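/- A lattice 3-polytope is the convex hull $P\subset\mathbb R^3$ of a finite subset of $\mathbb Z^3$ that contains four affinely independent points; its size is $\#(P\cap\mathbb Z^3)$. Two of them are $\mathbb Z$-equivalent if an affine automorphism $t$ of $\mathbb R^3$ with $t(\mathbb Z^3)=\mathbb Z^3$ maps one onto the other. The width of $P$ is the minimum of $\max_P f-\min_P f$ over the non-constant affine functionals $f:\mathbb R^3\to\mathbb R$ with $f(\mathbb Z^3)\subset\mathbb Z$. If $P$ has size $5$, its five lattice points have, up to a scalar factor, a unique non-zero affine dependence; $P$ has signature $(i,j)$ if this dependence has $i$ positive and $j$ negative coefficients (signatures $(i,j)$ and $(j,i)$ are the same). The volume vector of $p_1,\dots,p_5\in\mathbb Z^3$ is $(w_{2345},-w_{1345},w_{1245},-w_{1235},w_{1234})$, up to a global sign, where $w_{ijkl}$ is the determinant of the $4\times4$ matrix with columns $(1,p_i),(1,p_j),(1,p_k),(1,p_l)$. **Theorem.** Consider the following table, in which $p,q,a,b$ are integers. | Signature | Volume vector | Width | Lattice points | |---|---|---|---| | $(2,2)$ | $(-1,1,1,-1,0)$ | $1$ | $(0,0,0),(1,0,0),(0,1,0),(1,1,0),(0,0,1)$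 | | $(2,1)$ | $(-2q,q,0,q,0)$, $0\le p\le q/2$, $\gcd(p,q)=1$ | $1$ | $(0,0,0),(1,0,0),(0,0,1),(-1,0,0),(p,q,1)$ | | $(3,2)$ | $(-a-b,a,b,1,-1)$, $0<a\le b$, $\gcd(a,b)=1$ | $1$ | $(0,0,0),(1,0,0),(0,1,0),(0,0,1),(a,b,1)$ | | $(3,1)$ | $(-3,1,1,1,0)$ | $1$ | $(0,0,0),(1,0,0),(0,1,0),(-1,-1,0),(0,0,1)$ | | $(3,1)$ | $(-9,3,3,3,0)$ | $2$ | $(0,0,0),(1,0,0),(0,1,0),(-1,-1,0),(1,2,3)$ | | $(4,1)$ | $(-4,1,1,1,1)$ | $2$ | $(0,0,0),(1,0,0),(0,0,1),(1,1,1),(-2,-1,-2)$ | | $(4,1)$ | $(-5,1,1,1,2)$ | $2$ | $(0,0,0),(1,0,0),(0,0,1),(1,2,1),(-1,-1,-1)$ | | $(4,1)$ | $(-7,1,1,2,3)$ | $2$ | $(0,0,0),(1,0,0),(0,0,1),(1,3,1),(-1,-2,-1)$ | | $(4,1)$ | $(-11,1,3,2,5)$ | $2$ | $(0,0,0),(1,0,0),(0,0,1),(2,5,1),(-1,-2,-1)$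 | | $(4,1)$ | $(-13,3,4,1,5)$ | $2$ | $(0,0,0),(1,0,0),(0,0,1),(2,5,1),(-1,-1,-1)$ | | $(4,1)$ | $(-17,3,5,2,7)$ | $2$ | $(0,0,0),(1,0,0),(0,0,1),(2,7,1),(-1,-2,-1)$ | | $(4,1)$ | $(-19,5,4,3,7)$ | $2$ | $(0,0,0),(1,0,0),(0,0,1),(3,7,1),(-2,-3,-1)$ | | $(4,1)$ | $(-20,5,5,5,5)$ | $2$ | $(0,0,0),(1,0,0),(0,0,1),(2,5,1),(-3,-5,-2)$ | 1. For every row and every admissible choice of its parameters, the convex hull of the five listed points is a lattice 3-polytope of size $5$ whose lattice points are exactly these five, and it has the listed signature, volume vector (in the listed order of the points) and width. 2. Every lattice 3-polytope of size $5$ is $\mathbb Z$-equivalent to the convex hull of the points of some row for some admissible choice of its parameters. 3. The table is irredundant: the polytopes of different rows, or of different choices of parameters within a row, are not $\mathbb Z$-equivalent. -/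

import Mathlib

namespace LatticePolytopes

/-- The real point with the given integer coordinates. -/
def intPoint {d : ℕ} (v : Fin d → ℤ) : Fin d → ℝ := fun i => (v i : ℝ)

/-- A lattice polytope in `ℝ^d`: the convex hull of a finite set of points of `ℤ^d`. -/
def IsLatticePolytope {d : ℕ} (P : Set (Fin d → ℝ)) : Prop :=
  ∃ S : Finset (Fin d → ℤ), P = convexHull ℝ (intPoint '' (S : Set (Fin d → ℤ)))

/-- `P ⊆ ℝ^d` is `d`-dimensional: it contains `d + 1` affinely independent points. -/
def IsFullDimensional {d : ℕ} (P : Set (Fin d → ℝ)) : Prop :=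
  ∃ p : Fin (d + 1) → Fin d → ℝ, AffineIndependent ℝ p ∧ ∀ i, p i ∈ P

/-- The lattice points of `P`. -/
def latticePoints {d : ℕ} (P : Set (Fin d → ℝ)) : Set (Fin d → ℤ) :=
  {v | intPoint v ∈ P}

/-- The number of lattice points of `P` (a polytope has finitely many). -/
noncomputable def size {d : ℕ} (P : Set (Fin d → ℝ)) : ℕ := (latticePoints P).ncard

/-- `ℤ`-equivalence: an affine automorphism of `ℝ^d` that maps `ℤ^d` onto `ℤ^d` and `P` onto `Q`. -/
def ZEquivalent {d : ℕ} (P Q : Set (Fin d → ℝ)) : Prop :=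
  ∃ t : (Fin d → ℝ) ≃ᵃ[ℝ] (Fin d → ℝ),
    t '' Set.range intPoint = Set.range intPoint ∧ t '' P = Q

/-- The width of `P` with respect to a functional (the maximum minus the minimum on a polytope). -/
noncomputable def widthAlong {d : ℕ} (f : (Fin d → ℝ) →ᵃ[ℝ] ℝ) (P : Set (Fin d → ℝ)) : ℝ :=
  sSup (f '' P) - sInf (f '' P)

/-- The width of `P` is `w`: the minimum of the widths with respect to the non-constant affine
functionals that are integral on `ℤ^d`. -/
def HasWidth {d : ℕ} (P : Set (Fin d → ℝ)) (w : ℝ) : Prop :=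
  IsLeast {r : ℝ | ∃ f : (Fin d → ℝ) →ᵃ[ℝ] ℝ,
    (∀ v : Fin d → ℤ, ∃ m : ℤ, f (intPoint v) = (m : ℝ)) ∧ (∃ x y, f x ≠ f y) ∧
      r = widthAlong f P} w

/-- The `d`-polytope `P` of size `d + 2` has signature `s`: the affine dependence of its lattice
points (unique up to a scalar factor) has `s.1` positive and `s.2` negative coefficients. Since the
dependence may be multiplied by `-1`, signatures `(i, j)` and `(j, i)` are the same. -/
def HasSignature {d : ℕ} (P : Set (Fin d → ℝ)) (s : ℕ × ℕ) : Prop :=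
  ∃ (p : Fin (d + 2) → Fin d → ℤ) (c : Fin (d + 2) → ℝ),
    Function.Injective p ∧ Set.range p = latticePoints P ∧
    c ≠ 0 ∧ ∑ k, c k • intPoint (p k) = 0 ∧ ∑ k, c k = 0 ∧
    {k | 0 < c k}.ncard = s.1 ∧ {k | c k < 0}.ncard = s.2

/-- The volume vector `(w₂₃₄₅, -w₁₃₄₅, w₁₂₄₅, -w₁₂₃₅, w₁₂₃₄)` of five points of `ℤ^3`, where
`wᵢⱼₖₗ` is the determinant of the matrix with columns `(1, pᵢ), (1, pⱼ), (1, pₖ), (1, pₗ)`. -/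
def volumeVector (p : Fin 5 → Fin 3 → ℤ) : Fin 5 → ℤ := fun k =>
  (-1) ^ (k : ℕ) *
    (Matrix.of fun (i j : Fin 4) => Fin.cons (α := fun _ => ℤ) 1 (p (k.succAbove j)) i).det

/-- The entries of the table: one constructor for each row, with the parameters of the row. -/
inductive TableEntry : Type
  | s22 : TableEntry
  | s21 (p q : ℤ) (hp : 0 ≤ p) (hpq : 2 * p ≤ q) (hgcd : Int.gcd p q = 1) : TableEntry
  | s32 (a b : ℤ) (ha : 0 < a) (hab : a ≤ b) (hgcd : Int.gcd a b = 1) : TableEntry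
  | s31_3 : TableEntry
  | s31_9 : TableEntry
  | s41_4 : TableEntry
  | s41_5 : TableEntry
  | s41_7 : TableEntry
  | s41_11 : TableEntry
  | s41_13 : TableEntry
  | s41_17 : TableEntry
  | s41_19 : TableEntry
  | s41_20 : TableEntry

namespace TableEntry

/-- The five points of the representative. -/
def points : TableEntry → Fin 5 → Fin 3 → ℤ
  | s22 => ![![0, 0, 0], ![1, 0, 0], ![0, 1, 0], ![1, 1, 0], ![0, 0, 1]]
  | s21 p q _ _ _ => ![![0, 0, 0], ![1, 0, 0], ![0, 0, 1], ![-1, 0, 0], ![p, q, 1]]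
  | s32 a b _ _ _ => ![![0, 0, 0], ![1, 0, 0], ![0, 1, 0], ![0, 0, 1], ![a, b, 1]]
  | s31_3 => ![![0, 0, 0], ![1, 0, 0], ![0, 1, 0], ![-1, -1, 0], ![0, 0, 1]]
  | s31_9 => ![![0, 0, 0], ![1, 0, 0], ![0, 1, 0], ![-1, -1, 0], ![1, 2, 3]]
  | s41_4 => ![![0, 0, 0], ![1, 0, 0], ![0, 0, 1], ![1, 1, 1], ![-2, -1, -2]]
  | s41_5 => ![![0, 0, 0], ![1, 0, 0], ![0, 0, 1], ![1, 2, 1], ![-1, -1, -1]]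
  | s41_7 => ![![0, 0, 0], ![1, 0, 0], ![0, 0, 1], ![1, 3, 1], ![-1, -2, -1]]
  | s41_11 => ![![0, 0, 0], ![1, 0, 0], ![0, 0, 1], ![2, 5, 1], ![-1, -2, -1]]
  | s41_13 => ![![0, 0, 0], ![1, 0, 0], ![0, 0, 1], ![2, 5, 1], ![-1, -1, -1]]
  | s41_17 => ![![0, 0, 0], ![1, 0, 0], ![0, 0, 1], ![2, 7, 1], ![-1, -2, -1]]
  | s41_19 => ![![0, 0, 0], ![1, 0, 0], ![0, 0, 1], ![3, 7, 1], ![-2, -3, -1]]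
  | s41_20 => ![![0, 0, 0], ![1, 0, 0], ![0, 0, 1], ![2, 5, 1], ![-3, -5, -2]]

/-- The representative as a polytope: the convex hull of its five points. -/
def polytope (e : TableEntry) : Set (Fin 3 → ℝ) :=
  convexHull ℝ (Set.range fun k => intPoint (e.points k))

/-- The signature column. -/
def tableSignature : TableEntry → ℕ × ℕ
  | s22 => (2, 2)
  | s21 _ _ _ _ _ => (2, 1)
  | s32 _ _ _ _ _ => (3, 2)
  | s31_3 => (3, 1)
  | s31_9 => (3, 1)
  | s41_4 => (4, 1)
  | s41_5 => (4, 1)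
  | s41_7 => (4, 1)
  | s41_11 => (4, 1)
  | s41_13 => (4, 1)
  | s41_17 => (4, 1)
  | s41_19 => (4, 1)
  | s41_20 => (4, 1)

/-- The volume vector column. -/
def tableVolumeVector : TableEntry → Fin 5 → ℤ
  | s22 => ![-1, 1, 1, -1, 0]
  | s21 _ q _ _ _ => ![-2 * q, q, 0, q, 0]
  | s32 a b _ _ _ => ![-a - b, a, b, 1, -1]
  | s31_3 => ![-3, 1, 1, 1, 0]
  | s31_9 => ![-9, 3, 3, 3, 0]
  | s41_4 => ![-4, 1, 1, 1, 1]
  | s41_5 => ![-5, 1, 1, 1, 2]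
  | s41_7 => ![-7, 1, 1, 2, 3]
  | s41_11 => ![-11, 1, 3, 2, 5]
  | s41_13 => ![-13, 3, 4, 1, 5]
  | s41_17 => ![-17, 3, 5, 2, 7]
  | s41_19 => ![-19, 5, 4, 3, 7]
  | s41_20 => ![-20, 5, 5, 5, 5]

/-- The width column. -/
def tableWidth : TableEntry → ℕ
  | s22 => 1
  | s21 _ _ _ _ _ => 1
  | s32 _ _ _ _ _ => 1
  | s31_3 => 1
  | s31_9 => 2
  | s41_4 => 2
  | s41_5 => 2
  | s41_7 => 2
  | s41_11 => 2
  | s41_13 => 2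
  | s41_17 => 2
  | s41_19 => 2
  | s41_20 => 2

end TableEntry

end LatticePolytopes

/-! A polytope of size 5 is the hull of its lattice points, so the theorem concerns five points of
ℤ³ whose hull contains no other lattice point, together with their affine dependence `c` (`Config`).
Sorting the coefficients leaves five sign patterns up to a global sign: (2,2), (2,1), (3,2), (3,1),
(4,1).

Two rigidity facts drive every case. An empty lattice triangle is unimodular
(`EmptyTriangle.exists_equiv`), so three of the points can be moved to 0, e₁, e₂ and a fourth to (a,
b, n) with n > 0. By White's theorem (`white_arith`, `Config.white`) an empty tetrahedron 0, e₁, e₂,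
(a, b, n) has width one along a pair of opposite edges: n divides a - 1, b - 1 or a + b. Its
arithmetic core is that ⌊kA/n⌋ + ⌊kB/n⌋ + ⌊kC/n⌋ = k - 1 for 0 < k < n, with A + B + C = n + 1,
forces one of A, B, C to be 1.

For (2,2), (2,1) and (3,2) this pins down the coordinates almost directly. For (3,1) and (4,1)
several tetrahedra share the point `p 0`, and each yields a White functional. The determinant of the
values of three functionals on e₁, e₂, (a, b, n) is divisible by n (`dvd_det_functional`). For (3,1)
this gives n ∣ 3. For (4,1) the primitive weights of the vertices are pairwise coprime and each
divides the sum of two others, which leaves seven quadruples (`weights_classification`). The index g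
of the sublattice generated by the points is prime to 6 (`index_coprime_six`), and the determinants
then give g = 1, except that g = 5 is also possible for the weights (1,1,1,1).

Each row is checked from explicit valid inequalities of the hull. For irredundancy, the absolute
values of the volume vector are invariant up to permutation. They separate all entries except the
parameter p of the (2,1) family, which is recovered from the action of the equivalence on the
collinear triple. -/

namespace LatticePolytopes

/-! ### White's theorem: floor sums and residues -/

set_option maxHeartbeats 800000 in
/-- The floor identity behind White's theorem, with one of the three slopes at least `1/2`. -/
lemma floor_sum_two {n A B D : ℤ} (hA : 2 ≤ A) (hAB : A ≤ B) (hD : 2 * D < n) (hsum : A + B = D + 1)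
    (h : ∀ k, 0 < k → k < n → k * A / n + k * B / n = k * D / n) : False := by
  have hn : 0 < n := by linarith
  have hA0 : 0 < A := by linarith
  have hB0 : 0 < B := by linarith
  -- Here x = ⌈n/A⌉ is the first argument at which ⌊xA/n⌋ reaches 1.
  obtain ⟨x, hx1, hx2⟩ : ∃ x, (x - 1) * A < n ∧ n ≤ x * A :=
    ⟨(n - 1) / A + 1, by nlinarith [Int.ediv_mul_le (n - 1) hA0.ne'],
      by nlinarith [Int.lt_ediv_add_one_mul_self (n - 1) hA0]⟩
  have hx0 : 1 < x := by nlinarith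
  have hxn : x < n := by nlinarith
  have fl : ∀ m q : ℤ, q * n ≤ m → m < (q + 1) * n → m / n = q := by
    intro m q h1 h2
    apply le_antisymm
    · exact Int.lt_add_one_iff.mp ((Int.ediv_lt_iff_lt_mul hn).2 h2)
    · exact (Int.le_ediv_iff_mul_le hn).2 h1
  have le_fl : ∀ m : ℤ, m / n * n ≤ m := fun m => Int.ediv_mul_le m hn.ne'
  have lt_fl : ∀ m : ℤ, m < (m / n + 1) * n := fun m => Int.lt_ediv_add_one_mul_self m hn
  set j := x * B / n with hj
  have hj1 : j * n ≤ x * B := le_fl _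
  have hj2 : x * B < (j + 1) * n := lt_fl _
  have hj0 : 1 ≤ j := by
    rw [hj, Int.le_ediv_iff_mul_le hn]; nlinarith
  have hFAx : x * A / n = 1 := fl _ _ (by linarith) (by nlinarith)
  have hFAx' : (x - 1) * A / n = 0 := fl _ _ (by nlinarith) (by nlinarith)
  have e1 := h x (by linarith) hxn
  have e2 := h (x - 1) (by linarith) (by linarith)
  rw [hFAx] at e1
  rw [hFAx'] at e2
  -- `x` is not a jump of `B`
  have hjx : j ≤ (x - 1) * B / n := by
    have h1 := le_fl (x * D)
    have h2 := lt_fl ((x - 1) * D)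
    by_contra hlt
    push Not at hlt
    have : (x - 1) * D / n + 2 ≤ x * D / n := by omega
    nlinarith
  have hjx' : j * n ≤ (x - 1) * B := (Int.le_ediv_iff_mul_le hn).1 hjx
  -- The floor of the B-multiples first reaches j at u and first reaches j + 1 at v; x lies strictly
  -- between these two jumps.
  obtain ⟨u, hu1, hu2⟩ : ∃ u, (u - 1) * B < j * n ∧ j * n ≤ u * B :=
    ⟨(j * n - 1) / B + 1, by nlinarith [Int.ediv_mul_le (j * n - 1) hB0.ne'],
      by nlinarith [Int.lt_ediv_add_one_mul_self (j * n - 1) hB0]⟩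
  obtain ⟨v, hv1, hv2⟩ : ∃ v, (v - 1) * B < (j + 1) * n ∧ (j + 1) * n ≤ v * B :=
    ⟨((j + 1) * n - 1) / B + 1, by nlinarith [Int.ediv_mul_le ((j + 1) * n - 1) hB0.ne'],
      by nlinarith [Int.lt_ediv_add_one_mul_self ((j + 1) * n - 1) hB0]⟩
  have hux : u ≤ x - 1 := by
    have : (u - 1) * B < (x - 1) * B := by linarith
    have := lt_of_mul_lt_mul_right this hB0.le
    linarith
  have hvx : x + 1 ≤ v := by
    have : x * B < v * B := by linarith
    have := lt_of_mul_lt_mul_right this hB0.le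
    linarith
  have hjB : j + 1 < B := by
    -- from `j n ≤ (x-1) B` and `(x-1) A < n`
    have h1 : j * A < B := by
      have : j * n * A < B * n := by nlinarith
      have : j * A * n < B * n := by linarith
      exact lt_of_mul_lt_mul_right this hn.le
    nlinarith
  have hvn : v < n := by
    have h1 : (j + 1) * n ≤ (B - 1) * n := mul_le_mul_of_nonneg_right (by linarith) hn.le
    have : (v - 1) * B < (n - 1) * B := by linarith
    have := lt_of_mul_lt_mul_right this hB0.le
    linarith
  have hu0 : 1 ≤ u := by
    have : 0 < u * B := by nlinarith
    exact pos_of_mul_pos_left this hB0.le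
  -- the value at `v`
  have e3 := h v (by linarith) hvn
  have hFBv : j + 1 ≤ v * B / n := (Int.le_ediv_iff_mul_le hn).2 hv2
  have hFAv : 1 ≤ v * A / n := (Int.le_ediv_iff_mul_le hn).2 (by nlinarith)
  have hDv : (j + 2) * n ≤ v * D := (Int.le_ediv_iff_mul_le hn).1 (by omega)
  -- the value at `u - 1`
  have hDu : (u - 1) * D < j * n := by
    rcases eq_or_lt_of_le hu0 with hu | hu
    · rw [← hu]; nlinarith
    · have e4 := h (u - 1) (by linarith) (by linarith)
      have hFBu : (u - 1) * B / n < j := (Int.ediv_lt_iff_lt_mul hn).2 hu1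
      have hFAu : (u - 1) * A / n < 1 := (Int.ediv_lt_iff_lt_mul hn).2 (by nlinarith)
      exact (Int.ediv_lt_iff_lt_mul hn).1 (by omega)
  -- the value at `v - u - 1`
  have hvu : (v - u - 1) * B < n := by nlinarith
  have hDvu : (v - u - 1) * D < n := by
    rcases le_or_gt (v - u - 1) 0 with h0 | h0
    · nlinarith
    · have e5 := h _ h0 (by linarith)
      have h1 : (v - u - 1) * B / n < 1 := (Int.ediv_lt_iff_lt_mul hn).2 (by linarith)
      have h2 : (v - u - 1) * A / n < 1 := (Int.ediv_lt_iff_lt_mul hn).2 (by nlinarith)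
      have := (Int.ediv_lt_iff_lt_mul hn).1 (show (v - u - 1) * D / n < 1 by omega)
      linarith
  -- From `hDv` and `hDu`, (v - u + 1)D > 2n, while (v - u - 1)D < n; subtracting gives 2D > n.
  nlinarith

/-- Disjoint jump sets covering everything: one of the slopes is trivial. -/
lemma floor_sum_three {n A B C : ℤ} (hA : 0 < A) (hB : 0 < B) (hAB : A ≤ B) (hC : C < n)
    (hCn : n ≤ 2 * C) (hsum : A + B + C = n + 1) (hdvd : ∀ k, 0 < k → k < n → ¬ n ∣ k * C)
    (h : ∀ k, 0 < k → k < n → k * A / n + k * B / n + k * C / n = k - 1) : A = 1 ∨ n ≤ 2 := by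
  by_contra hcon
  push Not at hcon
  obtain ⟨h1, h2⟩ := hcon
  have h2C : 2 * C ≠ n := by
    intro h3
    exact hdvd 2 (by norm_num) h2 ⟨1, by linarith⟩
  -- Since n never divides kC, ⌊k(n - C)/n⌋ = k - 1 - ⌊kC/n⌋. Replacing C by D = n - C turns the
  -- three-term identity into the two-term one, and C > n/2 becomes 2D < n.
  refine floor_sum_two (n := n) (A := A) (B := B) (D := n - C) (by omega) hAB (by omega) (by omega)
    fun k hk hkn => ?_
  have := h k hk hkn
  have hn : 0 < n := by omega
  have key : k * (n - C) / n = k - 1 - k * C / n := by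
    have h4 := Int.ediv_mul_le (k * C) hn.ne'
    have h5 := Int.lt_ediv_add_one_mul_self (k * C) hn
    have h6 : k * C / n * n ≠ k * C := fun h7 => hdvd k hk hkn ⟨_, by rw [← h7, mul_comm]⟩
    have h7 : k * C / n * n < k * C := lt_of_le_of_ne h4 h6
    apply le_antisymm
    · exact Int.lt_add_one_iff.mp ((Int.ediv_lt_iff_lt_mul hn).2 (by nlinarith))
    · exact (Int.le_ediv_iff_mul_le hn).2 (by nlinarith)
  omega

/-- At k = 2 the floors sum to 1, so one of the three slopes is at least n/2 and can play the role
of C in `floor_sum_three`. -/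
lemma floor_sum_three' {n A B C : ℤ} (hA : 0 < A) (hB : 0 < B) (hC : 0 < C)
    (hn : 2 ≤ n) (hsum : A + B + C = n + 1)
    (hdA : ∀ k, 0 < k → k < n → ¬ n ∣ k * A)
    (hdB : ∀ k, 0 < k → k < n → ¬ n ∣ k * B) (hdC : ∀ k, 0 < k → k < n → ¬ n ∣ k * C)
    (h : ∀ k, 0 < k → k < n → k * A / n + k * B / n + k * C / n = k - 1) :
    A = 1 ∨ B = 1 ∨ C = 1 := by
  rcases le_or_gt n 2 with h2 | h2
  · omega
  by_contra hcon
  push Not at hcon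
  obtain ⟨hA1, hB1, hC1⟩ := hcon
  have hn0 : 0 < n := by omega
  have e := h 2 (by norm_num) h2
  have hbig : n ≤ 2 * A ∨ n ≤ 2 * B ∨ n ≤ 2 * C := by
    by_contra hcon
    push Not at hcon
    obtain ⟨a1, a2, a3⟩ := hcon
    rw [Int.ediv_eq_zero_of_lt (by omega) a1, Int.ediv_eq_zero_of_lt (by omega) a2,
      Int.ediv_eq_zero_of_lt (by omega) a3] at e
    norm_num at e
  have key : ∀ A B C : ℤ, 1 < A → 1 < B → 1 < C → A + B + C = n + 1 → n ≤ 2 * C →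
      (∀ k, 0 < k → k < n → ¬ n ∣ k * C) →
      (∀ k, 0 < k → k < n → k * A / n + k * B / n + k * C / n = k - 1) → False := by
    intro A B C hA hB hC hs hb hd hf
    rcases le_total A B with hl | hl
    · rcases floor_sum_three (by omega) (by omega) hl (by omega) hb hs hd hf with h | h <;> omega
    · rcases floor_sum_three (n := n) (A := B) (B := A) (C := C) (by omega) (by omega) hl (by omega)
        hb (by omega) hd (fun k h1 h2 => by have := hf k h1 h2; omega) with h | h <;> omega
  rcases hbig with hb | hb | hb
  · exact key B C A (by omega) (by omega) (by omega) (by omega) hb hdA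
      fun k h1 h2 => by have := h k h1 h2; omega
  · exact key A C B (by omega) (by omega) (by omega) (by omega) hb hdB
      fun k h1 h2 => by have := h k h1 h2; omega
  · exact key A B C (by omega) (by omega) (by omega) (by omega) hb hdC
      fun k h1 h2 => by have := h k h1 h2; omega

/-- White's theorem, arithmetic form: if the tetrahedron with vertices `0, e₁, e₂, (a, b, n)` has no
lattice points at the heights `1, …, n - 1`, then it has width one with respect to a pair of
opposite edges. -/
theorem white_arith {a b n : ℤ} (hn : 0 < n)
    (h : ∀ k x y : ℤ, 0 < k → k < n → k * a ≤ n * x → k * b ≤ n * y →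
      n * (x + y) ≤ k * (a + b) + (n - k) → False) :
    n ∣ a - 1 ∨ n ∣ b - 1 ∨ n ∣ a + b := by
  rcases eq_or_lt_of_le (show 1 ≤ n from hn) with h1 | h1
  · left; rw [← h1]; exact one_dvd _
  -- At height k the smallest candidates are x = ⌈ka/n⌉ and y = ⌈kb/n⌉, whose excesses nx - ka and
  -- ny - kb are these residues. Emptiness says that even they violate the third inequality.
  have E : ∀ k, 0 < k → k < n → n - k < (-(k * a)) % n + (-(k * b)) % n := by
    intro k hk hkn
    by_contra hcon
    push Not at hcon
    have ha := Int.emod_add_mul_ediv (-(k * a)) n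
    have hb := Int.emod_add_mul_ediv (-(k * b)) n
    have ha0 := Int.emod_nonneg (-(k * a)) hn.ne'
    have hb0 := Int.emod_nonneg (-(k * b)) hn.ne'
    refine h k (-(-(k * a) / n)) (-(-(k * b) / n)) hk hkn ?_ ?_ ?_ <;> linarith
  have negmod : ∀ m : ℤ, ¬ n ∣ m → (-m) % n = n - m % n := by
    intro m hm
    rw [Int.neg_emod, if_neg hm, Int.natAbs_of_nonneg hn.le]
  have F : ∀ k, 0 < k → k < n → ¬ n ∣ k * a ∧ ¬ n ∣ k * b := by
    intro k hk hkn
    have e1 := E k hk hkn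
    have e2 := E (n - k) (by linarith) (by linarith)
    have r1 : (-((n - k) * a)) % n = (k * a) % n := by
      rw [show -((n - k) * a) = k * a + n * (-a) by ring, Int.add_mul_emod_self_left]
    have r2 : (-((n - k) * b)) % n = (k * b) % n := by
      rw [show -((n - k) * b) = k * b + n * (-b) by ring, Int.add_mul_emod_self_left]
    rw [r1, r2] at e2
    have la := Int.emod_lt_of_pos (k * a) hn
    have lb := Int.emod_lt_of_pos (k * b) hn
    have ha0 := Int.emod_nonneg (k * a) hn.ne'
    have hb0 := Int.emod_nonneg (k * b) hn.ne'
    by_cases ha : n ∣ k * a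
    · exfalso
      rw [Int.emod_eq_zero_of_dvd ha] at e2
      rw [Int.emod_eq_zero_of_dvd (dvd_neg.2 ha)] at e1
      by_cases hb : n ∣ k * b
      · rw [Int.emod_eq_zero_of_dvd hb] at e2; linarith
      · rw [negmod _ hb] at e1; linarith
    · refine ⟨ha, fun hb => ?_⟩
      rw [Int.emod_eq_zero_of_dvd hb] at e2
      rw [Int.emod_eq_zero_of_dvd (dvd_neg.2 hb), negmod _ ha] at e1
      linarith
  -- The condition at height n - k gives the lower bound and the one at height k, with both residues
  -- reflected, the upper bound.
  have G : ∀ k, 0 < k → k < n → k < (k * a) % n + (k * b) % n ∧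
      (k * a) % n + (k * b) % n < n + k := by
    intro k hk hkn
    have e1 := E k hk hkn
    have e2 := E (n - k) (by linarith) (by linarith)
    have r1 : (-((n - k) * a)) % n = (k * a) % n := by
      rw [show -((n - k) * a) = k * a + n * (-a) by ring, Int.add_mul_emod_self_left]
    have r2 : (-((n - k) * b)) % n = (k * b) % n := by
      rw [show -((n - k) * b) = k * b + n * (-b) by ring, Int.add_mul_emod_self_left]
    rw [r1, r2] at e2
    rw [negmod _ (F k hk hkn).1, negmod _ (F k hk hkn).2] at e1
    constructor <;> linarith
  set A := a % n with hA
  set B := b % n with hB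
  obtain ⟨g1, g2⟩ := G 1 (by norm_num) h1
  obtain ⟨f1, f2⟩ := F 1 (by norm_num) h1
  rw [one_mul, one_mul] at g1 g2
  rw [one_mul] at f1 f2
  have hA0 : 0 < A := lt_of_le_of_ne (Int.emod_nonneg _ hn.ne')
    fun h => f1 (Int.dvd_of_emod_eq_zero h.symm)
  have hB0 : 0 < B := lt_of_le_of_ne (Int.emod_nonneg _ hn.ne')
    fun h => f2 (Int.dvd_of_emod_eq_zero h.symm)
  have mA : ∀ k, (k * A) % n = (k * a) % n := fun k => by
    rw [hA, Int.mul_emod, Int.emod_emod, ← Int.mul_emod]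
  have mB : ∀ k, (k * B) % n = (k * b) % n := fun k => by
    rw [hB, Int.mul_emod, Int.emod_emod, ← Int.mul_emod]
  -- By `G`, n + k minus the first two residues lies strictly between 0 and n, so it is the third
  -- residue. Since the three numbers sum to k(n + 1), their floors sum to k - 1.
  have H : ∀ k, 0 < k → k < n → 0 < (k * (n + 1 - A - B)) % n ∧
      (k * A) % n + (k * B) % n + (k * (n + 1 - A - B)) % n = n + k := by
    intro k hk hkn
    obtain ⟨g1, g2⟩ := G k hk hkn
    rw [← mA, ← mB] at g1 g2
    have ea := Int.emod_add_mul_ediv (k * A) n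
    have eb := Int.emod_add_mul_ediv (k * B) n
    have : (k * (n + 1 - A - B)) % n = n + k - (k * A) % n - (k * B) % n := by
      rw [show k * (n + 1 - A - B) = (n + k - (k * A) % n - (k * B) % n) +
        n * (k - 1 - k * A / n - k * B / n) by linarith, Int.add_mul_emod_self_left]
      exact Int.emod_eq_of_lt (by linarith) (by linarith)
    rw [this]
    constructor <;> linarith
  have main := floor_sum_three' (n := n) (A := A) (B := B) (C := n + 1 - A - B) hA0 hB0 (by linarith)
    (by linarith) (by ring)
    (fun k h1 h2 h3 => (F k h1 h2).1
      (Int.dvd_of_emod_eq_zero (by rw [← mA]; exact Int.emod_eq_zero_of_dvd h3)))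
    (fun k h1 h2 h3 => (F k h1 h2).2
      (Int.dvd_of_emod_eq_zero (by rw [← mB]; exact Int.emod_eq_zero_of_dvd h3)))
    (fun k h1 h2 h3 => (H k h1 h2).1.ne' (Int.emod_eq_zero_of_dvd h3))
    (fun k h1 h2 => by
      have e := (H k h1 h2).2
      have ea := Int.emod_add_mul_ediv (k * A) n
      have eb := Int.emod_add_mul_ediv (k * B) n
      have ec := Int.emod_add_mul_ediv (k * (n + 1 - A - B)) n
      have : n * (k * A / n + k * B / n + k * (n + 1 - A - B) / n) = n * (k - 1) := by linarith
      exact mul_left_cancel₀ hn.ne' this)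
  have da : n ∣ a - A := Int.dvd_self_sub_emod
  have db : n ∣ b - B := Int.dvd_self_sub_emod
  rcases main with h | h | h
  · left; rwa [h] at da
  · right; left; rwa [h] at db
  · right; right
    have : a + b = (a - A) + (b - B) + n := by linarith
    rw [this]
    exact dvd_add (dvd_add da db) dvd_rfl

/-! ### Coprime weights, each dividing a sum of two others -/

lemma eq_or_eq_two_mul_of_dvd {z s : ℤ} (hs : 0 < s) (h : z ∣ s) (h2 : s ≤ 2 * z) :
    s = z ∨ s = 2 * z := by
  obtain ⟨k, rfl⟩ := h
  have hz : 0 < z := by linarith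
  have h0 : 0 < k := pos_of_mul_pos_right hs hz.le
  have h1 : k ≤ 2 := by nlinarith
  interval_cases k <;> omega

lemma eq_or_eq_two_mul_or_eq_three_mul_of_dvd {z s : ℤ} (hs : 0 < s) (h : z ∣ s)
    (h2 : s ≤ 3 * z) : s = z ∨ s = 2 * z ∨ s = 3 * z := by
  obtain ⟨k, rfl⟩ := h
  have hz : 0 < z := by linarith
  have h0 : 0 < k := pos_of_mul_pos_right hs hz.le
  have h1 : k ≤ 3 := by nlinarith
  interval_cases k <;> omega

lemma le_of_dvd_mul_of_isCoprime {y x m : ℤ} (h : IsCoprime y x) (hm : 0 < m) (hd : y ∣ m * x) :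
    y ≤ m := Int.le_of_dvd hm (h.dvd_of_dvd_mul_right hd)

lemma dvd_of_eq_add_mul {y s s' k : ℤ} (h : y ∣ s) (e : s = s' + y * k) : y ∣ s' := by
  rw [e] at h
  exact (dvd_add_left (dvd_mul_right y k)).1 h

/-- Pairwise coprime positive integers, each of which divides the sum of two of the others. -/
theorem weights_bounded {x y z t : ℤ} (hx : 0 < x) (hxy : x ≤ y) (hyz : y ≤ z) (hzt : z ≤ t)
    (cxy : IsCoprime x y) (cxz : IsCoprime x z) (cyz : IsCoprime y z)
    (dy : y ∣ x + z ∨ y ∣ x + t ∨ y ∣ z + t) (dz : z ∣ x + y ∨ z ∣ x + t ∨ z ∣ y + t)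
    (dt : t ∣ x + y ∨ t ∣ x + z ∨ t ∣ y + z) :
    y ≤ 4 ∧ ((t = x + y ∨ t = x + z ∨ t = y + z) ∨ z = 1 ∧ t = 1) ∧
      (z = x + y ∨ z ≤ 2 ∨ 2 * x + y = 2 * z ∨ x + 2 * y = 2 * z) := by
  -- The largest weight divides a sum of at most 2t, so the sum is t or 2t; the latter makes two
  -- coprime weights equal, hence equal to 1.
  have ht : (t = x + y ∨ t = x + z ∨ t = y + z) ∨ z = 1 ∧ t = 1 := by
    rcases dt with d | d | d
    · rcases eq_or_eq_two_mul_of_dvd (by omega) d (by omega) with h | h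
      · omega
      · have hy : x = y := by omega
        subst hy
        have := isCoprime_self.1 cxy
        have := Int.isUnit_iff.1 this
        omega
    · rcases eq_or_eq_two_mul_of_dvd (by omega) d (by omega) with h | h
      · omega
      · have hy : x = z := by omega
        subst hy
        have := Int.isUnit_iff.1 (isCoprime_self.1 cxz)
        omega
    · rcases eq_or_eq_two_mul_of_dvd (by omega) d (by omega) with h | h
      · omega
      · have hy : y = z := by omega
        subst hy
        have := Int.isUnit_iff.1 (isCoprime_self.1 cyz)
        omega
  have zxy : z ∣ x + y → z = x + y ∨ z = 1 := fun d => by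
    rcases eq_or_eq_two_mul_of_dvd (by omega) d (by omega) with h | h
    · omega
    · have hy : x = y := by omega
      subst hy
      have := Int.isUnit_iff.1 (isCoprime_self.1 cxy)
      omega
  have y2x : y ∣ 2 * x → y ≤ 2 := le_of_dvd_mul_of_isCoprime cxy.symm (by norm_num)
  have y3x : y ∣ 3 * x → y ≤ 3 := le_of_dvd_mul_of_isCoprime cxy.symm (by norm_num)
  have z2x : z ∣ 2 * x → z ≤ 2 := le_of_dvd_mul_of_isCoprime cxz.symm (by norm_num)
  have z2y : z ∣ 2 * y → z ≤ 2 := le_of_dvd_mul_of_isCoprime cyz.symm (by norm_num)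
  rcases ht with (h | h | h) | ⟨h1, h2⟩
  · subst h
    have hz : z = x + y ∨ z ≤ 2 ∨ 2 * x + y = 2 * z ∨ x + 2 * y = 2 * z := by
      rcases dz with d | d | d
      · rcases zxy d with h | h <;> omega
      · rcases eq_or_eq_two_mul_or_eq_three_mul_of_dvd (by omega) d (by omega) with h | h | h
        · omega
        · omega
        · have hy : x = z := by omega
          subst hy
          have := Int.isUnit_iff.1 (isCoprime_self.1 cxz)
          omega
      · rcases eq_or_eq_two_mul_or_eq_three_mul_of_dvd (by omega) d (by omega) with h | h | h
        · omega
        · omega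
        · have hy : y = z := by omega
          subst hy
          have := Int.isUnit_iff.1 (isCoprime_self.1 cyz)
          omega
    refine ⟨?_, by omega, hz⟩
    rcases hz with h | h | h | h
    · have hx1 : x + y = z := h.symm
      subst hx1
      rcases dy with d | d | d
      · exact (y2x (dvd_of_eq_add_mul (k := 1) d (by ring))).trans (by norm_num)
      · exact (y2x (dvd_of_eq_add_mul (k := 1) d (by ring))).trans (by norm_num)
      · exact (y2x (dvd_of_eq_add_mul (k := 2) d (by ring))).trans (by norm_num)
    · omega
    · obtain ⟨s, rfl⟩ : ∃ s, y = 2 * s := ⟨z - x, by omega⟩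
      obtain rfl : z = x + s := by omega
      have cs : IsCoprime s x := (cxy.of_mul_right_right).symm
      have hs : s ≤ 2 := by
        have hd : 2 * s ∣ 2 * x + s ∨ 2 * s ∣ 2 * x + 2 * s ∨ 2 * s ∣ 2 * x + 3 * s := by
          rcases dy with d | d | d
          · left; rwa [show 2 * x + s = x + (x + s) by ring]
          · right; left; rwa [show 2 * x + 2 * s = x + (x + 2 * s) by ring]
          · right; right; rwa [show 2 * x + 3 * s = x + s + (x + 2 * s) by ring]
        refine le_of_dvd_mul_of_isCoprime cs (by norm_num) ?_
        rcases hd with d | d | d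
        · exact dvd_of_eq_add_mul (k := 1) (dvd_trans (dvd_mul_left s 2) d) (by ring)
        · exact dvd_of_eq_add_mul (k := 2) (dvd_trans (dvd_mul_left s 2) d) (by ring)
        · exact dvd_of_eq_add_mul (k := 3) (dvd_trans (dvd_mul_left s 2) d) (by ring)
      omega
    · obtain ⟨s, rfl⟩ : ∃ s, x = 2 * s := ⟨z - y, by omega⟩
      obtain rfl : z = s + y := by omega
      have cs : IsCoprime y s := (cxy.of_mul_left_right).symm
      rcases dy with d | d | d
      · exact (le_of_dvd_mul_of_isCoprime cs (m := 3) (by norm_num)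
          (dvd_of_eq_add_mul (k := 1) d (by ring))).trans (by norm_num)
      · exact (le_of_dvd_mul_of_isCoprime cs (m := 4) (by norm_num)
          (dvd_of_eq_add_mul (k := 1) d (by ring))).trans (by norm_num)
      · exact (le_of_dvd_mul_of_isCoprime cs (m := 3) (by norm_num)
          (dvd_of_eq_add_mul (k := 2) d (by ring))).trans (by norm_num)
  · subst h
    have hz : z = x + y ∨ z ≤ 2 := by
      rcases dz with d | d | d
      · rcases zxy d with h | h <;> omega
      · exact Or.inr (z2x (dvd_of_eq_add_mul (k := 1) d (by ring)))
      · rcases zxy (dvd_of_eq_add_mul (k := 1) d (by ring)) with h | h <;> omega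
    refine ⟨?_, by omega, by omega⟩
    rcases hz with h | h
    · subst h
      rcases dy with d | d | d
      · exact (y2x (dvd_of_eq_add_mul (k := 1) d (by ring))).trans (by norm_num)
      · exact (y3x (dvd_of_eq_add_mul (k := 1) d (by ring))).trans (by norm_num)
      · exact (y3x (dvd_of_eq_add_mul (k := 2) d (by ring))).trans (by norm_num)
    · omega
  · subst h
    have hz : z = x + y ∨ z ≤ 2 := by
      rcases dz with d | d | d
      · rcases zxy d with h | h <;> omega
      · rcases zxy (dvd_of_eq_add_mul (k := 1) d (by ring)) with h | h <;> omega
      · exact Or.inr (z2y (dvd_of_eq_add_mul (k := 1) d (by ring)))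
    refine ⟨?_, by omega, by omega⟩
    rcases hz with h | h
    · subst h
      rcases dy with d | d | d
      · exact (y2x (dvd_of_eq_add_mul (k := 1) d (by ring))).trans (by norm_num)
      · exact (y2x (dvd_of_eq_add_mul (k := 2) d (by ring))).trans (by norm_num)
      · exact (y2x (dvd_of_eq_add_mul (k := 3) d (by ring))).trans (by norm_num)
    · omega
  · omega

/-- `weights_bounded` gives y ≤ 4, hence z ≤ 8, and makes t a sum of two others unless z = t = 1, so
a finite search remains. These are the possible barycentric weights in signature (4,1). -/
theorem weights_classification {x y z t : ℤ} (hx : 0 < x) (hxy : x ≤ y) (hyz : y ≤ z) (hzt : z ≤ t)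
    (cxy : IsCoprime x y) (cxz : IsCoprime x z) (cyz : IsCoprime y z) (cxt : IsCoprime x t)
    (cyt : IsCoprime y t) (czt : IsCoprime z t)
    (dx : x ∣ y + z ∨ x ∣ y + t ∨ x ∣ z + t)
    (dy : y ∣ x + z ∨ y ∣ x + t ∨ y ∣ z + t) (dz : z ∣ x + y ∨ z ∣ x + t ∨ z ∣ y + t)
    (dt : t ∣ x + y ∨ t ∣ x + z ∨ t ∣ y + z) :
    (x = 1 ∧ y = 1 ∧ z = 1 ∧ t = 1) ∨ (x = 1 ∧ y = 1 ∧ z = 1 ∧ t = 2) ∨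
    (x = 1 ∧ y = 1 ∧ z = 2 ∧ t = 3) ∨ (x = 1 ∧ y = 2 ∧ z = 3 ∧ t = 5) ∨
    (x = 1 ∧ y = 3 ∧ z = 4 ∧ t = 5) ∨ (x = 2 ∧ y = 3 ∧ z = 5 ∧ t = 7) ∨
    (x = 3 ∧ y = 4 ∧ z = 5 ∧ t = 7) := by
  obtain ⟨hy4, ht, hz⟩ := weights_bounded hx hxy hyz hzt cxy cxz cyz dy dz dt
  rw [Int.isCoprime_iff_gcd_eq_one] at *
  have hz8 : z ≤ 8 := by omega
  have hy0 : 0 < y := by omega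
  have hz0 : 0 < z := by omega
  have hx4 : x ≤ 4 := by omega
  clear dt
  interval_cases y <;> interval_cases x <;> first
    | (exfalso; revert cxy; decide)
    | (interval_cases z <;> first
        | (exfalso; revert cyz; decide)
        | (exfalso; revert cxz; decide)
        | (exfalso; omega)
        | (rcases ht with (h | h | h) | ⟨h, h'⟩ <;> subst t <;> first
            | (exfalso; revert cxt; decide)
            | (exfalso; revert cyt; decide)
            | (exfalso; revert czt; decide)
            | omega))

/-! ### Configurations of five points and their symmetries -/

/-- A configuration of five lattice points in space, not all in a plane, such that every lattice
point in their convex hull is one of them, together with their affine dependence. -/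
structure Config (p : Fin 5 → Fin 3 → ℤ) (c : Fin 5 → ℤ) : Prop where
  inj : Function.Injective p
  closed : ∀ (v : Fin 3 → ℤ) (a : Fin 5 → ℤ), (∀ k, 0 ≤ a k) → 0 < ∑ k, a k →
    (∑ k, a k) • v = ∑ k, a k • p k → ∃ k, v = p k
  sum_eq : ∑ k, c k = 0
  dep : ∑ k, c k • p k = 0
  unique : ∀ d : Fin 5 → ℤ, ∑ k, d k = 0 → ∑ k, d k • p k = 0 → ∀ k l, d k * c l = d l * c k
  noncoplanar : ∀ f : (Fin 3 → ℤ) →ₗ[ℤ] ℤ, (∀ k, f (p k) = f (p 0)) → f = 0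

/-- Unimodular equivalence of two labelled configurations, up to a relabelling. -/
def IntEquiv (p q : Fin 5 → Fin 3 → ℤ) : Prop :=
  ∃ (E : (Fin 3 → ℤ) ≃ₗ[ℤ] (Fin 3 → ℤ)) (b : Fin 3 → ℤ) (s : Fin 5 → Fin 5),
    Function.Bijective s ∧ ∀ k, q k = E (p (s k)) + b

lemma IntEquiv.trans {p q r : Fin 5 → Fin 3 → ℤ} (h : IntEquiv p q) (h' : IntEquiv q r) :
    IntEquiv p r := by
  obtain ⟨E, b, s, hs, h⟩ := h
  obtain ⟨E', b', s', hs', h'⟩ := h'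
  refine ⟨E.trans E', E' b + b', s ∘ s', hs.comp hs', fun k => ?_⟩
  rw [h', h]
  simp [add_assoc]

lemma IntEquiv.reindex (p : Fin 5 → Fin 3 → ℤ) {s : Fin 5 → Fin 5} (hs : Function.Bijective s) :
    IntEquiv p (p ∘ s) :=
  ⟨LinearEquiv.refl _ _, 0, s, hs, fun k => by simp⟩

lemma IntEquiv.map (p : Fin 5 → Fin 3 → ℤ) (E : (Fin 3 → ℤ) ≃ₗ[ℤ] (Fin 3 → ℤ)) (b : Fin 3 → ℤ) :
    IntEquiv p (fun k => E (p k - b)) :=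
  ⟨E, -E b, id, Function.bijective_id, fun k => by simp [sub_eq_add_neg]⟩

namespace Config

variable {p : Fin 5 → Fin 3 → ℤ} {c : Fin 5 → ℤ}

lemma reindex (h : Config p c) {s : Fin 5 → Fin 5} (hs : Function.Bijective s) :
    Config (p ∘ s) (c ∘ s) := by
  set σ := Equiv.ofBijective s hs with hσ
  have hσs : ∀ k, s k = σ k := fun k => rfl
  have sumc : ∀ (a : Fin 5 → ℤ), ∑ k, a k = ∑ k, a (σ.symm k) := fun a =>
    (Equiv.sum_comp σ.symm a).symm
  have sump : ∀ (a : Fin 5 → ℤ), ∑ k, a k • p (s k) = ∑ k, a (σ.symm k) • p k := fun a => by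
    rw [← Equiv.sum_comp σ fun k => a (σ.symm k) • p k]
    simp only [Equiv.symm_apply_apply, hσs]
  refine ⟨h.inj.comp hs.1, fun v a ha hN hv => ?_, ?_, ?_, fun d h1 h2 k l => ?_, fun f hf => ?_⟩
  · obtain ⟨k, hk⟩ := h.closed v (fun k => a (σ.symm k)) (fun k => ha _) (by rwa [← sumc])
      (by rw [← sumc, ← sump]; exact hv)
    exact ⟨σ.symm k, by rw [hk]; simp [hσs]⟩
  · rw [← h.sum_eq]; exact Equiv.sum_comp σ c
  · rw [← h.dep]; exact Equiv.sum_comp σ fun k => c k • p k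
  · have := h.unique (fun k => d (σ.symm k)) (by rw [← sumc]; exact h1)
      (by rw [← sump]; exact h2) (s k) (s l)
    simpa [hσs] using this
  · refine h.noncoplanar f fun k => ?_
    have h1 := hf (σ.symm k)
    have h2 := hf (σ.symm 0)
    simp only [Function.comp, hσs, Equiv.apply_symm_apply] at h1 h2
    rw [h1, h2]

lemma map (h : Config p c) (E : (Fin 3 → ℤ) ≃ₗ[ℤ] (Fin 3 → ℤ)) (b : Fin 3 → ℤ) :
    Config (fun k => E (p k - b)) c := by
  have key : ∀ a : Fin 5 → ℤ, ∑ k, a k • E (p k - b) = E (∑ k, a k • p k - (∑ k, a k) • b) := by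
    intro a
    simp only [map_sub, map_sum, map_smul, smul_sub, Finset.sum_sub_distrib, Finset.sum_smul]
  refine ⟨fun k l hkl => h.inj ?_, fun v a ha hN hv => ?_, h.sum_eq, ?_, fun d h1 h2 => ?_,
    fun f hf => ?_⟩
  · simpa using hkl
  · obtain ⟨k, hk⟩ := h.closed (E.symm v + b) a ha hN (by
      apply E.injective
      rw [key] at hv
      rw [smul_add, map_add, map_smul, LinearEquiv.apply_symm_apply, hv, ← map_add]
      congr 1
      abel)
    exact ⟨k, by rw [← hk]; simp⟩
  · rw [key, h.dep, h.sum_eq]; simp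
  · refine h.unique d h1 ?_
    rw [key, h1, zero_smul, sub_zero] at h2
    exact E.map_eq_zero_iff.1 h2
  · have := h.noncoplanar (f ∘ₗ E.toLinearMap) fun k => by
      have := hf k
      simp only [map_sub] at this
      simpa using this
    ext1 i
    have h3 := LinearMap.congr_fun this (E.symm (Pi.single i 1))
    ext
    simpa using h3

lemma neg (h : Config p c) : Config p (-c) :=
  ⟨h.inj, h.closed, by simp [h.sum_eq], by simp [h.dep, -zsmul_eq_mul],
    fun d h1 h2 k l => by have := h.unique d h1 h2 k l; simp only [Pi.neg_apply]; linarith,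
    h.noncoplanar⟩

/-- If one of the points is a convex combination of the others then the coefficients are given by
the affine dependence. -/
lemma coeff_eq (h : Config p c) {a : Fin 5 → ℤ} {l : Fin 5} (hl : a l = 0)
    (hv : (∑ k, a k) • p l = ∑ k, a k • p k) (k : Fin 5) (hk : k ≠ l) :
    a k * c l = -((∑ k, a k) * c k) := by
  have := h.unique (a - Pi.single l (∑ k, a k)) (by simp [Finset.sum_sub_distrib])
    (by simp [sub_smul, Finset.sum_sub_distrib, ← hv, Pi.single_apply, ite_smul, -zsmul_eq_mul]) k l
  simp only [Pi.sub_apply, Pi.single_eq_same, Pi.single_eq_of_ne hk, hl] at this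
  linarith

/-- Writing `p l` as a convex combination of the others is, up to scale, the dependence itself, and
there every other coefficient is zero or has the sign opposite to `c l`. -/
lemma not_mem_convexHull (h : Config p c) {a : Fin 5 → ℤ} {l : Fin 5} (ha : ∀ k, 0 ≤ a k)
    (hs : 0 < ∑ k, a k) (hl : a l = 0) (hv : (∑ k, a k) • p l = ∑ k, a k • p k) {k : Fin 5}
    (hk : k ≠ l) (hc : 0 < c k * c l) : False := by
  have e := h.coeff_eq hl hv k hk
  have e' : a k * (c l * c l) = -((∑ k, a k) * (c k * c l)) := by linear_combination c l * e
  linarith [mul_pos hs hc, mul_nonneg (ha k) (mul_self_nonneg (c l))]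

end Config

/-! ### Unimodular maps and empty triangles -/

/-- The unimodular map acting on the last two coordinates. -/
def blockEquiv (a b c d : ℤ) (h : a * d - b * c = 1) : (Fin 3 → ℤ) ≃ₗ[ℤ] (Fin 3 → ℤ) where
  toFun v := ![v 0, a * v 1 + b * v 2, c * v 1 + d * v 2]
  invFun v := ![v 0, d * v 1 - b * v 2, -c * v 1 + a * v 2]
  map_add' v w := by ext i; fin_cases i <;> simp <;> ring
  map_smul' r v := by ext i; fin_cases i <;> simp <;> ring
  left_inv v := by
    ext i; fin_cases i <;> simp
    · linear_combination v 1 * h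
    · linear_combination v 2 * h
  right_inv v := by
    ext i; fin_cases i <;> simp
    · linear_combination v 1 * h
    · linear_combination v 2 * h

/-- The cyclic permutation of the coordinates. -/
def rotateEquiv : (Fin 3 → ℤ) ≃ₗ[ℤ] (Fin 3 → ℤ) where
  toFun v := ![v 2, v 0, v 1]
  invFun v := ![v 1, v 2, v 0]
  map_add' v w := by ext i; fin_cases i <;> simp
  map_smul' r v := by ext i; fin_cases i <;> simp
  left_inv v := by ext i; fin_cases i <;> simp
  right_inv v := by ext i; fin_cases i <;> simp

/-- The exchange of the first two coordinates. -/
def swapEquiv : (Fin 3 → ℤ) ≃ₗ[ℤ] (Fin 3 → ℤ) where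
  toFun v := ![v 1, v 0, v 2]
  invFun v := ![v 1, v 0, v 2]
  map_add' v w := by ext i; fin_cases i <;> simp
  map_smul' r v := by ext i; fin_cases i <;> simp
  left_inv v := by ext i; fin_cases i <;> simp
  right_inv v := by ext i; fin_cases i <;> simp

/-- The reflection in the last coordinate. -/
def flipEquiv : (Fin 3 → ℤ) ≃ₗ[ℤ] (Fin 3 → ℤ) where
  toFun v := ![v 0, v 1, -v 2]
  invFun v := ![v 0, v 1, -v 2]
  map_add' v w := by ext i; fin_cases i <;> simp; ring
  map_smul' r v := by ext i; fin_cases i <;> simp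
  left_inv v := by ext i; fin_cases i <;> simp
  right_inv v := by ext i; fin_cases i <;> simp

/-- The shear that fixes the plane spanned by the first two coordinate vectors. -/
def shearEquiv (s t : ℤ) : (Fin 3 → ℤ) ≃ₗ[ℤ] (Fin 3 → ℤ) where
  toFun v := ![v 0 - s * v 2, v 1 - t * v 2, v 2]
  invFun v := ![v 0 + s * v 2, v 1 + t * v 2, v 2]
  map_add' v w := by ext i; fin_cases i <;> simp <;> ring
  map_smul' r v := by ext i; fin_cases i <;> simp <;> ring
  left_inv v := by ext i; fin_cases i <;> simp
  right_inv v := by ext i; fin_cases i <;> simp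

lemma blockEquiv_apply (a b c d : ℤ) (h : a * d - b * c = 1) (v : Fin 3 → ℤ) :
    blockEquiv a b c d h v = ![v 0, a * v 1 + b * v 2, c * v 1 + d * v 2] := rfl

lemma rotateEquiv_apply (v : Fin 3 → ℤ) : rotateEquiv v = ![v 2, v 0, v 1] := rfl

lemma rotateEquiv_symm_apply (v : Fin 3 → ℤ) : rotateEquiv.symm v = ![v 1, v 2, v 0] := rfl

lemma swapEquiv_apply (v : Fin 3 → ℤ) : swapEquiv v = ![v 1, v 0, v 2] := rfl

lemma flipEquiv_apply (v : Fin 3 → ℤ) : flipEquiv v = ![v 0, v 1, -v 2] := rfl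

lemma shearEquiv_apply (s t : ℤ) (v : Fin 3 → ℤ) :
    shearEquiv s t v = ![v 0 - s * v 2, v 1 - t * v 2, v 2] := rfl

/-- The block has the Bézout coefficients of the last two coordinates as first row, and the
coordinates divided by their gcd, crossed, as second row. Fixing the first axis lets it be applied
after a first edge has been normalised. -/
lemma exists_blockEquiv (v : Fin 3 → ℤ) : ∃ (E : (Fin 3 → ℤ) ≃ₗ[ℤ] (Fin 3 → ℤ)) (g : ℤ),
    0 ≤ g ∧ E v = ![v 0, g, 0] ∧ ∀ x, E ![x, 0, 0] = ![x, 0, 0] := by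
  rcases eq_or_ne (Int.gcd (v 1) (v 2)) 0 with h0 | h0
  · rw [Int.gcd_eq_zero_iff] at h0
    refine ⟨LinearEquiv.refl _ _, 0, le_rfl, ?_, fun x => rfl⟩
    ext i; fin_cases i <;> simp [h0]
  · obtain ⟨y, hy⟩ := Int.gcd_dvd_left (a := v 1) (b := v 2)
    obtain ⟨z, hz⟩ := Int.gcd_dvd_right (a := v 1) (b := v 2)
    have hb := Int.gcd_eq_gcd_ab (v 1) (v 2)
    set g : ℤ := (Int.gcd (v 1) (v 2) : ℤ) with hg
    have hg0 : g ≠ 0 := by rw [hg]; exact_mod_cast h0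
    refine ⟨blockEquiv (Int.gcdA (v 1) (v 2)) (Int.gcdB (v 1) (v 2)) (-z) y ?_, g,
      by positivity, ?_, fun x => ?_⟩
    · apply mul_left_cancel₀ hg0
      linear_combination -hb - Int.gcdA (v 1) (v 2) * hy - Int.gcdB (v 1) (v 2) * hz
    · rw [blockEquiv_apply]
      ext i; fin_cases i
      · simp
      · simp only [Fin.mk_one, Matrix.cons_val_one, Matrix.cons_val_zero]; linear_combination -hb
      · simp only [Fin.reduceFinMk, Matrix.cons_val]; linear_combination -z * hy + y * hz
    · rw [blockEquiv_apply]
      ext i; fin_cases i <;> simp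

/-- The triangle with vertices `0, u, v` is non-degenerate and its only lattice points are its
vertices. -/
structure EmptyTriangle (u v : Fin 3 → ℤ) : Prop where
  indep : ∀ s t : ℤ, s • u + t • v = 0 → s = 0 ∧ t = 0
  empty : ∀ (w : Fin 3 → ℤ) (a b N : ℤ), 0 ≤ a → 0 ≤ b → a + b ≤ N → 0 < N →
    N • w = a • u + b • v → w = 0 ∨ w = u ∨ w = v

lemma EmptyTriangle.map {u v : Fin 3 → ℤ} (h : EmptyTriangle u v)
    (E : (Fin 3 → ℤ) ≃ₗ[ℤ] (Fin 3 → ℤ)) : EmptyTriangle (E u) (E v) := by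
  refine ⟨fun s t hst => h.indep s t ?_, fun w a b N ha hb hab hN hw => ?_⟩
  · rw [← map_smul, ← map_smul, ← map_add] at hst
    exact E.map_eq_zero_iff.1 hst
  · have := h.empty (E.symm w) a b N ha hb hab hN (by
      apply E.injective
      simp [hw, -zsmul_eq_mul])
    rcases this with h | h | h
    · left; simpa using h
    · right; left; rw [← h]; simp
    · right; right; rw [← h]; simp

/-- Empty lattice triangles are unimodular. -/
theorem EmptyTriangle.exists_equiv {u v : Fin 3 → ℤ} (h : EmptyTriangle u v) :
    ∃ E : (Fin 3 → ℤ) ≃ₗ[ℤ] (Fin 3 → ℤ), E u = ![1, 0, 0] ∧ E v = ![0, 1, 0] := by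
  -- the first edge
  obtain ⟨E₁, hu₁⟩ : ∃ E : (Fin 3 → ℤ) ≃ₗ[ℤ] (Fin 3 → ℤ), E u = ![1, 0, 0] := by
    obtain ⟨F₁, g, hg, h₁, -⟩ := exists_blockEquiv u
    obtain ⟨F₂, g', hg', h₂, -⟩ := exists_blockEquiv (rotateEquiv (F₁ u))
    have e : (((F₁.trans rotateEquiv).trans F₂).trans rotateEquiv.symm) u = ![g', 0, 0] := by
      simp only [LinearEquiv.trans_apply]
      rw [h₂, h₁, rotateEquiv_symm_apply, rotateEquiv_apply]
      ext i; fin_cases i <;> simp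
    set E := ((F₁.trans rotateEquiv).trans F₂).trans rotateEquiv.symm
    have h' := h.map E
    rw [e] at h'
    have hg0 : g' ≠ 0 := by
      rintro rfl
      have := (h'.indep 1 0 (by ext i; fin_cases i <;> simp)).1
      omega
    refine ⟨E, ?_⟩
    rw [e]
    -- The vector e₁ lies on the edge from 0 to (g', 0, 0), so emptiness makes the edge primitive.
    rcases h'.empty ![1, 0, 0] 1 0 g' (by norm_num) le_rfl (by omega) (by omega)
      (by ext i; fin_cases i <;> simp) with h0 | h0 | h0
    · have := congrFun h0 0; simp at this
    · exact h0.symm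
    · have := (h'.indep 1 (-g') (by rw [← h0]; ext i; fin_cases i <;> simp)).1
      omega
  have h₁ := h.map E₁
  rw [hu₁] at h₁
  obtain ⟨E₂, d, hd, hv₂, hu₂⟩ := exists_blockEquiv (E₁ v)
  have h₂ := h₁.map E₂
  rw [hu₂, hv₂] at h₂
  set x := E₁ v 0
  have hd0 : d ≠ 0 := by
    rintro rfl
    have := (h₂.indep (-x) 1 (by ext i; fin_cases i <;> simp)).2
    omega
  have hdpos : 0 < d := by omega
  -- The point (⌈x/d⌉, 1, 0) lies in the triangle 0, (1, 0, 0), (x, d, 0), off its base; by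
  -- emptiness it is the third vertex.
  have hd1 : d = 1 := by
    have e1 := Int.emod_add_mul_ediv (-x) d
    have e2 := Int.emod_nonneg (-x) hd0
    have e3 := Int.emod_lt_of_pos (-x) hdpos
    rcases h₂.empty ![-(-x / d), 1, 0] ((-x) % d) 1 d e2 (by norm_num) (by omega) hdpos
      (by ext i; fin_cases i <;> simp; linarith) with h0 | h0 | h0
    · have := congrFun h0 1; simp at this
    · have := congrFun h0 1; simp at this
    · have := congrFun h0 1; simp at this; omega
  subst hd1
  refine ⟨((E₁.trans E₂).trans rotateEquiv).trans ((shearEquiv 0 x).trans rotateEquiv.symm), ?_, ?_⟩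
  · simp only [LinearEquiv.trans_apply, hu₁, hu₂, rotateEquiv_symm_apply, shearEquiv_apply,
      rotateEquiv_apply]
    ext i; fin_cases i <;> simp
  · simp only [LinearEquiv.trans_apply, hv₂, rotateEquiv_symm_apply, shearEquiv_apply,
      rotateEquiv_apply]
    ext i; fin_cases i <;> simp

/-! ### Normal form and White's theorem for configurations -/

namespace Config

variable {p : Fin 5 → Fin 3 → ℤ} {c : Fin 5 → ℤ}

/-- The first hypothesis prevents `p 0`, `p 1`, `p 2` from carrying the dependence, so they are not
collinear. The other two keep `p 3` and `p 4` out of the triangle: either the dependence also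
involves the remaining point, or the intruder has the sign of one of the three vertices. -/
lemma emptyTriangle (h : Config p c) (h34 : c 3 ≠ 0 ∨ c 4 ≠ 0)
    (h3 : c 4 ≠ 0 ∨ 0 < c 0 * c 3 ∨ 0 < c 1 * c 3 ∨ 0 < c 2 * c 3)
    (h4 : c 3 ≠ 0 ∨ 0 < c 0 * c 4 ∨ 0 < c 1 * c 4 ∨ 0 < c 2 * c 4) :
    EmptyTriangle (p 1 - p 0) (p 2 - p 0) := by
  constructor
  · intro s t hst
    have hu := h.unique ![-s - t, s, t, 0, 0] (by simp [Fin.sum_univ_five]; try ring)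
      (by
        rw [← hst]
        simp only [Fin.sum_univ_five, Matrix.cons_val]
        module)
    rcases h34 with hc | hc
    · have e1 := hu 1 3
      have e2 := hu 2 3
      simp only [Matrix.cons_val, zero_mul, mul_eq_zero, hc, or_false] at e1 e2
      exact ⟨e1, e2⟩
    · have e1 := hu 1 4
      have e2 := hu 2 4
      simp only [Matrix.cons_val, zero_mul, mul_eq_zero, hc, or_false] at e1 e2
      exact ⟨e1, e2⟩
  · intro w a b N ha hb hab hN hw
    have hsum : ∑ k, (![N - a - b, a, b, 0, 0] : Fin 5 → ℤ) k = N := by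
      simp [Fin.sum_univ_five]; ring
    have hsmul : N • (w + p 0) = ∑ k, (![N - a - b, a, b, 0, 0] : Fin 5 → ℤ) k • p k := by
      simp only [Fin.sum_univ_five, Matrix.cons_val, smul_add, hw]
      module
    obtain ⟨k, hk⟩ := h.closed (w + p 0) ![N - a - b, a, b, 0, 0]
      (by intro k; fin_cases k <;> simp <;> omega) (by rwa [hsum]) (by rw [hsum, hsmul])
    have excl : ∀ l m : Fin 5, k = l → (![N - a - b, a, b, 0, 0] : Fin 5 → ℤ) l = 0 →
        (∀ j, j ≠ l → (![N - a - b, a, b, 0, 0] : Fin 5 → ℤ) j * c l = -(N * c j)) := by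
      intro l m hkl hl j hj
      subst hkl
      have := h.coeff_eq hl (by rw [hsum, ← hk, hsmul]) j hj
      rwa [hsum] at this
    have nonneg : ∀ j, 0 ≤ (![N - a - b, a, b, 0, 0] : Fin 5 → ℤ) j := by
      intro j; fin_cases j <;> simp <;> omega
    have contra : ∀ l j : Fin 5, k = l → (![N - a - b, a, b, 0, 0] : Fin 5 → ℤ) l = 0 → j ≠ l →
        0 < c j * c l → False := by
      intro l j hkl hl hj hpos
      subst hkl
      exact h.not_mem_convexHull nonneg (by rwa [hsum]) hl (by rw [hsum, ← hk, hsmul]) hj hpos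
    fin_cases k
    · left; simpa using hk
    · right; left; rw [← show w + p 0 = p 1 from hk]; simp
    · right; right; rw [← show w + p 0 = p 2 from hk]; simp
    · exfalso
      rcases h3 with h3 | h3 | h3 | h3
      · have e := excl 3 3 rfl (by simp) 4 (by decide)
        simp only [Matrix.cons_val, zero_mul] at e
        have : N * c 4 ≠ 0 := mul_ne_zero hN.ne' h3
        omega
      · exact contra 3 0 rfl (by simp) (by decide) h3
      · exact contra 3 1 rfl (by simp) (by decide) h3
      · exact contra 3 2 rfl (by simp) (by decide) h3
    · exfalso
      rcases h4 with h3 | h3 | h3 | h3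
      · have e := excl 4 4 rfl (by simp) 3 (by decide)
        simp only [Matrix.cons_val, zero_mul] at e
        have : N * c 3 ≠ 0 := mul_ne_zero hN.ne' h3
        omega
      · exact contra 4 0 rfl (by simp) (by decide) h3
      · exact contra 4 1 rfl (by simp) (by decide) h3
      · exact contra 4 2 rfl (by simp) (by decide) h3

/-- A unimodular triangle as the standard triangle and a fourth point above its plane. -/
lemma exists_normal (h : Config p c) (hT : EmptyTriangle (p 1 - p 0) (p 2 - p 0)) (h4 : c 4 ≠ 0) :
    ∃ (E : (Fin 3 → ℤ) ≃ₗ[ℤ] (Fin 3 → ℤ)) (a b n : ℤ), 0 < n ∧ E (p 1 - p 0) = ![1, 0, 0] ∧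
      E (p 2 - p 0) = ![0, 1, 0] ∧ E (p 3 - p 0) = ![a, b, n] := by
  obtain ⟨E, hE1, hE2⟩ := hT.exists_equiv
  have h3 : E (p 3 - p 0) = ![E (p 3 - p 0) 0, E (p 3 - p 0) 1, E (p 3 - p 0) 2] := by
    ext i; fin_cases i <;> rfl
  set a := E (p 3 - p 0) 0
  set b := E (p 3 - p 0) 1
  set n := E (p 3 - p 0) 2
  -- If n = 0 the first four points are coplanar and carry a dependence avoiding `p 4`, against `c 4
  -- ≠ 0`.
  have hn : n ≠ 0 := by
    intro hn
    have hu := h.unique ![a + b - 1, -a, -b, 1, 0] (by simp [Fin.sum_univ_five]; try ring) (by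
      have e : -a • (p 1 - p 0) + -b • (p 2 - p 0) + (p 3 - p 0) = 0 := by
        apply E.injective
        simp only [map_add, map_smul, hE1, hE2, h3, hn, map_zero]
        ext i; fin_cases i <;> simp
      rw [← e]
      simp only [Fin.sum_univ_five, Matrix.cons_val]
      module) 3 4
    simp only [Matrix.cons_val, zero_mul, one_mul] at hu
    exact h4 hu
  rcases lt_or_gt_of_ne hn with hn | hn
  · refine ⟨E.trans flipEquiv, a, b, -n, by omega, ?_, ?_, ?_⟩
    · simp only [LinearEquiv.trans_apply, hE1, flipEquiv_apply]; simp
    · simp only [LinearEquiv.trans_apply, hE2, flipEquiv_apply]; simp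
    · simp only [LinearEquiv.trans_apply, h3, flipEquiv_apply]; simp
  · exact ⟨E, a, b, n, hn, hE1, hE2, h3⟩

/-- White's theorem for the tetrahedra in a configuration. -/
theorem white (h : Config p c) (h4 : c 4 ≠ 0)
    (hpos : 0 < c 0 * c 4 ∨ 0 < c 1 * c 4 ∨ 0 < c 2 * c 4 ∨ 0 < c 3 * c 4) :
    ∃ f : (Fin 3 → ℤ) →ₗ[ℤ] ℤ,
      (f (p 1 - p 0) = 0 ∧ f (p 2 - p 0) = 1 ∧ f (p 3 - p 0) = 1) ∨
      (f (p 1 - p 0) = 1 ∧ f (p 2 - p 0) = 0 ∧ f (p 3 - p 0) = 1) ∨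
      (f (p 1 - p 0) = 1 ∧ f (p 2 - p 0) = 1 ∧ f (p 3 - p 0) = 0) := by
  have hT := h.emptyTriangle (Or.inr h4) (Or.inl h4) (by
    rcases hpos with h' | h' | h' | h'
    · tauto
    · tauto
    · tauto
    · left; rintro h3; simp [h3] at h')
  obtain ⟨E, a, b, n, hn, h1, h2, h3⟩ := h.exists_normal hT h4
  have key : n ∣ a - 1 ∨ n ∣ b - 1 ∨ n ∣ a + b := by
    refine white_arith hn fun k x y hk hkn hx hy hxy => ?_
    -- These are n times the barycentric coordinates of (x, y, k) in the tetrahedron.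
    set w : Fin 5 → ℤ := ![n - k - (n * x - k * a) - (n * y - k * b), n * x - k * a, n * y - k * b,
      k, 0] with hw
    have hsum : ∑ j, w j = n := by simp [Fin.sum_univ_five, hw]; ring
    have hsmul : n • (E.symm ![x, y, k] + p 0) = ∑ j, w j • p j := by
      have : n • E.symm ![x, y, k] = (n * x - k * a) • (p 1 - p 0) + (n * y - k * b) • (p 2 - p 0) +
          k • (p 3 - p 0) := by
        apply E.injective
        simp only [map_add, map_smul, h1, h2, h3, LinearEquiv.apply_symm_apply]
        ext i; fin_cases i <;> simp
        ring
      rw [smul_add, this]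
      simp only [Fin.sum_univ_five, hw, Matrix.cons_val]
      module
    have hw0 : ∀ j, 0 ≤ w j := by
      intro j; fin_cases j <;> simp [hw] <;> linarith
    obtain ⟨j, hj⟩ := h.closed _ w hw0 (by rwa [hsum]) (by rw [hsum, hsmul])
    have hj' : ![x, y, k] = E (p j - p 0) := by
      rw [← hj]; simp
    -- The heights of the four vertices are 0, 0, 0 and n, never k; the fifth point is outside the
    -- tetrahedron because it has the sign of one of the vertices.
    fin_cases j
    · have := congrFun hj' 2; simp at this; omega
    · rw [show E (p ((fun i => i) ⟨1, by norm_num⟩) - p 0) = ![1, 0, 0] from h1] at hj'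
      have := congrFun hj' 2; simp at this; omega
    · rw [show E (p ((fun i => i) ⟨2, by norm_num⟩) - p 0) = ![0, 1, 0] from h2] at hj'
      have := congrFun hj' 2; simp at this; omega
    · rw [show E (p ((fun i => i) ⟨3, by norm_num⟩) - p 0) = ![a, b, n] from h3] at hj'
      have := congrFun hj' 2; simp at this; omega
    · have hc : ∀ j : Fin 5, j ≠ 4 → 0 < c j * c 4 → False := by
        intro j hj0 hpos
        exact h.not_mem_convexHull (a := w) (l := 4) hw0 (by rwa [hsum]) (by simp [hw])
          (by rw [hsum, ← hsmul, hj]; rfl) hj0 hpos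
      rcases hpos with h' | h' | h' | h'
      · exact hc 0 (by decide) h'
      · exact hc 1 (by decide) h'
      · exact hc 2 (by decide) h'
      · exact hc 3 (by decide) h'
  have ev : ∀ (r s t : ℤ) (v : Fin 3 → ℤ),
      ((r • LinearMap.proj 0 + s • LinearMap.proj 1 + t • LinearMap.proj 2 :
        (Fin 3 → ℤ) →ₗ[ℤ] ℤ) ∘ₗ E.toLinearMap) v = r * E v 0 + s * E v 1 + t * E v 2 := by
    intro r s t v
    simp
  -- Subtracting m times the height from the first coordinate, the second, or their sum gives values
  -- 0 and 1 on a pair of opposite edges.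
  rcases key with ⟨m, hm⟩ | ⟨m, hm⟩ | ⟨m, hm⟩
  · refine ⟨(((1 : ℤ) • LinearMap.proj 0 + (0 : ℤ) • LinearMap.proj 1 + (-m) • LinearMap.proj 2 :
        (Fin 3 → ℤ) →ₗ[ℤ] ℤ) ∘ₗ E.toLinearMap), Or.inr (Or.inl ?_)⟩
    rw [ev, ev, ev, h1, h2, h3]
    simp only [Matrix.cons_val]
    refine ⟨by ring, by ring, by linear_combination hm⟩
  · refine ⟨(((0 : ℤ) • LinearMap.proj 0 + (1 : ℤ) • LinearMap.proj 1 + (-m) • LinearMap.proj 2 :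
        (Fin 3 → ℤ) →ₗ[ℤ] ℤ) ∘ₗ E.toLinearMap), Or.inl ?_⟩
    rw [ev, ev, ev, h1, h2, h3]
    simp only [Matrix.cons_val]
    refine ⟨by ring, by ring, by linear_combination hm⟩
  · refine ⟨(((1 : ℤ) • LinearMap.proj 0 + (1 : ℤ) • LinearMap.proj 1 + (-m) • LinearMap.proj 2 :
        (Fin 3 → ℤ) →ₗ[ℤ] ℤ) ∘ₗ E.toLinearMap), Or.inr (Or.inr ?_)⟩
    rw [ev, ev, ev, h1, h2, h3]
    simp only [Matrix.cons_val]
    refine ⟨by ring, by ring, by linear_combination hm⟩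

end Config

/-! ### Signatures (2,2) and (3,2) -/

/-- A labelled configuration is equivalent to one of the table. -/
def Classified (p : Fin 5 → Fin 3 → ℤ) : Prop := ∃ e : TableEntry, IntEquiv p e.points

lemma Classified.of_intEquiv {p q : Fin 5 → Fin 3 → ℤ} (h : IntEquiv p q) (hq : Classified q) :
    Classified p := by
  obtain ⟨e, he⟩ := hq
  exact ⟨e, h.trans he⟩

lemma Classified.of_reindex {p : Fin 5 → Fin 3 → ℤ} {s : Fin 5 → Fin 5} (hs : Function.Bijective s)
    (h : Classified (p ∘ s)) : Classified p :=
  .of_intEquiv (.reindex p hs) h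

lemma Classified.of_points {p : Fin 5 → Fin 3 → ℤ} (e : TableEntry) (s : Fin 5 → Fin 5)
    (hs : Function.Bijective s) (E : (Fin 3 → ℤ) ≃ₗ[ℤ] (Fin 3 → ℤ))
    (h : ∀ k, E (p (s k)) = e.points k) : Classified p :=
  ⟨e, E, 0, s, hs, fun k => by rw [h, add_zero]⟩

/-- A Bézout certificate: evaluated on explicit coordinates, it turns emptiness of a triangle into
coprimality. -/
lemma EmptyTriangle.exists_functional {u v : Fin 3 → ℤ} (h : EmptyTriangle u v) :
    ∃ f : (Fin 3 → ℤ) →ₗ[ℤ] ℤ, f u = 1 ∧ f v = 0 := by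
  obtain ⟨E, h1, h2⟩ := h.exists_equiv
  refine ⟨LinearMap.proj 0 ∘ₗ E.toLinearMap, ?_, ?_⟩ <;> simp [h1, h2]

lemma functional_apply (f : (Fin 3 → ℤ) →ₗ[ℤ] ℤ) (x y z : ℤ) :
    f ![x, y, z] = x * f ![1, 0, 0] + y * f ![0, 1, 0] + z * f ![0, 0, 1] := by
  have : (![x, y, z] : Fin 3 → ℤ) = x • ![1, 0, 0] + y • ![0, 1, 0] + z • ![0, 0, 1] := by
    ext i; fin_cases i <;> simp
  rw [this]
  simp only [map_add, map_smul, smul_eq_mul]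

lemma eq_vec (v : Fin 3 → ℤ) : v = ![v 0, v 1, v 2] := by
  ext i; fin_cases i <;> rfl

lemma eq_one_of_mul_eq_one {x y : ℤ} (hx : 0 < x) (h : x * y = 1) : x = 1 :=
  Int.eq_one_of_mul_eq_one_right hx.le h

namespace Config

variable {p : Fin 5 → Fin 3 → ℤ} {c : Fin 5 → ℤ}

lemma classified_of_normal (h : Config p c) (hT : EmptyTriangle (p 1 - p 0) (p 2 - p 0))
    (h4 : c 4 ≠ 0)
    (H : ∀ (q : Fin 5 → Fin 3 → ℤ) (a b n : ℤ), Config q c → q 0 = 0 → q 1 = ![1, 0, 0] →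
      q 2 = ![0, 1, 0] → q 3 = ![a, b, n] → 0 < n → Classified q) : Classified p := by
  obtain ⟨E, a, b, n, hn, h1, h2, h3⟩ := h.exists_normal hT h4
  exact .of_intEquiv (.map p E (p 0)) (H _ a b n (h.map E (p 0)) (by simp) h1 h2 h3 hn)

/-- Four points form a plane quadrilateral with `p 0` and `p 4` opposite; its empty triangles make
it a unit square. A pyramid of height n > 1 over a unit square contains another lattice point. -/
theorem classified_two_two (h : Config p c) (h0 : c 0 < 0) (h1 : 0 < c 1) (h2 : 0 < c 2)
    (h3 : c 3 = 0) (h4 : c 4 < 0) : Classified p := by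
  refine h.classified_of_normal (h.emptyTriangle (.inr h4.ne) (.inl h4.ne)
    (.inr (.inl (mul_pos_of_neg_of_neg h0 h4)))) h4.ne ?_
  clear h
  intro q a b n h q0 q1 q2 q3 hn
  obtain ⟨x, y, z, q4⟩ : ∃ x y z, q 4 = ![x, y, z] := ⟨_, _, _, eq_vec _⟩
  have d0 := congrFun h.dep 0
  have d1 := congrFun h.dep 1
  have d2 := congrFun h.dep 2
  simp only [Fin.sum_univ_five, q0, q1, q2, q3, q4, h3] at d0 d1 d2
  simp at d0 d1 d2
  replace d2 : z = 0 := d2.resolve_left h4.ne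
  subst d2
  have hx : 0 < x := by nlinarith
  have hy : 0 < y := by nlinarith
  have hx1 : x = 1 := by
    have hT : EmptyTriangle (q 4 - q 0) (q 2 - q 0) :=
      (h.reindex (s := ![0, 4, 2, 1, 3]) (by decide)).emptyTriangle (.inl h1.ne')
        (.inr (.inr (.inr (mul_pos h2 h1)))) (.inl h1.ne')
    obtain ⟨f, f1, f2⟩ := hT.exists_functional
    rw [q0, q4, sub_zero, functional_apply] at f1
    rw [q0, q2, sub_zero] at f2
    exact eq_one_of_mul_eq_one hx (y := f ![1, 0, 0]) (by rw [f2] at f1; linarith)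
  have hy1 : y = 1 := by
    have hT : EmptyTriangle (q 4 - q 0) (q 1 - q 0) :=
      (h.reindex (s := ![0, 4, 1, 2, 3]) (by decide)).emptyTriangle (.inl h2.ne')
        (.inr (.inr (.inr (mul_pos h1 h2)))) (.inl h2.ne')
    obtain ⟨f, f1, f2⟩ := hT.exists_functional
    rw [q0, q4, sub_zero, functional_apply] at f1
    rw [q0, q1, sub_zero] at f2
    exact eq_one_of_mul_eq_one hy (y := f ![0, 1, 0]) (by rw [f2] at f1; linarith)
  subst hx1 hy1
  have hn1 : n = 1 := by
    have ea := Int.emod_add_mul_ediv (-a) n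
    have ea1 := Int.emod_nonneg (-a) hn.ne'
    have ea2 := Int.emod_lt_of_pos (-a) hn
    have eb := Int.emod_add_mul_ediv (-b) n
    have eb1 := Int.emod_nonneg (-b) hn.ne'
    have eb2 := Int.emod_lt_of_pos (-b) hn
    set r := (-a) % n
    set s := (-b) % n
    -- The section at height one is a square of side 1 - 1/n with corner (a/n, b/n), so it contains
    -- (⌈a/n⌉, ⌈b/n⌉). The weights depend on which triangle of the base square lies below that
    -- point.
    have key : ∃ k, ![-(-a / n), -(-b / n), 1] = q k := by
      rcases le_total s r with hl | hl
      · have hsum : ∑ k, (![n - 1 - r, r - s, 0, 1, s] : Fin 5 → ℤ) k = n := by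
          simp [Fin.sum_univ_five]; ring
        refine h.closed _ ![n - 1 - r, r - s, 0, 1, s] (fun k => ?_) (by rwa [hsum]) ?_
        · fin_cases k <;> simp <;> omega
        · rw [hsum]
          simp only [Fin.sum_univ_five, q0, q1, q2, q3, q4, Matrix.cons_val]
          ext i; fin_cases i <;> simp <;> linarith
      · have hsum : ∑ k, (![n - 1 - s, 0, s - r, 1, r] : Fin 5 → ℤ) k = n := by
          simp [Fin.sum_univ_five]; ring
        refine h.closed _ ![n - 1 - s, 0, s - r, 1, r] (fun k => ?_) (by rwa [hsum]) ?_
        · fin_cases k <;> simp <;> omega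
        · rw [hsum]
          simp only [Fin.sum_univ_five, q0, q1, q2, q3, q4, Matrix.cons_val]
          ext i; fin_cases i <;> simp <;> linarith
    obtain ⟨k, hk⟩ := key
    have hk2 := congrFun hk 2
    fin_cases k <;> simp [q0, q1, q2, q3, q4] at hk2
    exact hk2.symm
  subst hn1
  refine .of_points .s22 ![0, 1, 2, 4, 3] (by decide) (shearEquiv a b) fun k => ?_
  fin_cases k <;> simp [q0, q1, q2, q3, q4, shearEquiv_apply, TableEntry.points]

/-- The choice of the larger negative coefficient at `p 0` bounds its level: it is (c₁ + c₂)/(-c₀),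
strictly between 0 and 2. So the triangle `p 0`, `p 1`, `p 2` and the edge `p 3`, `p 4` lie in
consecutive lattice planes, and the primitive vector of that edge supplies the parameters. -/
theorem classified_three_two_of_functional (h : Config p c) (h0 : c 0 < 0) (h1 : 0 < c 1)
    (h2 : 0 < c 2) (h3 : 0 < c 3) (h4 : c 4 < 0) (h04 : c 0 ≤ c 4) (f : (Fin 3 → ℤ) →ₗ[ℤ] ℤ)
    (f1 : f (p 1 - p 4) = 1) (f2 : f (p 2 - p 4) = 1) (f3 : f (p 3 - p 4) = 0) :
    Classified p := by
  have hdep := congrArg f h.dep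
  have hsum := h.sum_eq
  simp only [Fin.sum_univ_five, map_add, map_smul, map_zero, smul_eq_mul] at hdep hsum
  rw [map_sub] at f1 f2 f3
  have f0 : f (p 0) = f (p 4) + 1 := by
    have e : c 0 * (f (p 0) - f (p 4)) + c 1 + c 2 = 0 := by
      linear_combination hdep - f (p 4) * hsum - c 1 * f1 - c 2 * f2 - c 3 * f3
    have l1 : 0 < f (p 0) - f (p 4) := by nlinarith
    have l2 : f (p 0) - f (p 4) < 2 := by nlinarith
    omega
  obtain ⟨E, a, b, n, hn, e1, e2, e3⟩ := h.exists_normal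
    (h.emptyTriangle (.inr h4.ne) (.inl h4.ne) (.inl h3.ne')) h4.ne
  refine .of_intEquiv (.map p E (p 0)) ?_
  have hq := h.map E (p 0)
  have q0 : E (p 0 - p 0) = 0 := by simp
  have fE : ∀ k, (f ∘ₗ E.symm.toLinearMap) (E (p k - p 0)) = f (p k) - f (p 0) := fun k => by simp
  generalize f ∘ₗ E.symm.toLinearMap = g at fE
  have fE1 := fE 1
  have fE2 := fE 2
  have fE3 := fE 3
  have fE4 := fE 4
  generalize hqq : (fun k => E (p k - p 0)) = q at *
  have qk : ∀ k, E (p k - p 0) = q k := fun k => by rw [← hqq]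
  simp only [qk] at *
  obtain ⟨x, y, z, q4⟩ : ∃ x y z, q 4 = ![x, y, z] := ⟨_, _, _, eq_vec _⟩
  rw [e1] at fE1
  rw [e2] at fE2
  rw [e3, functional_apply] at fE3
  rw [q4, functional_apply] at fE4
  rw [show f (p 1) - f (p 0) = 0 by linarith] at fE1
  rw [show f (p 2) - f (p 0) = 0 by linarith] at fE2
  rw [fE1, fE2] at fE3 fE4
  have hn1 : n = 1 := eq_one_of_mul_eq_one hn (y := -g ![0, 0, 1]) (by linarith)
  subst hn1
  have hz1 : z = 1 := by
    have hg : g ![0, 0, 1] = -1 := by linarith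
    rw [hg] at fE4
    linarith
  subst hz1
  have d0 := congrFun hq.dep 0
  have d1 := congrFun hq.dep 1
  have d2 := congrFun hq.dep 2
  simp only [Fin.sum_univ_five, q0, e1, e2, e3, q4] at d0 d1 d2
  simp at d0 d1 d2
  have hx : 0 < x - a :=
    pos_of_mul_pos_right (a := c 3) (by linarith [show c 3 * (x - a) = c 1 by linear_combination x * d2 - d0]) h3.le
  have hy : 0 < y - b :=
    pos_of_mul_pos_right (a := c 3) (by linarith [show c 3 * (y - b) = c 2 by linear_combination y * d2 - d1]) h3.le
  have hgcd : IsCoprime (x - a) (y - b) := by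
    have hT : EmptyTriangle (q 4 - q 3) (q 1 - q 3) :=
      (hq.reindex (s := ![3, 4, 1, 0, 2]) (by decide)).emptyTriangle (.inl h0.ne)
        (.inl h2.ne') (.inl h0.ne)
    obtain ⟨f, f1, f2⟩ := hT.exists_functional
    rw [e3, q4, show (![x, y, 1] - ![a, b, 1] : Fin 3 → ℤ) = ![x - a, y - b, 0] by
      ext i; fin_cases i <;> simp, functional_apply] at f1
    exact ⟨f ![1, 0, 0], f ![0, 1, 0], by linarith⟩
  rw [Int.isCoprime_iff_gcd_eq_one] at hgcd
  rcases le_total (x - a) (y - b) with hl | hl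
  · refine .of_points (.s32 (x - a) (y - b) hx hl hgcd) id Function.bijective_id (shearEquiv a b)
      fun k => ?_
    fin_cases k <;> simp [q0, e1, e2, e3, q4, shearEquiv_apply, TableEntry.points]
  · refine .of_points (.s32 (y - b) (x - a) hy hl (by rwa [Int.gcd_comm])) ![0, 2, 1, 3, 4]
      (by decide) ((shearEquiv a b).trans swapEquiv) fun k => ?_
    fin_cases k <;> simp [q0, e1, e2, e3, q4, shearEquiv_apply, swapEquiv_apply, TableEntry.points]

/-- White's theorem is applied to the tetrahedron avoiding `p 0`; the three pairs of opposite edges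
differ by a relabelling of `p 1`, `p 2`, `p 3`. -/
theorem classified_three_two (h : Config p c) (h0 : c 0 < 0) (h1 : 0 < c 1)
    (h2 : 0 < c 2) (h3 : 0 < c 3) (h4 : c 4 < 0) (h04 : c 0 ≤ c 4) : Classified p := by
  have hW := (h.reindex (s := ![4, 1, 2, 3, 0]) (by decide)).white h0.ne
    (.inl (mul_pos_of_neg_of_neg h4 h0))
  obtain ⟨f, ⟨f1, f2, f3⟩ | ⟨f1, f2, f3⟩ | ⟨f1, f2, f3⟩⟩ := hW
  · exact .of_reindex (s := ![0, 2, 3, 1, 4]) (by decide)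
      ((h.reindex (s := ![0, 2, 3, 1, 4]) (by decide)).classified_three_two_of_functional
        h0 h2 h3 h1 h4 h04 f f2 f3 f1)
  · exact .of_reindex (s := ![0, 1, 3, 2, 4]) (by decide)
      ((h.reindex (s := ![0, 1, 3, 2, 4]) (by decide)).classified_three_two_of_functional
        h0 h1 h3 h2 h4 h04 f f1 f3 f2)
  · exact h.classified_three_two_of_functional h0 h1 h2 h3 h4 h04 f f1 f2 f3

end Config

/-! ### Signatures (2,1) and (3,1) -/

lemma exists_abs_le_half (a n : ℤ) (hn : 0 < n) :
    ∃ m, (0 ≤ a - m * n ∧ 2 * (a - m * n) ≤ n) ∨ (0 ≤ -(a - m * n) ∧ 2 * (-(a - m * n)) ≤ n) := by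
  have e1 := Int.emod_add_mul_ediv a n
  have e2 := Int.emod_nonneg a hn.ne'
  have e3 := Int.emod_lt_of_pos a hn
  rcases le_or_gt (2 * (a % n)) n with h | h
  · exact ⟨a / n, Or.inl ⟨by linarith, by linarith⟩⟩
  · exact ⟨a / n + 1, Or.inr ⟨by linarith, by linarith⟩⟩

/-- Multiplicativity of determinants: the values of three functionals on e₁, e₂, (a, b, n) have
determinant n times that of the functionals. -/
lemma dvd_det_functional {a b n f₁ f₂ f₃ g₁ g₂ g₃ h₁ h₂ h₃ f g h : ℤ}
    (hf : a * f₁ + b * f₂ + n * f₃ = f) (hg : a * g₁ + b * g₂ + n * g₃ = g)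
    (hh : a * h₁ + b * h₂ + n * h₃ = h) :
    n ∣ f₁ * (g₂ * h - g * h₂) - f₂ * (g₁ * h - g * h₁) + f * (g₁ * h₂ - g₂ * h₁) := by
  refine ⟨f₁ * (g₂ * h₃ - g₃ * h₂) - f₂ * (g₁ * h₃ - g₃ * h₁) + f₃ * (g₁ * h₂ - g₂ * h₁), ?_⟩
  rw [← hf, ← hg, ← hh]
  ring

/-- The three functionals are those of White's theorem for the tetrahedra around the edge `p 0`, `p
3` in signature (3,1). In all but one of the 27 combinations their determinant divides 3, or divides
4 and the oddness of n suffices. -/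
lemma dvd_three_of_functionals {a b n f₁ f₂ f₃ g₁ g₂ g₃ e₁ e₂ e₃ : ℤ} (hn : 0 < n)
    (hodd : n % 2 = 1) (han : ∃ r s, a * r + n * s = 1)
    (hf : (f₁ = 0 ∧ f₂ = 1 ∧ a * f₁ + b * f₂ + n * f₃ = 1) ∨
      (f₁ = 1 ∧ f₂ = 0 ∧ a * f₁ + b * f₂ + n * f₃ = 1) ∨
      (f₁ = 1 ∧ f₂ = 1 ∧ a * f₁ + b * f₂ + n * f₃ = 0))
    (hg : (g₁ = -1 ∧ g₂ = 0 ∧ a * g₁ + b * g₂ + n * g₃ = 1) ∨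
      (g₁ = -1 ∧ g₂ = 1 ∧ a * g₁ + b * g₂ + n * g₃ = 1) ∨
      (g₁ = -2 ∧ g₂ = 1 ∧ a * g₁ + b * g₂ + n * g₃ = 0))
    (he : (e₁ = 0 ∧ e₂ = -1 ∧ a * e₁ + b * e₂ + n * e₃ = 1) ∨
      (e₁ = 1 ∧ e₂ = -1 ∧ a * e₁ + b * e₂ + n * e₃ = 1) ∨
      (e₁ = 1 ∧ e₂ = -2 ∧ a * e₁ + b * e₂ + n * e₃ = 0)) : n ∣ 3 := by
  have four : ∀ r, r ∣ 4 → n ∣ r → n ∣ 3 := by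
    intro r hr hd
    have hd4 : n ∣ 4 := hd.trans hr
    have hle := Int.le_of_dvd (by norm_num) hd4
    interval_cases n <;> omega
  rcases hf with ⟨rfl, rfl, hf⟩ | ⟨rfl, rfl, hf⟩ | ⟨rfl, rfl, hf⟩ <;>
  rcases hg with ⟨rfl, rfl, hg⟩ | ⟨rfl, rfl, hg⟩ | ⟨rfl, rfl, hg⟩ <;>
  rcases he with ⟨rfl, rfl, he⟩ | ⟨rfl, rfl, he⟩ | ⟨rfl, rfl, he⟩ <;>
  first
    | (refine (dvd_det_functional hf hg he).trans ?_; decide)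
    | (refine four _ ?_ (dvd_det_functional hf hg he); decide)
    -- Here all three functionals vanish on (a, b, n) and the determinant is 0; instead, f - g has
    -- values 3 and 0 on e₁ and e₂, so n divides 3a, and a is prime to n.
    | (obtain ⟨r, s, hrs⟩ := han
       exact ⟨r * (g₃ - f₃) + 3 * s, by linear_combination -3 * hrs + r * hf - r * hg⟩)

namespace Config

variable {p : Fin 5 → Fin 3 → ℤ} {c : Fin 5 → ℤ}

/-- The point `p 0` is the midpoint of `p 1` and `p 4`. White's theorem on the two tetrahedra
separated by `p 0`, `p 2`, `p 3` puts this segment and the edge `p 2`, `p 3` in consecutive lattice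
planes; a shear and a reflection bring the remaining residue into [0, n/2]. -/
theorem classified_two_one (h : Config p c) (h0 : c 0 < 0) (h1 : 0 < c 1) (h2 : c 2 = 0)
    (h3 : c 3 = 0) (h4 : 0 < c 4) : Classified p := by
  refine h.classified_of_normal (h.emptyTriangle (.inr h4.ne') (.inl h4.ne')
    (.inr (.inr (.inl (mul_pos h1 h4))))) h4.ne' ?_
  clear h
  intro q a b n h q0 q1 q2 q3 hn
  obtain ⟨x, y, z, q4⟩ : ∃ x y z, q 4 = ![x, y, z] := ⟨_, _, _, eq_vec _⟩
  have d0 := congrFun h.dep 0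
  have d1 := congrFun h.dep 1
  have d2 := congrFun h.dep 2
  simp only [Fin.sum_univ_five, q0, q1, q2, q3, q4, h2, h3] at d0 d1 d2
  simp at d0 d1 d2
  replace d1 : y = 0 := d1.resolve_left h4.ne'
  replace d2 : z = 0 := d2.resolve_left h4.ne'
  subst d1 d2
  have hx : 0 < -x := by nlinarith
  have hx1 : x = -1 := by
    have hT : EmptyTriangle (q 4 - q 0) (q 2 - q 0) :=
      (h.reindex (s := ![0, 4, 2, 1, 3]) (by decide)).emptyTriangle (.inl h1.ne')
        (.inr (.inr (.inl (mul_pos h4 h1)))) (.inl h1.ne')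
    obtain ⟨f, f1, f2⟩ := hT.exists_functional
    rw [q0, q4, sub_zero, functional_apply] at f1
    have := eq_one_of_mul_eq_one hx (y := -f ![1, 0, 0]) (by linarith)
    linarith
  subst hx1
  have hbn : IsCoprime b n := by
    have hT : EmptyTriangle (q 3 - q 0) (q 1 - q 0) :=
      (h.reindex (s := ![0, 3, 1, 4, 2]) (by decide)).emptyTriangle (.inl h4.ne')
        (.inr (.inr (.inr (mul_pos h1 h4)))) (.inl h4.ne')
    obtain ⟨f, f1, f2⟩ := hT.exists_functional
    rw [q0, q3, sub_zero, functional_apply] at f1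
    rw [q0, q1, sub_zero] at f2
    rw [f2] at f1
    exact ⟨f ![0, 1, 0], f ![0, 0, 1], by linarith⟩
  -- The pair of functionals gives n ∣ b - 1 directly or n ∣ 2; in the latter case it follows
  -- because b is prime to n.
  have hb : n ∣ b - 1 := by
    have two : n ∣ 2 → n ∣ b - 1 := by
      intro h2
      have hle := Int.le_of_dvd (by norm_num) h2
      have hcop := Int.isCoprime_iff_gcd_eq_one.1 hbn
      interval_cases n
      · exact one_dvd _
      · by_contra hc
        have hb2 : (2 : ℤ) ∣ b := by omega
        have := Int.dvd_gcd hb2 (dvd_refl 2)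
        rw [hcop] at this
        norm_num at this
    obtain ⟨f, hf⟩ := h.white h4.ne' (.inr (.inl (mul_pos h1 h4)))
    obtain ⟨g, hg⟩ := (h.reindex (s := ![0, 4, 2, 3, 1]) (by decide)).white h1.ne'
      (.inr (.inl (mul_pos h4 h1)))
    change (g (q 4 - q 0) = 0 ∧ g (q 2 - q 0) = 1 ∧ g (q 3 - q 0) = 1) ∨
      (g (q 4 - q 0) = 1 ∧ g (q 2 - q 0) = 0 ∧ g (q 3 - q 0) = 1) ∨
      (g (q 4 - q 0) = 1 ∧ g (q 2 - q 0) = 1 ∧ g (q 3 - q 0) = 0) at hg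
    simp only [q0, q1, q2, q3, q4, sub_zero] at hf hg
    rw [functional_apply g (-1) 0 0, functional_apply g a b n] at hg
    rw [functional_apply f a b n] at hf
    rcases hf with ⟨f1, f2, f3⟩ | ⟨f1, f2, f3⟩ | ⟨f1, f2, f3⟩
    · rw [f1, f2] at f3
      exact ⟨-f ![0, 0, 1], by linarith⟩
    · rw [f1, f2] at f3
      rcases hg with ⟨g1, g2, g3⟩ | ⟨g1, g2, g3⟩ | ⟨g1, g2, g3⟩
      · rw [g2, show g ![1, 0, 0] = 0 by linarith] at g3
        exact ⟨-g ![0, 0, 1], by linarith⟩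
      · rw [g2, show g ![1, 0, 0] = -1 by linarith] at g3
        exact two ⟨f ![0, 0, 1] + g ![0, 0, 1], by linarith⟩
      · rw [g2, show g ![1, 0, 0] = -1 by linarith] at g3
        exact ⟨-f ![0, 0, 1] - g ![0, 0, 1], by linarith⟩
    · rw [f1, f2] at f3
      rcases hg with ⟨g1, g2, g3⟩ | ⟨g1, g2, g3⟩ | ⟨g1, g2, g3⟩
      · rw [g2, show g ![1, 0, 0] = 0 by linarith] at g3
        exact ⟨-g ![0, 0, 1], by linarith⟩
      · rw [g2, show g ![1, 0, 0] = -1 by linarith] at g3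
        exact ⟨-f ![0, 0, 1] - g ![0, 0, 1], by linarith⟩
      · rw [g2, show g ![1, 0, 0] = -1 by linarith] at g3
        refine two (hbn.symm.dvd_of_dvd_mul_right ⟨-f ![0, 0, 1] - g ![0, 0, 1], by linarith⟩)
  obtain ⟨t, ht⟩ := hb
  have hcop : IsCoprime a n := by
    have hT : EmptyTriangle (q 3 - q 2) (q 1 - q 2) :=
      (h.reindex (s := ![2, 3, 1, 0, 4]) (by decide)).emptyTriangle (.inl h0.ne)
        (.inl h4.ne') (.inl h0.ne)
    obtain ⟨f, f1, f2⟩ := hT.exists_functional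
    rw [q2, q3, show (![a, b, n] - ![0, 1, 0] : Fin 3 → ℤ) = ![a, b - 1, n] by
      ext i; fin_cases i <;> simp, functional_apply, ht] at f1
    exact ⟨f ![1, 0, 0], t * f ![0, 1, 0] + f ![0, 0, 1], by linarith⟩
  obtain ⟨m, hm⟩ := exists_abs_le_half a n hn
  have hcop' : IsCoprime (a - m * n) n := by
    have := IsCoprime.add_mul_right_left hcop (-m)
    rwa [show a + -m * n = a - m * n by ring] at this
  rcases hm with ⟨hm1, hm2⟩ | ⟨hm1, hm2⟩
  · refine .of_points (.s21 (a - m * n) n hm1 hm2 (Int.isCoprime_iff_gcd_eq_one.1 hcop'))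
      ![0, 1, 2, 4, 3] (by decide) (((shearEquiv m t).trans rotateEquiv).trans swapEquiv) fun k => ?_
    fin_cases k <;> simp [q0, q1, q2, q3, q4, shearEquiv_apply, rotateEquiv_apply, swapEquiv_apply,
      TableEntry.points]
    linarith
  · refine .of_points (.s21 (-(a - m * n)) n hm1 hm2
      (Int.isCoprime_iff_gcd_eq_one.1 hcop'.neg_left))
      ![0, 4, 2, 1, 3] (by decide) ((((((shearEquiv m t).trans rotateEquiv).trans rotateEquiv).trans
        flipEquiv).trans rotateEquiv).trans (rotateEquiv.trans swapEquiv)) fun k => ?_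
    fin_cases k <;> simp [q0, q1, q2, q3, q4, shearEquiv_apply, rotateEquiv_apply, swapEquiv_apply,
      flipEquiv_apply, TableEntry.points]
    linarith

/-- The midpoint of two of the points is not a lattice point, unless it is one of the others. -/
lemma exists_eq_midpoint (h : Config p c) {i j : Fin 5} {v : Fin 3 → ℤ}
    (hv : (2 : ℤ) • v = p i + p j) : ∃ k, v = p k := by
  have hs : ∑ k, (Pi.single i 1 + Pi.single j 1 : Fin 5 → ℤ) k = 2 := by
    simp [Finset.sum_add_distrib]
  refine h.closed v (Pi.single i 1 + Pi.single j 1) (fun k => ?_) (by rw [hs]; norm_num) ?_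
  · simp only [Pi.add_apply, Pi.single_apply]
    split_ifs <;> norm_num
  · rw [hs, hv]
    simp [Pi.single_apply, add_smul, Finset.sum_add_distrib, ite_smul, -zsmul_eq_mul]

-- The unimodular triangles at `p 0` make it the centroid of `p 1`, `p 2`, `p 4`, so only the apex
-- (a, b, n) is unknown, and White's theorem on the three tetrahedra above these triangles gives n ∣
-- 3.
set_option maxHeartbeats 1000000 in
theorem classified_three_one (h : Config p c) (h1 : 0 < c 1) (h2 : 0 < c 2)
    (h3 : c 3 = 0) (h4 : 0 < c 4) : Classified p := by
  refine h.classified_of_normal (h.emptyTriangle (.inr h4.ne') (.inl h4.ne')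
    (.inr (.inr (.inl (mul_pos h1 h4))))) h4.ne' ?_
  clear h
  intro q a b n h q0 q1 q2 q3 hn
  obtain ⟨x, y, z, q4⟩ : ∃ x y z, q 4 = ![x, y, z] := ⟨_, _, _, eq_vec _⟩
  have d0 := congrFun h.dep 0
  have d1 := congrFun h.dep 1
  have d2 := congrFun h.dep 2
  simp only [Fin.sum_univ_five, q0, q1, q2, q3, q4, h3] at d0 d1 d2
  simp at d0 d1 d2
  replace d2 : z = 0 := d2.resolve_left h4.ne'
  subst d2
  have hx : 0 < -x := by nlinarith
  have hy : 0 < -y := by nlinarith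
  have hx1 : x = -1 := by
    have hT : EmptyTriangle (q 4 - q 0) (q 2 - q 0) :=
      (h.reindex (s := ![0, 4, 2, 1, 3]) (by decide)).emptyTriangle (.inl h1.ne')
        (.inr (.inr (.inl (mul_pos h4 h1)))) (.inl h1.ne')
    obtain ⟨f, f1, f2⟩ := hT.exists_functional
    rw [q0, q4, sub_zero, functional_apply] at f1
    rw [q0, q2, sub_zero] at f2
    have := eq_one_of_mul_eq_one hx (y := -f ![1, 0, 0]) (by rw [f2] at f1; linarith)
    linarith
  have hy1 : y = -1 := by
    have hT : EmptyTriangle (q 4 - q 0) (q 1 - q 0) :=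
      (h.reindex (s := ![0, 4, 1, 2, 3]) (by decide)).emptyTriangle (.inl h2.ne')
        (.inr (.inr (.inl (mul_pos h4 h2)))) (.inl h2.ne')
    obtain ⟨f, f1, f2⟩ := hT.exists_functional
    rw [q0, q4, sub_zero, functional_apply] at f1
    rw [q0, q1, sub_zero] at f2
    have := eq_one_of_mul_eq_one hy (y := -f ![0, 1, 0]) (by rw [f2] at f1; linarith)
    linarith
  subst hx1 hy1
  have hbn : ∃ r s, b * r + n * s = 1 := by
    have hT : EmptyTriangle (q 3 - q 0) (q 1 - q 0) :=
      (h.reindex (s := ![0, 3, 1, 4, 2]) (by decide)).emptyTriangle (.inl h4.ne')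
        (.inl h2.ne') (.inl h4.ne')
    obtain ⟨f, f1, f2⟩ := hT.exists_functional
    rw [q0, q3, sub_zero, functional_apply] at f1
    rw [q0, q1, sub_zero] at f2
    rw [f2] at f1
    exact ⟨f ![0, 1, 0], f ![0, 0, 1], by linarith⟩
  have han : ∃ r s, a * r + n * s = 1 := by
    have hT : EmptyTriangle (q 3 - q 0) (q 2 - q 0) :=
      (h.reindex (s := ![0, 3, 2, 4, 1]) (by decide)).emptyTriangle (.inl h4.ne')
        (.inl h1.ne') (.inl h4.ne')
    obtain ⟨f, f1, f2⟩ := hT.exists_functional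
    rw [q0, q3, sub_zero, functional_apply] at f1
    rw [q0, q2, sub_zero] at f2
    rw [f2] at f1
    exact ⟨f ![1, 0, 0], f ![0, 0, 1], by linarith⟩
  have habn : ∃ r s, (a - b) * r + n * s = 1 := by
    have hT : EmptyTriangle (q 3 - q 0) (q 4 - q 0) :=
      (h.reindex (s := ![0, 3, 4, 2, 1]) (by decide)).emptyTriangle (.inl h2.ne')
        (.inl h1.ne') (.inl h2.ne')
    obtain ⟨f, f1, f2⟩ := hT.exists_functional
    rw [q0, q3, sub_zero, functional_apply] at f1
    rw [q0, q4, sub_zero, functional_apply] at f2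
    exact ⟨f ![1, 0, 0], f ![0, 0, 1], by linear_combination f1 + b * f2⟩
  -- The four base points represent all classes of (a, b) modulo 2; for even n the midpoint of the
  -- apex and the congruent base point would be a new lattice point.
  have hodd : n % 2 = 1 := by
    by_contra hc
    have key : ∀ j : Fin 5, q j 2 = 0 → ∀ x y, 2 * x = a + q j 0 → 2 * y = b + q j 1 →
        False := by
      intro j hj2 x y hx hy
      obtain ⟨k, hk⟩ := h.exists_eq_midpoint (i := 3) (j := j) (v := ![x, y, n / 2]) (by
        ext i; fin_cases i <;> simp [q3, hx, hy, hj2]; omega)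
      have := congrFun hk 2
      fin_cases k <;> simp [q0, q1, q2, q3, q4] at this <;> omega
    rcases Int.emod_two_eq_zero_or_one a with ha | ha <;>
      rcases Int.emod_two_eq_zero_or_one b with hb | hb
    · exact key 0 (by simp [q0]) (a / 2) (b / 2) (by simp [q0]; omega)
        (by simp [q0]; omega)
    · exact key 2 (by simp [q2]) (a / 2) (b / 2 + 1) (by simp [q2]; omega)
        (by simp [q2]; omega)
    · exact key 1 (by simp [q1]) (a / 2 + 1) (b / 2) (by simp [q1]; omega)
        (by simp [q1]; omega)
    · exact key 4 (by simp [q4]) (a / 2) (b / 2) (by simp [q4]; omega)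
        (by simp [q4]; omega)
  have hn13 : n ∣ 3 := by
    obtain ⟨f, hf⟩ := h.white h4.ne' (.inr (.inl (mul_pos h1 h4)))
    obtain ⟨g, hg⟩ := (h.reindex (s := ![0, 2, 4, 3, 1]) (by decide)).white h1.ne'
      (.inr (.inl (mul_pos h2 h1)))
    obtain ⟨e, he⟩ := (h.reindex (s := ![0, 1, 4, 3, 2]) (by decide)).white h2.ne'
      (.inr (.inl (mul_pos h1 h2)))
    change (g (q 2 - q 0) = 0 ∧ g (q 4 - q 0) = 1 ∧ g (q 3 - q 0) = 1) ∨
      (g (q 2 - q 0) = 1 ∧ g (q 4 - q 0) = 0 ∧ g (q 3 - q 0) = 1) ∨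
      (g (q 2 - q 0) = 1 ∧ g (q 4 - q 0) = 1 ∧ g (q 3 - q 0) = 0) at hg
    change (e (q 1 - q 0) = 0 ∧ e (q 4 - q 0) = 1 ∧ e (q 3 - q 0) = 1) ∨
      (e (q 1 - q 0) = 1 ∧ e (q 4 - q 0) = 0 ∧ e (q 3 - q 0) = 1) ∨
      (e (q 1 - q 0) = 1 ∧ e (q 4 - q 0) = 1 ∧ e (q 3 - q 0) = 0) at he
    simp only [q0, q1, q2, q3, q4, sub_zero] at hf hg he
    rw [functional_apply g (-1) (-1) 0, functional_apply g a b n] at hg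
    rw [functional_apply e (-1) (-1) 0, functional_apply e a b n] at he
    rw [functional_apply f a b n] at hf
    generalize f ![1, 0, 0] = f₁, f ![0, 1, 0] = f₂, f ![0, 0, 1] = f₃ at hf
    generalize g ![1, 0, 0] = g₁, g ![0, 1, 0] = g₂, g ![0, 0, 1] = g₃ at hg
    generalize e ![1, 0, 0] = e₁, e ![0, 1, 0] = e₂, e ![0, 0, 1] = e₃ at he
    have hf' : (f₁ = 0 ∧ f₂ = 1 ∧ a * f₁ + b * f₂ + n * f₃ = 1) ∨
      (f₁ = 1 ∧ f₂ = 0 ∧ a * f₁ + b * f₂ + n * f₃ = 1) ∨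
      (f₁ = 1 ∧ f₂ = 1 ∧ a * f₁ + b * f₂ + n * f₃ = 0) := by omega
    have hg' : (g₁ = -1 ∧ g₂ = 0 ∧ a * g₁ + b * g₂ + n * g₃ = 1) ∨
      (g₁ = -1 ∧ g₂ = 1 ∧ a * g₁ + b * g₂ + n * g₃ = 1) ∨
      (g₁ = -2 ∧ g₂ = 1 ∧ a * g₁ + b * g₂ + n * g₃ = 0) := by omega
    have he' : (e₁ = 0 ∧ e₂ = -1 ∧ a * e₁ + b * e₂ + n * e₃ = 1) ∨
      (e₁ = 1 ∧ e₂ = -1 ∧ a * e₁ + b * e₂ + n * e₃ = 1) ∨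
      (e₁ = 1 ∧ e₂ = -2 ∧ a * e₁ + b * e₂ + n * e₃ = 0) := by omega
    exact dvd_three_of_functionals hn hodd han hf' hg' he'
  have hle := Int.le_of_dvd (by norm_num) hn13
  have hn' : n = 1 ∨ n = 3 := by omega
  rcases hn' with rfl | rfl
  · refine .of_points .s31_3 ![0, 1, 2, 4, 3] (by decide) (shearEquiv a b) fun k => ?_
    fin_cases k <;> simp [q0, q1, q2, q3, q4, shearEquiv_apply, TableEntry.points]
  · have nd : ∀ u : ℤ, (∃ r s, u * r + 3 * s = 1) → u % 3 ≠ 0 := by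
      rintro u ⟨r, s, hrs⟩ hu
      have : u = 3 * (u / 3) := by omega
      rw [this] at hrs
      have : (3 : ℤ) ∣ 1 := ⟨u / 3 * r + s, by linarith⟩
      norm_num at this
    have ha := nd _ han
    have hb := nd _ hbn
    have hab := nd _ habn
    -- None of a, b, a - b is divisible by 3, by the empty triangles through the apex; the two
    -- classes are exchanged by swapping e₁ and e₂.
    have hcase : (a % 3 = 1 ∧ b % 3 = 2) ∨ (a % 3 = 2 ∧ b % 3 = 1) := by omega
    rcases hcase with ⟨ha, hb⟩ | ⟨ha, hb⟩
    · refine .of_points .s31_9 ![0, 1, 2, 4, 3] (by decide) (shearEquiv (a / 3) (b / 3))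
        fun k => ?_
      fin_cases k <;> simp [q0, q1, q2, q3, q4, shearEquiv_apply, TableEntry.points]
      omega
    · refine .of_points .s31_9 ![0, 2, 1, 4, 3] (by decide)
        ((shearEquiv (a / 3) (b / 3)).trans swapEquiv) fun k => ?_
      fin_cases k <;> simp [q0, q1, q2, q3, q4, shearEquiv_apply, swapEquiv_apply,
        TableEntry.points]
      omega

end Config

/-! ### Signature (4,1): emptiness, coprime weights and reconstruction -/

/-- The determinant of three vectors. -/
def det3 (u v w : Fin 3 → ℤ) : ℤ :=
  u 0 * (v 1 * w 2 - v 2 * w 1) - u 1 * (v 0 * w 2 - v 2 * w 0) + u 2 * (v 0 * w 1 - v 1 * w 0)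

lemma exists_equiv_of_det3 {u v w : Fin 3 → ℤ} (h : IsUnit (det3 u v w)) :
    ∃ E : (Fin 3 → ℤ) ≃ₗ[ℤ] (Fin 3 → ℤ), ∀ a b c : ℤ, E ![a, b, c] = a • u + b • v + c • w := by
  set M : Matrix (Fin 3) (Fin 3) ℤ := !![u 0, v 0, w 0; u 1, v 1, w 1; u 2, v 2, w 2] with hM
  have hdet : IsUnit M.det := by
    rw [Matrix.det_fin_three]
    convert h using 1
    simp [hM, det3]
    ring
  refine ⟨Matrix.toLin'OfInv (Matrix.nonsing_inv_mul M hdet) (Matrix.mul_nonsing_inv M hdet), ?_⟩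
  intro a b c
  change M.mulVec ![a, b, c] = _
  ext i
  fin_cases i <;> simp [hM, Matrix.mulVec, dotProduct, Fin.sum_univ_three] <;> ring

namespace Config

variable {p q : Fin 5 → Fin 3 → ℤ} {c : Fin 5 → ℤ}

lemma of_smul {D : ℤ} {v : Fin 5 → ℤ} (hD : D ≠ 0) (h : Config p (D • v)) : Config p v := by
  refine ⟨h.inj, h.closed, ?_, ?_, fun d h1 h2 k l => ?_, h.noncoplanar⟩
  · have := h.sum_eq
    simp only [Pi.smul_apply, smul_eq_mul, ← Finset.mul_sum] at this
    exact (mul_eq_zero.1 this).resolve_left hD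
  · have := h.dep
    simp only [Pi.smul_apply, smul_assoc, ← Finset.smul_sum] at this
    exact (smul_eq_zero.1 this).resolve_left hD
  · have := h.unique d h1 h2 k l
    simp only [Pi.smul_apply, smul_eq_mul] at this
    apply mul_left_cancel₀ hD
    linarith

/-- A lattice point on a proper face of a simplicial configuration is a vertex. -/
lemma exists_eq_sum (h : Config p c) (hc : ∀ k, c k ≠ 0) {a : Fin 5 → ℤ} (ha : ∀ k, 0 ≤ a k)
    (hs : 0 < ∑ k, a k) {v : Fin 3 → ℤ} (hv : (∑ k, a k) • v = ∑ k, a k • p k) {l m : Fin 5}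
    (hlm : l ≠ m) (hl : a l = 0) (hm : a m = 0) : ∃ k, a k = ∑ j, a j := by
  obtain ⟨k, rfl⟩ := h.closed v a ha hs hv
  obtain ⟨j, hjk, hj⟩ : ∃ j, j ≠ k ∧ a j = 0 := by
    by_cases hlk : l = k
    · exact ⟨m, fun hmk => hlm (hlk.trans hmk.symm), hm⟩
    · exact ⟨l, hlk, hl⟩
  refine ⟨k, ?_⟩
  have := h.unique (a - Pi.single k (∑ k, a k)) (by simp [Finset.sum_sub_distrib])
    (by simp [sub_smul, Finset.sum_sub_distrib, ← hv, Pi.single_apply, ite_smul, -zsmul_eq_mul]) k j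
  simp only [Pi.sub_apply, Pi.single_eq_same, Pi.single_eq_of_ne hjk, hj, sub_zero, zero_mul,
    mul_eq_zero, hc, or_false] at this
  linarith

lemma not_two_dvd (h : Config p c) (hc : ∀ k, c k ≠ 0) {i j : Fin 5} (hij : i ≠ j) :
    ¬ ∀ t, (2 : ℤ) ∣ p i t + p j t := by
  intro hd
  choose v hv using hd
  set a : Fin 5 → ℤ := Pi.single i 1 + Pi.single j 1 with ha
  have hs : ∑ k, a k = 2 := by simp [ha, Finset.sum_add_distrib]
  have hsum : ∑ k, a k • p k = p i + p j := by
    simp [ha, Pi.single_apply, add_smul, Finset.sum_add_distrib, ite_smul, -zsmul_eq_mul]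
  have ha1 : ∀ k, a k = (if k = i then 1 else 0) + (if k = j then 1 else 0) := by
    intro k; simp [ha, Pi.single_apply]
  obtain ⟨l, m, hlm, hl, hm⟩ : ∃ l m, l ≠ m ∧ a l = 0 ∧ a m = 0 := by
    simp only [ha1]
    clear * - hij
    revert i j; decide
  obtain ⟨k, hk⟩ := h.exists_eq_sum hc (a := a) (v := v)
    (fun k => by rw [ha1]; split_ifs <;> norm_num) (by rw [hs]; norm_num)
    (by rw [hs, hsum]; ext t; simp [hv]) hlm hl hm
  rw [hs, ha1] at hk
  split_ifs at hk <;> omega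

/-- Otherwise a trisection point of a segment or the centroid of a triangle would be a lattice
point. Modulo 3, the points are thus distinct and no three lie on a line. -/
lemma not_three_dvd (h : Config p c) (hc : ∀ k, c k ≠ 0) {i j l : Fin 5}
    (hij : ¬ (i = j ∧ j = l)) : ¬ ∀ t, (3 : ℤ) ∣ p i t + p j t + p l t := by
  intro hd
  choose v hv using hd
  set a : Fin 5 → ℤ := Pi.single i 1 + Pi.single j 1 + Pi.single l 1 with ha
  have hs : ∑ k, a k = 3 := by simp [ha, Finset.sum_add_distrib]
  have hsum : ∑ k, a k • p k = p i + p j + p l := by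
    simp [ha, Pi.single_apply, add_smul, Finset.sum_add_distrib, ite_smul, -zsmul_eq_mul]
  have ha1 : ∀ k, a k = (if k = i then 1 else 0) + (if k = j then 1 else 0) +
      (if k = l then 1 else 0) := by
    intro k; simp [ha, Pi.single_apply]
  obtain ⟨l', m, hlm, hl, hm⟩ : ∃ l' m, l' ≠ m ∧ a l' = 0 ∧ a m = 0 := by
    simp only [ha1]
    clear * - hij
    revert i j l; decide
  obtain ⟨k, hk⟩ := h.exists_eq_sum hc (a := a) (v := v)
    (fun k => by rw [ha1]; split_ifs <;> norm_num) (by rw [hs]; norm_num)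
    (by rw [hs, hsum]; ext t; simp [hv]) hlm hl hm
  rw [hs, ha1] at hk
  split_ifs at hk <;> omega

/-- A functional with values 1 and 0 on the edges of the empty triangle `p 0`, `p 1`, `p 2`
expresses `c 1` through `c 3` and `c 4`, and similarly `c 2`. A common divisor of `c 3` and `c 4`
therefore divides all coefficients. -/
lemma isCoprime_three_four (h : Config p c) (hc : ∀ k, c k ≠ 0)
    (hp : ∀ d : ℤ, (∀ k, d ∣ c k) → IsUnit d) : IsCoprime (c 3) (c 4) := by
  have hdep : ∀ f : (Fin 3 → ℤ) →ₗ[ℤ] ℤ, c 1 * f (p 1 - p 0) + c 2 * f (p 2 - p 0) +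
      c 3 * f (p 3 - p 0) + c 4 * f (p 4 - p 0) = 0 := by
    intro f
    have e1 := congrArg f h.dep
    have e2 := h.sum_eq
    simp only [Fin.sum_univ_five, map_add, map_smul, map_zero, smul_eq_mul] at e1 e2
    simp only [map_sub]
    linear_combination e1 - f (p 0) * e2
  obtain ⟨f, f1, f2⟩ := (h.emptyTriangle (.inl (hc 3)) (.inl (hc 4)) (.inl (hc 3))).exists_functional
  have hT : EmptyTriangle (p 2 - p 0) (p 1 - p 0) :=
    (h.reindex (s := ![0, 2, 1, 3, 4]) (by decide)).emptyTriangle (.inl (hc 3)) (.inl (hc 4))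
      (.inl (hc 3))
  obtain ⟨g, g1, g2⟩ := hT.exists_functional
  have ef := hdep f
  have eg := hdep g
  rw [f1, f2] at ef
  rw [g1, g2] at eg
  rw [Int.isCoprime_iff_gcd_eq_one]
  have d3 := Int.gcd_dvd_left (a := c 3) (b := c 4)
  have d4 := Int.gcd_dvd_right (a := c 3) (b := c 4)
  have d1 : (Int.gcd (c 3) (c 4) : ℤ) ∣ c 1 := by
    rw [show c 1 = -(c 3 * f (p 3 - p 0) + c 4 * f (p 4 - p 0)) by linarith]
    exact (dvd_add (d3.mul_right _) (d4.mul_right _)).neg_right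
  have d2 : (Int.gcd (c 3) (c 4) : ℤ) ∣ c 2 := by
    rw [show c 2 = -(c 3 * g (p 3 - p 0) + c 4 * g (p 4 - p 0)) by linarith]
    exact (dvd_add (d3.mul_right _) (d4.mul_right _)).neg_right
  have d0 : (Int.gcd (c 3) (c 4) : ℤ) ∣ c 0 := by
    have e2 := h.sum_eq
    simp only [Fin.sum_univ_five] at e2
    rw [show c 0 = -(c 1 + c 2 + c 3 + c 4) by linarith]
    exact (dvd_add (dvd_add (dvd_add d1 d2) d3) d4).neg_right
  have hu := hp _ (fun k => by fin_cases k; exacts [d0, d1, d2, d3, d4])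
  have := Int.isUnit_iff.1 hu
  omega

lemma isCoprime (h : Config p c) (hc : ∀ k, c k ≠ 0)
    (hp : ∀ d : ℤ, (∀ k, d ∣ c k) → IsUnit d) :
    IsCoprime (c 1) (c 2) ∧ IsCoprime (c 1) (c 3) ∧ IsCoprime (c 2) (c 3) ∧
      IsCoprime (c 1) (c 4) ∧ IsCoprime (c 2) (c 4) ∧ IsCoprime (c 3) (c 4) := by
  have key : ∀ s : Fin 5 → Fin 5, Function.Bijective s → IsCoprime (c (s 3)) (c (s 4)) :=
    fun s hs => (h.reindex hs).isCoprime_three_four (fun k => hc _) fun d hd => hp d fun k => by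
      obtain ⟨j, rfl⟩ := hs.2 k
      exact hd j
  exact ⟨key ![0, 3, 4, 1, 2] (by decide), key ![0, 2, 4, 1, 3] (by decide),
    key ![0, 1, 4, 2, 3] (by decide), key ![0, 3, 2, 1, 4] (by decide),
    key ![0, 1, 3, 2, 4] (by decide), h.isCoprime_three_four hc hp⟩

/-- A configuration in normal form is determined by its affine dependence and an integrality
condition. -/
theorem classified_of_dependence (h : Config q c) {a b n : ℤ} (q0 : q 0 = 0) (q1 : q 1 = ![1, 0, 0])
    (q2 : q 2 = ![0, 1, 0]) (q3 : q 3 = ![a, b, n]) (hn : n ≠ 0) (hc : c 4 ≠ 0) (e : TableEntry)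
    (s t : Fin 5 → Fin 5) (hst : ∀ k, s (t k) = k) (he0 : e.points (s 0) = 0)
    (hdep : c 1 • e.points (s 1) + c 2 • e.points (s 2) + c 3 • e.points (s 3) +
      c 4 • e.points (s 4) = 0) (r : Fin 3 → ℤ)
    (hr : a • e.points (s 1) + b • e.points (s 2) + n • r = e.points (s 3))
    (hdet : det3 (e.points (s 1)) (e.points (s 2)) (e.points (s 3)) = n ∨
      det3 (e.points (s 1)) (e.points (s 2)) (e.points (s 3)) = -n) : Classified q := by
  -- The vector `r` is to be the image of e₃. Equal volumes, up to sign, make the map unimodular.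
  have hu : IsUnit (det3 (e.points (s 1)) (e.points (s 2)) r) := by
    have : det3 (e.points (s 1)) (e.points (s 2)) (e.points (s 3)) =
        n * det3 (e.points (s 1)) (e.points (s 2)) r := by
      rw [← hr]
      simp only [det3, Pi.add_apply, Pi.smul_apply, smul_eq_mul]
      ring
    rw [this] at hdet
    rw [Int.isUnit_iff]
    rcases hdet with h | h
    · left; exact mul_left_cancel₀ hn (by linarith)
    · right; exact mul_left_cancel₀ hn (by linarith)
  obtain ⟨E, hE⟩ := exists_equiv_of_det3 hu
  have E1 : E (q 1) = e.points (s 1) := by rw [q1, hE]; simp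
  have E2 : E (q 2) = e.points (s 2) := by rw [q2, hE]; simp
  have E3 : E (q 3) = e.points (s 3) := by rw [q3, hE, hr]
  have E4 : E (q 4) = e.points (s 4) := by
    have hd := congrArg E h.dep
    simp only [Fin.sum_univ_five, map_add, map_smul, map_zero, q0, smul_zero, zero_add, E1, E2,
      E3] at hd
    have : c 4 • E (q 4) = c 4 • e.points (s 4) := by
      rw [← hdep] at hd
      exact add_left_cancel hd
    exact smul_right_injective _ hc this
  have hall : ∀ k, E (q k) = e.points (s k) := by
    intro k
    fin_cases k
    · change E (q 0) = _; rw [q0, map_zero]; exact he0.symm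
    · exact E1
    · exact E2
    · exact E3
    · exact E4
  refine .of_points e t ?_ E fun k => by rw [hall, hst]
  exact Finite.injective_iff_bijective.1 (Function.LeftInverse.injective hst)

/-- As `c 3` and `c 4` are coprime, e₃ is an integral combination of the points; its image is the
same combination of the table's points, so the dependence alone determines the configuration. -/
theorem classified_of_primitive (h : Config q c) {a b x y : ℤ} (q0 : q 0 = 0)
    (q1 : q 1 = ![1, 0, 0]) (q2 : q 2 = ![0, 1, 0]) (q3 : q 3 = ![a, b, c 4])
    (q4 : q 4 = ![x, y, -c 3]) (hc : c 4 ≠ 0) (hco : IsCoprime (c 3) (c 4)) (e : TableEntry)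
    (s t : Fin 5 → Fin 5) (hst : ∀ k, s (t k) = k) (he0 : e.points (s 0) = 0)
    (hdep : c 1 • e.points (s 1) + c 2 • e.points (s 2) + c 3 • e.points (s 3) +
      c 4 • e.points (s 4) = 0)
    (hdet : det3 (e.points (s 1)) (e.points (s 2)) (e.points (s 3)) = c 4 ∨
      det3 (e.points (s 1)) (e.points (s 2)) (e.points (s 3)) = -c 4) : Classified q := by
  obtain ⟨u, v, huv⟩ := hco
  have d0 := congrFun h.dep 0
  have d1 := congrFun h.dep 1
  simp only [Fin.sum_univ_five, q0, q1, q2, q3, q4] at d0 d1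
  simp at d0 d1
  refine h.classified_of_dependence q0 q1 q2 q3 hc hc e s t hst he0 hdep
    (v • e.points (s 3) - u • e.points (s 4) - (v * a - u * x) • e.points (s 1) -
      (v * b - u * y) • e.points (s 2)) ?_ hdet
  ext i
  have hi := congrFun hdep i
  simp only [Pi.add_apply, Pi.sub_apply, Pi.smul_apply, smul_eq_mul, Pi.zero_apply] at hi ⊢
  linear_combination -u * hi + e.points (s 3) i * huv + u * e.points (s 1) i * d0 +
    u * e.points (s 2) i * d1 - a * e.points (s 1) i * huv - b * e.points (s 2) i * huv

end Config

/-! ### Signature (4,1): the index of the generated sublattice -/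

lemma dvd_of_dvd_gcd {g m r k₁ k₂ k₃ k₄ : ℤ} (hm : m ≠ 0) (h₁ : g * m ∣ k₁) (h₂ : g * m ∣ k₂)
    (h₃ : g * m ∣ k₃) (h₄ : g * m ∣ k₄)
    (h : ((Int.gcd (Int.gcd k₁ k₂) (Int.gcd k₃ k₄) : ℕ) : ℤ) ∣ r * m) : g ∣ r :=
  (mul_dvd_mul_iff_right hm).1
    ((Int.dvd_coe_gcd (Int.dvd_coe_gcd h₁ h₂) (Int.dvd_coe_gcd h₃ h₄)).trans h)

/-- The digits in the name are the weights. The functionals belong to the four tetrahedra around the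
interior point; their values at `p 4` are eliminated by the dependence, which in the analogues below
also discards non-integral cases. In each combination the gcd of the four 3 × 3 determinants bounds
g; the allowed factors 2 and 3 are removed later by `index_coprime_six`. -/
lemma dvd_of_functionals_1111 {a b g f₁ f₂ f₃ g₁ g₂ g₃ e₁ e₂ e₃ d₁ d₂ d₃ F G E D : ℤ}
    (ef : a * f₁ + b * f₂ + g * 1 * f₃ = F) (eg : a * g₁ + b * g₂ + g * 1 * g₃ = G)
    (ee : a * e₁ + b * e₂ + g * 1 * e₃ = E) (ed : a * d₁ + b * d₂ + g * 1 * d₃ = D)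
    (hf : (f₁ = 0 ∧ f₂ = 1 ∧ F = 1) ∨ (f₁ = 1 ∧ f₂ = 0 ∧ F = 1) ∨ (f₁ = 1 ∧ f₂ = 1 ∧ F = 0))
    (hg : (g₁ = 0 ∧ g₂ = 1 ∧ G = -2) ∨ (g₁ = 1 ∧ g₂ = 0 ∧ G = -2) ∨ (g₁ = 1 ∧ g₂ = 1 ∧ G = -2))
    (he : (e₁ = 0 ∧ e₂ = -2 ∧ E = 1) ∨ (e₁ = 1 ∧ e₂ = -2 ∧ E = 0) ∨ (e₁ = 1 ∧ e₂ = -2 ∧ E = 1))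
    (hd : (d₁ = -2 ∧ d₂ = 0 ∧ D = 1) ∨ (d₁ = -2 ∧ d₂ = 1 ∧ D = 0) ∨ (d₁ = -2 ∧ d₂ = 1 ∧ D = 1)) :
    g ∣ 60 := by
  rcases hf with ⟨rfl, rfl, rfl⟩ | ⟨rfl, rfl, rfl⟩ | ⟨rfl, rfl, rfl⟩ <;>
  rcases hg with ⟨rfl, rfl, rfl⟩ | ⟨rfl, rfl, rfl⟩ | ⟨rfl, rfl, rfl⟩ <;>
  rcases he with ⟨rfl, rfl, rfl⟩ | ⟨rfl, rfl, rfl⟩ | ⟨rfl, rfl, rfl⟩ <;>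
  rcases hd with ⟨rfl, rfl, rfl⟩ | ⟨rfl, rfl, rfl⟩ | ⟨rfl, rfl, rfl⟩ <;>
  (refine dvd_of_dvd_gcd (by norm_num) (dvd_det_functional ef eg ee) (dvd_det_functional ef eg ed)
      (dvd_det_functional ef ee ed) (dvd_det_functional eg ee ed) ?_; decide)

lemma dvd_of_functionals_1112 {a b g f₁ f₂ f₃ g₁ g₂ g₃ e₁ e₂ e₃ d₁ d₂ d₃ F G E D : ℤ}
    (ef : a * f₁ + b * f₂ + g * 2 * f₃ = F) (eg : a * g₁ + b * g₂ + g * 2 * g₃ = G)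
    (ee : a * e₁ + b * e₂ + g * 2 * e₃ = E) (ed : a * d₁ + b * d₂ + g * 2 * d₃ = D)
    (hf : (f₁ = 0 ∧ f₂ = 1 ∧ F = 1) ∨ (f₁ = 1 ∧ f₂ = 0 ∧ F = 1) ∨ (f₁ = 1 ∧ f₂ = 1 ∧ F = 0))
    (hg : (g₁ = 0 ∧ g₂ = 1 ∧ G = -3) ∨ (g₁ = 1 ∧ g₂ = 0 ∧ G = -3) ∨ (g₁ = 1 ∧ g₂ = 1 ∧ G = -2))
    (he : (e₁ = 0 ∧ e₂ = -3 ∧ E = 1) ∨ (e₁ = 1 ∧ e₂ = -3 ∧ E = 0) ∨ (e₁ = 1 ∧ e₂ = -2 ∧ E = 1))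
    (hd : (d₁ = -3 ∧ d₂ = 0 ∧ D = 1) ∨ (d₁ = -3 ∧ d₂ = 1 ∧ D = 0) ∨ (d₁ = -2 ∧ d₂ = 1 ∧ D = 1)) :
    g ∣ 12 := by
  rcases hf with ⟨rfl, rfl, rfl⟩ | ⟨rfl, rfl, rfl⟩ | ⟨rfl, rfl, rfl⟩ <;>
  rcases hg with ⟨rfl, rfl, rfl⟩ | ⟨rfl, rfl, rfl⟩ | ⟨rfl, rfl, rfl⟩ <;>
  rcases he with ⟨rfl, rfl, rfl⟩ | ⟨rfl, rfl, rfl⟩ | ⟨rfl, rfl, rfl⟩ <;>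
  rcases hd with ⟨rfl, rfl, rfl⟩ | ⟨rfl, rfl, rfl⟩ | ⟨rfl, rfl, rfl⟩ <;>
  (refine dvd_of_dvd_gcd (by norm_num) (dvd_det_functional ef eg ee) (dvd_det_functional ef eg ed)
      (dvd_det_functional ef ee ed) (dvd_det_functional eg ee ed) ?_; decide)

lemma dvd_of_functionals_1123 {a b g f₁ f₂ f₃ g₁ g₂ g₃ e₁ e₂ e₃ d₁ d₂ d₃ F G E D : ℤ}
    (hg0 : 0 < g)
    (ef : a * f₁ + b * f₂ + g * 3 * f₃ = F) (eg : a * g₁ + b * g₂ + g * 3 * g₃ = G)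
    (ee : a * e₁ + b * e₂ + g * 3 * e₃ = E) (ed : a * d₁ + b * d₂ + g * 3 * d₃ = D)
    (hf : (f₁ = 0 ∧ f₂ = 1 ∧ F = 1) ∨ (f₁ = 1 ∧ f₂ = 0 ∧ F = 1))
    (hg : (g₁ = 0 ∧ g₂ = 1 ∧ G = -2) ∨ (g₁ = 1 ∧ g₂ = 0 ∧ G = -2) ∨ (g₁ = 1 ∧ g₂ = 1 ∧ G = -1))
    (he : (e₁ = 0 ∧ e₂ = -5 ∧ E = 1) ∨ (e₁ = 1 ∧ e₂ = -4 ∧ E = 0) ∨ (e₁ = 1 ∧ e₂ = -3 ∧ E = 1))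
    (hd : (d₁ = -5 ∧ d₂ = 0 ∧ D = 1) ∨ (d₁ = -4 ∧ d₂ = 1 ∧ D = 0) ∨ (d₁ = -3 ∧ d₂ = 1 ∧ D = 1)) :
    g ∣ 12 := by
  rcases hf with ⟨rfl, rfl, rfl⟩ | ⟨rfl, rfl, rfl⟩ <;>
  rcases hg with ⟨rfl, rfl, rfl⟩ | ⟨rfl, rfl, rfl⟩ | ⟨rfl, rfl, rfl⟩ <;>
  rcases he with ⟨rfl, rfl, rfl⟩ | ⟨rfl, rfl, rfl⟩ | ⟨rfl, rfl, rfl⟩ <;>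
  rcases hd with ⟨rfl, rfl, rfl⟩ | ⟨rfl, rfl, rfl⟩ | ⟨rfl, rfl, rfl⟩ <;>
  first
  | (refine dvd_of_dvd_gcd (by norm_num) (dvd_det_functional ef eg ee) (dvd_det_functional ef eg ed)
      (dvd_det_functional ef ee ed) (dvd_det_functional eg ee ed) ?_; decide)
  -- Some combinations have determinants compatible with g = 5, but then the four equations are
  -- inconsistent modulo 5.
  | (have h5 : g ∣ 5 := by
       refine dvd_of_dvd_gcd (by norm_num) (dvd_det_functional ef eg ee) (dvd_det_functional ef eg ed)
         (dvd_det_functional ef ee ed) (dvd_det_functional eg ee ed) ?_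
       decide
     have := Int.le_of_dvd (by norm_num) h5
     interval_cases g <;> omega)

lemma dvd_of_functionals_1235 {a b g f₁ f₂ f₃ g₁ g₂ g₃ e₁ e₂ e₃ d₁ d₂ d₃ F G E D : ℤ}
    (ef : a * f₁ + b * f₂ + g * 5 * f₃ = F) (eg : a * g₁ + b * g₂ + g * 5 * g₃ = G)
    (ee : a * e₁ + b * e₂ + g * 5 * e₃ = E) (ed : a * d₁ + b * d₂ + g * 5 * d₃ = D)
    (hf : (f₁ = 0 ∧ f₂ = 1 ∧ F = 1))
    (hg : (g₁ = 1 ∧ g₂ = 0 ∧ G = -2) ∨ (g₁ = 1 ∧ g₂ = 1 ∧ G = -1))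
    (he : (e₁ = 0 ∧ e₂ = -4 ∧ E = 1) ∨ (e₁ = 1 ∧ e₂ = -3 ∧ E = 0) ∨ (e₁ = 1 ∧ e₂ = -2 ∧ E = 1))
    (hd : (d₁ = -8 ∧ d₂ = 0 ∧ D = 1) ∨ (d₁ = -7 ∧ d₂ = 1 ∧ D = 0) ∨ (d₁ = -5 ∧ d₂ = 1 ∧ D = 1)) :
    g ∣ 12 := by
  rcases hf with ⟨rfl, rfl, rfl⟩ <;>
  rcases hg with ⟨rfl, rfl, rfl⟩ | ⟨rfl, rfl, rfl⟩ <;>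
  rcases he with ⟨rfl, rfl, rfl⟩ | ⟨rfl, rfl, rfl⟩ | ⟨rfl, rfl, rfl⟩ <;>
  rcases hd with ⟨rfl, rfl, rfl⟩ | ⟨rfl, rfl, rfl⟩ | ⟨rfl, rfl, rfl⟩ <;>
  (refine dvd_of_dvd_gcd (by norm_num) (dvd_det_functional ef eg ee) (dvd_det_functional ef eg ed)
      (dvd_det_functional ef ee ed) (dvd_det_functional eg ee ed) ?_; decide)

lemma dvd_of_functionals_1345 {a b g f₁ f₂ f₃ g₁ g₂ g₃ e₁ e₂ e₃ d₁ d₂ d₃ F G E D : ℤ}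
    (ef : a * f₁ + b * f₂ + g * 5 * f₃ = F) (eg : a * g₁ + b * g₂ + g * 5 * g₃ = G)
    (ee : a * e₁ + b * e₂ + g * 5 * e₃ = E) (ed : a * d₁ + b * d₂ + g * 5 * d₃ = D)
    (hf : (f₁ = 1 ∧ f₂ = 0 ∧ F = 1))
    (hg : (g₁ = 0 ∧ g₂ = 1 ∧ G = -2) ∨ (g₁ = 1 ∧ g₂ = 1 ∧ G = -1))
    (he : (e₁ = 0 ∧ e₂ = -3 ∧ E = 1) ∨ (e₁ = 1 ∧ e₂ = -2 ∧ E = 0))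
    (hd : (d₁ = -9 ∧ d₂ = 0 ∧ D = 1) ∨ (d₁ = -8 ∧ d₂ = 1 ∧ D = 0) ∨ (d₁ = -7 ∧ d₂ = 1 ∧ D = 1)) :
    g ∣ 12 := by
  rcases hf with ⟨rfl, rfl, rfl⟩ <;>
  rcases hg with ⟨rfl, rfl, rfl⟩ | ⟨rfl, rfl, rfl⟩ <;>
  rcases he with ⟨rfl, rfl, rfl⟩ | ⟨rfl, rfl, rfl⟩ <;>
  rcases hd with ⟨rfl, rfl, rfl⟩ | ⟨rfl, rfl, rfl⟩ | ⟨rfl, rfl, rfl⟩ <;>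
  (refine dvd_of_dvd_gcd (by norm_num) (dvd_det_functional ef eg ee) (dvd_det_functional ef eg ed)
      (dvd_det_functional ef ee ed) (dvd_det_functional eg ee ed) ?_; decide)

lemma dvd_of_functionals_2357 {a b g f₁ f₂ f₃ g₁ g₂ g₃ e₁ e₂ e₃ d₁ d₂ d₃ F G E D : ℤ}
    (ef : a * f₁ + b * f₂ + g * 7 * f₃ = F) (eg : a * g₁ + b * g₂ + g * 7 * g₃ = G)
    (ee : a * e₁ + b * e₂ + g * 7 * e₃ = E) (ed : a * d₁ + b * d₂ + g * 7 * d₃ = D)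
    (hf : (f₁ = 1 ∧ f₂ = 0 ∧ F = 1))
    (hg : (g₁ = 0 ∧ g₂ = 1 ∧ G = -2) ∨ (g₁ = 1 ∧ g₂ = 1 ∧ G = -1))
    (he : (e₁ = 0 ∧ e₂ = -4 ∧ E = 1) ∨ (e₁ = 1 ∧ e₂ = -3 ∧ E = 0))
    (hd : (d₁ = -6 ∧ d₂ = 0 ∧ D = 1) ∨ (d₁ = -5 ∧ d₂ = 1 ∧ D = 0) ∨ (d₁ = -4 ∧ d₂ = 1 ∧ D = 1)) :
    g ∣ 12 := by
  rcases hf with ⟨rfl, rfl, rfl⟩ <;>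
  rcases hg with ⟨rfl, rfl, rfl⟩ | ⟨rfl, rfl, rfl⟩ <;>
  rcases he with ⟨rfl, rfl, rfl⟩ | ⟨rfl, rfl, rfl⟩ <;>
  rcases hd with ⟨rfl, rfl, rfl⟩ | ⟨rfl, rfl, rfl⟩ | ⟨rfl, rfl, rfl⟩ <;>
  (refine dvd_of_dvd_gcd (by norm_num) (dvd_det_functional ef eg ee) (dvd_det_functional ef eg ed)
      (dvd_det_functional ef ee ed) (dvd_det_functional eg ee ed) ?_; decide)

lemma dvd_of_functionals_3457 {a b g f₁ f₂ f₃ g₁ g₂ g₃ e₁ e₂ e₃ d₁ d₂ d₃ F G E D : ℤ}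
    (ef : a * f₁ + b * f₂ + g * 7 * f₃ = F) (eg : a * g₁ + b * g₂ + g * 7 * g₃ = G)
    (ee : a * e₁ + b * e₂ + g * 7 * e₃ = E) (ed : a * d₁ + b * d₂ + g * 7 * d₃ = D)
    (hf : (f₁ = 1 ∧ f₂ = 1 ∧ F = 0))
    (hg : (g₁ = 1 ∧ g₂ = 0 ∧ G = -2))
    (he : (e₁ = 0 ∧ e₂ = -3 ∧ E = 1) ∨ (e₁ = 1 ∧ e₂ = -2 ∧ E = 1))
    (hd : (d₁ = -4 ∧ d₂ = 0 ∧ D = 1) ∨ (d₁ = -3 ∧ d₂ = 1 ∧ D = 1)) :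
    g ∣ 12 := by
  rcases hf with ⟨rfl, rfl, rfl⟩ <;>
  rcases hg with ⟨rfl, rfl, rfl⟩ <;>
  rcases he with ⟨rfl, rfl, rfl⟩ | ⟨rfl, rfl, rfl⟩ <;>
  rcases hd with ⟨rfl, rfl, rfl⟩ | ⟨rfl, rfl, rfl⟩ <;>
  (refine dvd_of_dvd_gcd (by norm_num) (dvd_det_functional ef eg ee) (dvd_det_functional ef eg ed)
      (dvd_det_functional ef ee ed) (dvd_det_functional eg ee ed) ?_; decide)

/-- Index 5 survives for equal weights. The residues of a and b are then distinct elements of {1, 2,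
3}, and the six possibilities are relabellings of one another. -/
lemma residues_of_functionals_1111 {a b f₁ f₂ f₃ g₁ g₂ g₃ e₁ e₂ e₃ d₁ d₂ d₃ F G E D : ℤ}
    (ef : a * f₁ + b * f₂ + 5 * f₃ = F) (eg : a * g₁ + b * g₂ + 5 * g₃ = G)
    (ee : a * e₁ + b * e₂ + 5 * e₃ = E) (ed : a * d₁ + b * d₂ + 5 * d₃ = D)
    (hf : (f₁ = 0 ∧ f₂ = 1 ∧ F = 1) ∨ (f₁ = 1 ∧ f₂ = 0 ∧ F = 1) ∨ (f₁ = 1 ∧ f₂ = 1 ∧ F = 0))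
    (hg : (g₁ = 0 ∧ g₂ = 1 ∧ G = -2) ∨ (g₁ = 1 ∧ g₂ = 0 ∧ G = -2) ∨ (g₁ = 1 ∧ g₂ = 1 ∧ G = -2))
    (he : (e₁ = 0 ∧ e₂ = -2 ∧ E = 1) ∨ (e₁ = 1 ∧ e₂ = -2 ∧ E = 0) ∨ (e₁ = 1 ∧ e₂ = -2 ∧ E = 1))
    (hd : (d₁ = -2 ∧ d₂ = 0 ∧ D = 1) ∨ (d₁ = -2 ∧ d₂ = 1 ∧ D = 0) ∨ (d₁ = -2 ∧ d₂ = 1 ∧ D = 1)) :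
    (a % 5 = 1 ∧ b % 5 = 2) ∨ (a % 5 = 1 ∧ b % 5 = 3) ∨ (a % 5 = 2 ∧ b % 5 = 1) ∨
      (a % 5 = 2 ∧ b % 5 = 3) ∨ (a % 5 = 3 ∧ b % 5 = 1) ∨ (a % 5 = 3 ∧ b % 5 = 2) := by
  have ha := Int.emod_lt_of_pos a (show (0 : ℤ) < 5 by norm_num)
  have hb := Int.emod_lt_of_pos b (show (0 : ℤ) < 5 by norm_num)
  rcases hf with ⟨rfl, rfl, rfl⟩ | ⟨rfl, rfl, rfl⟩ | ⟨rfl, rfl, rfl⟩ <;>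
  rcases hg with ⟨rfl, rfl, rfl⟩ | ⟨rfl, rfl, rfl⟩ | ⟨rfl, rfl, rfl⟩ <;>
  rcases he with ⟨rfl, rfl, rfl⟩ | ⟨rfl, rfl, rfl⟩ | ⟨rfl, rfl, rfl⟩ <;>
  rcases hd with ⟨rfl, rfl, rfl⟩ | ⟨rfl, rfl, rfl⟩ | ⟨rfl, rfl, rfl⟩ <;> omega

lemma eq_one_of_dvd_twelve {g : ℤ} (hg : 0 < g) (h2 : g % 2 ≠ 0) (h3 : g % 3 ≠ 0) (h : g ∣ 12) :
    g = 1 := by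
  have := Int.le_of_dvd (by norm_num) h
  interval_cases g <;> omega

lemma eq_one_or_five_of_dvd {g : ℤ} (hg : 0 < g) (h2 : g % 2 ≠ 0) (h3 : g % 3 ≠ 0) (h : g ∣ 60) :
    g = 1 ∨ g = 5 := by
  have := Int.le_of_dvd (by norm_num) h
  interval_cases g <;> omega

namespace Config

variable {p q : Fin 5 → Fin 3 → ℤ} {c : Fin 5 → ℤ}

/-- The index of the sublattice spanned by a configuration is coprime to `6`. -/
lemma index_coprime_six (h : Config q c) (hc : ∀ k, c k ≠ 0) {a b x y g m m' : ℤ} (q0 : q 0 = 0)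
    (q1 : q 1 = ![1, 0, 0]) (q2 : q 2 = ![0, 1, 0]) (q3 : q 3 = ![a, b, g * m])
    (q4 : q 4 = ![x, y, g * m']) : g % 2 ≠ 0 ∧ g % 3 ≠ 0 := by
  constructor
  -- For even g all five points have even third coordinate, hence lie in four classes modulo 2; two
  -- congruent ones would have a lattice midpoint.
  · intro hg
    have hm : (2 : ℤ) ∣ g * m := (Int.dvd_of_emod_eq_zero hg).mul_right _
    have hm' : (2 : ℤ) ∣ g * m' := (Int.dvd_of_emod_eq_zero hg).mul_right _
    have h03 := h.not_two_dvd hc (i := 0) (j := 3) (by decide)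
    have h13 := h.not_two_dvd hc (i := 1) (j := 3) (by decide)
    have h23 := h.not_two_dvd hc (i := 2) (j := 3) (by decide)
    have h04 := h.not_two_dvd hc (i := 0) (j := 4) (by decide)
    have h14 := h.not_two_dvd hc (i := 1) (j := 4) (by decide)
    have h24 := h.not_two_dvd hc (i := 2) (j := 4) (by decide)
    have h34 := h.not_two_dvd hc (i := 3) (j := 4) (by decide)
    simp [Fin.forall_fin_succ, q0, q1, q2, q3, q4] at h03 h13 h23 h04 h14 h24 h34
    omega
  -- For g divisible by 3 the points reduce to five distinct points of the affine plane over 𝔽₃ with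
  -- no three on a line, but such a set has at most four elements.
  · intro hg
    have hm : (3 : ℤ) ∣ g * m := (Int.dvd_of_emod_eq_zero hg).mul_right _
    have hm' : (3 : ℤ) ∣ g * m' := (Int.dvd_of_emod_eq_zero hg).mul_right _
    generalize g * m = u at *
    generalize g * m' = v at *
    have key : ∀ k : Fin 5, k ≠ 0 → k ≠ 1 → k ≠ 2 → (3 : ℤ) ∣ q k 2 →
        (q k 0 % 3 = 1 ∧ q k 1 % 3 = 1) ∨ (q k 0 % 3 = 1 ∧ q k 1 % 3 = 2) ∨
          (q k 0 % 3 = 2 ∧ q k 1 % 3 = 1) := by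
      intro k k0 k1 k2 hk
      have h1 := h.not_three_dvd hc (i := 0) (j := 0) (l := k) (by tauto)
      have h2 := h.not_three_dvd hc (i := 1) (j := 1) (l := k) (by tauto)
      have h3 := h.not_three_dvd hc (i := 2) (j := 2) (l := k) (by tauto)
      have h4 := h.not_three_dvd hc (i := 0) (j := 1) (l := k) (by simp)
      have h5 := h.not_three_dvd hc (i := 0) (j := 2) (l := k) (by simp)
      have h6 := h.not_three_dvd hc (i := 1) (j := 2) (l := k) (by simp)
      simp [Fin.forall_fin_succ, q0, q1, q2] at h1 h2 h3 h4 h5 h6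
      omega
    have k3 := key 3 (by decide) (by decide) (by decide) (by simpa [q3] using hm)
    have k4 := key 4 (by decide) (by decide) (by decide) (by simpa [q4] using hm')
    have h1 := h.not_three_dvd hc (i := 3) (j := 3) (l := 4) (by simp)
    have h2 := h.not_three_dvd hc (i := 0) (j := 3) (l := 4) (by simp)
    have h3 := h.not_three_dvd hc (i := 1) (j := 3) (l := 4) (by simp)
    have h4 := h.not_three_dvd hc (i := 2) (j := 3) (l := 4) (by simp)
    simp [Fin.forall_fin_succ, q0, q1, q2, q3, q4] at h1 h2 h3 h4
    simp [q3, q4] at k3 k4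
    omega

-- White's theorem is used on the four tetrahedra that `p 0` spans with three vertices. The
-- functionals serve twice: inserted in the dependence they show that each weight divides a sum of
-- two others, and their determinants bound the index g.
set_option maxHeartbeats 1600000 in
theorem classified_four_one (h : Config p c) (h0 : c 0 < 0) (h1 : 0 < c 1) (h12 : c 1 ≤ c 2)
    (h23 : c 2 ≤ c 3) (h34 : c 3 ≤ c 4) (hp : ∀ d : ℤ, (∀ k, d ∣ c k) → IsUnit d) :
    Classified p := by
  have h2 : 0 < c 2 := h1.trans_le h12
  have h3 : 0 < c 3 := h2.trans_le h23
  have h4 : 0 < c 4 := h3.trans_le h34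
  have hc : ∀ k, c k ≠ 0 := by
    intro k; fin_cases k
    exacts [h0.ne, h1.ne', h2.ne', h3.ne', h4.ne']
  refine h.classified_of_normal (h.emptyTriangle (.inr h4.ne') (.inl h4.ne')
    (.inl h3.ne')) h4.ne' ?_
  clear h
  intro q a b n h q0 q1 q2 q3 hn
  obtain ⟨x, y, z, q4⟩ : ∃ x y z, q 4 = ![x, y, z] := ⟨_, _, _, eq_vec _⟩
  have d2 := congrFun h.dep 2
  simp only [Fin.sum_univ_five, q0, q1, q2, q3, q4] at d2
  simp at d2
  obtain ⟨c12, c13, c23, c14, c24, c34⟩ := h.isCoprime hc hp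
  -- The heights of `q 3` and `q 4` are inversely proportional to the coprime weights `c 3`, `c 4`,
  -- so they are g `c 4` and -g `c 3`; with e₁ and e₂ the points generate a sublattice of index g.
  obtain ⟨g, rfl⟩ : c 4 ∣ n := c34.symm.dvd_of_dvd_mul_left ⟨-z, by linarith⟩
  rw [mul_comm] at q3 hn d2
  obtain rfl : z = g * -c 3 := mul_left_cancel₀ h4.ne' (by linarith)
  have hg0 : 0 < g := pos_of_mul_pos_left hn h4.le
  obtain ⟨g2, g3⟩ := h.index_coprime_six hc q0 q1 q2 q3 q4
  have hdep : ∀ f : (Fin 3 → ℤ) →ₗ[ℤ] ℤ,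
      c 1 * f (q 1) + c 2 * f (q 2) + c 3 * f (q 3) + c 4 * f (q 4) = 0 := by
    intro f
    have e1 := congrArg f h.dep
    simpa only [Fin.sum_univ_five, map_add, map_smul, map_zero, smul_eq_mul, q0, mul_zero,
      zero_add] using e1
  have hval : ∀ f : (Fin 3 → ℤ) →ₗ[ℤ] ℤ,
      a * f (q 1) + b * f (q 2) + g * c 4 * f ![0, 0, 1] = f (q 3) := by
    intro f
    rw [q3, q1, q2, functional_apply f a b]
  obtain ⟨f, hf⟩ := h.white h4.ne' (.inr (.inl (mul_pos h1 h4)))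
  obtain ⟨f', hf'⟩ := (h.reindex (s := ![0, 1, 2, 4, 3]) (by decide)).white h3.ne'
    (.inr (.inl (mul_pos h1 h3)))
  obtain ⟨e, he⟩ := (h.reindex (s := ![0, 1, 3, 4, 2]) (by decide)).white h2.ne'
    (.inr (.inl (mul_pos h1 h2)))
  obtain ⟨d, hd⟩ := (h.reindex (s := ![0, 2, 3, 4, 1]) (by decide)).white h1.ne'
    (.inr (.inl (mul_pos h2 h1)))
  change (f' (q 1 - q 0) = 0 ∧ f' (q 2 - q 0) = 1 ∧ f' (q 4 - q 0) = 1) ∨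
    (f' (q 1 - q 0) = 1 ∧ f' (q 2 - q 0) = 0 ∧ f' (q 4 - q 0) = 1) ∨
    (f' (q 1 - q 0) = 1 ∧ f' (q 2 - q 0) = 1 ∧ f' (q 4 - q 0) = 0) at hf'
  change (e (q 1 - q 0) = 0 ∧ e (q 3 - q 0) = 1 ∧ e (q 4 - q 0) = 1) ∨
    (e (q 1 - q 0) = 1 ∧ e (q 3 - q 0) = 0 ∧ e (q 4 - q 0) = 1) ∨
    (e (q 1 - q 0) = 1 ∧ e (q 3 - q 0) = 1 ∧ e (q 4 - q 0) = 0) at he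
  change (d (q 2 - q 0) = 0 ∧ d (q 3 - q 0) = 1 ∧ d (q 4 - q 0) = 1) ∨
    (d (q 2 - q 0) = 1 ∧ d (q 3 - q 0) = 0 ∧ d (q 4 - q 0) = 1) ∨
    (d (q 2 - q 0) = 1 ∧ d (q 3 - q 0) = 1 ∧ d (q 4 - q 0) = 0) at hd
  simp only [q0, sub_zero] at hf hf' he hd
  have vf := hval f
  have vg := hval f'
  have ve := hval e
  have vd := hval d
  have df := hdep f
  have dg := hdep f'
  have de := hdep e
  have dd := hdep d
  generalize f (q 1) = f₁, f (q 2) = f₂, f ![0, 0, 1] = f₃, f (q 3) = F, f (q 4) = F' at *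
  generalize f' (q 1) = g₁, f' (q 2) = g₂, f' ![0, 0, 1] = g₃, f' (q 3) = G, f' (q 4) = G' at *
  generalize e (q 1) = e₁, e (q 2) = e₂, e ![0, 0, 1] = e₃, e (q 3) = E, e (q 4) = E' at *
  generalize d (q 1) = d₁, d (q 2) = d₂, d ![0, 0, 1] = d₃, d (q 3) = D, d (q 4) = D' at *
  clear hval hdep f f' e d
  have dvd1 : c 1 ∣ c 2 + c 3 ∨ c 1 ∣ c 2 + c 4 ∨ c 1 ∣ c 3 + c 4 := by
    rcases hd with ⟨rfl, rfl, rfl⟩ | ⟨rfl, rfl, rfl⟩ | ⟨rfl, rfl, rfl⟩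
    · exact .inr (.inr ⟨-d₁, by linarith⟩)
    · exact .inr (.inl ⟨-d₁, by linarith⟩)
    · exact .inl ⟨-d₁, by linarith⟩
  have dvd2 : c 2 ∣ c 1 + c 3 ∨ c 2 ∣ c 1 + c 4 ∨ c 2 ∣ c 3 + c 4 := by
    rcases he with ⟨rfl, rfl, rfl⟩ | ⟨rfl, rfl, rfl⟩ | ⟨rfl, rfl, rfl⟩
    · exact .inr (.inr ⟨-e₂, by linarith⟩)
    · exact .inr (.inl ⟨-e₂, by linarith⟩)
    · exact .inl ⟨-e₂, by linarith⟩
  have dvd3 : c 3 ∣ c 1 + c 2 ∨ c 3 ∣ c 1 + c 4 ∨ c 3 ∣ c 2 + c 4 := by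
    rcases hf' with ⟨rfl, rfl, rfl⟩ | ⟨rfl, rfl, rfl⟩ | ⟨rfl, rfl, rfl⟩
    · exact .inr (.inr ⟨-G, by linarith⟩)
    · exact .inr (.inl ⟨-G, by linarith⟩)
    · exact .inl ⟨-G, by linarith⟩
  have dvd4 : c 4 ∣ c 1 + c 2 ∨ c 4 ∣ c 1 + c 3 ∨ c 4 ∣ c 2 + c 3 := by
    rcases hf with ⟨rfl, rfl, rfl⟩ | ⟨rfl, rfl, rfl⟩ | ⟨rfl, rfl, rfl⟩
    · exact .inr (.inr ⟨-F', by linarith⟩)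
    · exact .inr (.inl ⟨-F', by linarith⟩)
    · exact .inl ⟨-F', by linarith⟩
  rcases weights_classification h1 h12 h23 h34 c12 c13 c23 c14 c24 c34 dvd1 dvd2 dvd3 dvd4 with
    ⟨hc1, hc2, hc3, hc4⟩ | ⟨hc1, hc2, hc3, hc4⟩ | ⟨hc1, hc2, hc3, hc4⟩ | ⟨hc1, hc2, hc3, hc4⟩ |
    ⟨hc1, hc2, hc3, hc4⟩ | ⟨hc1, hc2, hc3, hc4⟩ | ⟨hc1, hc2, hc3, hc4⟩
  · rw [hc1, hc2, hc3, hc4] at df dg de dd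
    rw [hc4] at vf vg ve vd
    rcases eq_one_or_five_of_dvd hg0 g2 g3 (dvd_of_functionals_1111 vf vg ve vd (by clear * - hf df; omega) (by clear * - hf' dg; omega)
      (by clear * - he de; omega) (by clear * - hd dd; omega))
      with rfl | rfl
    · rw [one_mul] at q3 q4
      refine h.classified_of_primitive q0 q1 q2 q3 q4 (hc 4) c34 .s41_4 id id
        (by decide) (by decide) ?_ ?_
      · rw [hc1, hc2, hc3, hc4]; decide
      · rw [hc4]; decide
    · rw [mul_one] at vf vg ve vd
      have hres := residues_of_functionals_1111 vf vg ve vd (by clear * - hf df; omega)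
        (by clear * - hf' dg; omega) (by clear * - he de; omega) (by clear * - hd dd; omega)
      rw [hc4] at q3
      have key : ∀ (s t : Fin 5 → Fin 5) (r : Fin 3 → ℤ), (∀ k, s (t k) = k) → s 0 = 0 →
          TableEntry.s41_20.points (s 1) + TableEntry.s41_20.points (s 2) +
            TableEntry.s41_20.points (s 3) + TableEntry.s41_20.points (s 4) = 0 →
          (a % 5) • TableEntry.s41_20.points (s 1) + (b % 5) • TableEntry.s41_20.points (s 2) +
            (5 : ℤ) • r = TableEntry.s41_20.points (s 3) →
          (det3 (TableEntry.s41_20.points (s 1)) (TableEntry.s41_20.points (s 2))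
            (TableEntry.s41_20.points (s 3)) = 5 ∨
          det3 (TableEntry.s41_20.points (s 1)) (TableEntry.s41_20.points (s 2))
            (TableEntry.s41_20.points (s 3)) = -5) → Classified q := by
        intro s t r hst hs0 hsum hr hdet
        refine h.classified_of_dependence q0 q1 q2 q3 (by norm_num) h4.ne' .s41_20 s t hst
          (by rw [hs0]; decide) (by rw [hc1, hc2, hc3, hc4]; simpa only [one_smul] using hsum)
          (r - (a / 5) • TableEntry.s41_20.points (s 1) -
            (b / 5) • TableEntry.s41_20.points (s 2)) ?_ (by simpa using hdet)
        rw [← hr]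
        have ea := Int.emod_add_mul_ediv a 5
        have eb := Int.emod_add_mul_ediv b 5
        ext i
        simp only [Pi.add_apply, Pi.sub_apply, Pi.smul_apply, smul_eq_mul]
        linear_combination (-TableEntry.s41_20.points (s 1) i) * ea -
          TableEntry.s41_20.points (s 2) i * eb
      -- Each residue pair is matched with a permutation of the vertices of the table's index-5
      -- simplex; the third argument solves the congruence for the image of e₃.
      rcases hres with ⟨ha, hb⟩ | ⟨ha, hb⟩ | ⟨ha, hb⟩ | ⟨ha, hb⟩ | ⟨ha, hb⟩ | ⟨ha, hb⟩ <;>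
        rw [ha, hb] at key
      · exact key ![0, 1, 4, 2, 3] ![0, 1, 3, 4, 2] ![1, 2, 1] (by decide) rfl (by decide) (by decide) (by decide)
      · exact key ![0, 1, 3, 4, 2] ![0, 1, 4, 2, 3] ![-2, -4, -1] (by decide) rfl (by decide) (by decide) (by decide)
      · exact key ![0, 1, 2, 3, 4] ![0, 1, 2, 3, 4] ![0, 1, 0] (by decide) rfl (by decide) (by decide) (by decide)
      · exact key ![0, 1, 2, 4, 3] ![0, 1, 2, 4, 3] ![-1, -1, -1] (by decide) rfl (by decide) (by decide) (by decide)
      · exact key ![0, 1, 3, 2, 4] ![0, 1, 3, 2, 4] ![-1, -1, 0] (by decide) rfl (by decide) (by decide) (by decide)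
      · exact key ![0, 1, 4, 3, 2] ![0, 1, 4, 3, 2] ![1, 3, 1] (by decide) rfl (by decide) (by decide) (by decide)
  · rw [hc1, hc2, hc3, hc4] at df dg de dd
    rw [hc4] at vf vg ve vd
    obtain rfl := eq_one_of_dvd_twelve hg0 g2 g3 (dvd_of_functionals_1112 vf vg ve vd (by clear * - hf df; omega)
      (by clear * - hf' dg; omega) (by clear * - he de; omega) (by clear * - hd dd; omega))
    rw [one_mul] at q3 q4
    refine h.classified_of_primitive q0 q1 q2 q3 q4 (hc 4) c34 .s41_5 ![0, 1, 2, 3, 4] ![0, 1, 2, 3, 4]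
      (by decide) (by decide) ?_ ?_
    · rw [hc1, hc2, hc3, hc4]; decide
    · rw [hc4]; decide
  · rw [hc1, hc2, hc3, hc4] at df dg de dd
    rw [hc4] at vf vg ve vd
    obtain rfl := eq_one_of_dvd_twelve hg0 g2 g3 (dvd_of_functionals_1123 hg0 vf vg ve vd (by clear * - hf df; omega)
      (by clear * - hf' dg; omega) (by clear * - he de; omega) (by clear * - hd dd; omega))
    rw [one_mul] at q3 q4
    refine h.classified_of_primitive q0 q1 q2 q3 q4 (hc 4) c34 .s41_7 ![0, 1, 2, 3, 4] ![0, 1, 2, 3, 4]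
      (by decide) (by decide) ?_ ?_
    · rw [hc1, hc2, hc3, hc4]; decide
    · rw [hc4]; decide
  · rw [hc1, hc2, hc3, hc4] at df dg de dd
    rw [hc4] at vf vg ve vd
    obtain rfl := eq_one_of_dvd_twelve hg0 g2 g3 (dvd_of_functionals_1235 vf vg ve vd (by clear * - hf df; omega)
      (by clear * - hf' dg; omega) (by clear * - he de; omega) (by clear * - hd dd; omega))
    rw [one_mul] at q3 q4
    refine h.classified_of_primitive q0 q1 q2 q3 q4 (hc 4) c34 .s41_11 ![0, 1, 3, 2, 4] ![0, 1, 3, 2, 4]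
      (by decide) (by decide) ?_ ?_
    · rw [hc1, hc2, hc3, hc4]; decide
    · rw [hc4]; decide
  · rw [hc1, hc2, hc3, hc4] at df dg de dd
    rw [hc4] at vf vg ve vd
    obtain rfl := eq_one_of_dvd_twelve hg0 g2 g3 (dvd_of_functionals_1345 vf vg ve vd (by clear * - hf df; omega)
      (by clear * - hf' dg; omega) (by clear * - he de; omega) (by clear * - hd dd; omega))
    rw [one_mul] at q3 q4
    refine h.classified_of_primitive q0 q1 q2 q3 q4 (hc 4) c34 .s41_13 ![0, 3, 1, 2, 4] ![0, 2, 3, 1, 4]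
      (by decide) (by decide) ?_ ?_
    · rw [hc1, hc2, hc3, hc4]; decide
    · rw [hc4]; decide
  · rw [hc1, hc2, hc3, hc4] at df dg de dd
    rw [hc4] at vf vg ve vd
    obtain rfl := eq_one_of_dvd_twelve hg0 g2 g3 (dvd_of_functionals_2357 vf vg ve vd (by clear * - hf df; omega)
      (by clear * - hf' dg; omega) (by clear * - he de; omega) (by clear * - hd dd; omega))
    rw [one_mul] at q3 q4
    refine h.classified_of_primitive q0 q1 q2 q3 q4 (hc 4) c34 .s41_17 ![0, 3, 1, 2, 4] ![0, 2, 3, 1, 4]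
      (by decide) (by decide) ?_ ?_
    · rw [hc1, hc2, hc3, hc4]; decide
    · rw [hc4]; decide
  · rw [hc1, hc2, hc3, hc4] at df dg de dd
    rw [hc4] at vf vg ve vd
    obtain rfl := eq_one_of_dvd_twelve hg0 g2 g3 (dvd_of_functionals_3457 vf vg ve vd (by clear * - hf df; omega)
      (by clear * - hf' dg; omega) (by clear * - he de; omega) (by clear * - hd dd; omega))
    rw [one_mul] at q3 q4
    refine h.classified_of_primitive q0 q1 q2 q3 q4 (hc 4) c34 .s41_19 ![0, 3, 2, 1, 4] ![0, 3, 2, 1, 4]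
      (by decide) (by decide) ?_ ?_
    · rw [hc1, hc2, hc3, hc4]; decide
    · rw [hc4]; decide

end Config

/-! ### The affine dependence and the case distinction by signs -/

/-- The five columns `(1, pᵢ)` are linearly dependent. -/
lemma exists_affine_dependence (p : Fin 5 → Fin 3 → ℤ) :
    ∃ c : Fin 5 → ℤ, c ≠ 0 ∧ ∑ k, c k = 0 ∧ ∑ k, c k • p k = 0 := by
  have hnot : ¬ LinearIndependent ℤ fun k => (Fin.cons 1 (p k) : Fin 4 → ℤ) := by
    intro h
    have := h.fintype_card_le_finrank
    simp at this
  obtain ⟨c, hc, i, hi⟩ := Fintype.not_linearIndependent_iff.1 hnot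
  refine ⟨c, fun h => hi (congrFun h i), ?_, ?_⟩
  · have := congrFun hc 0
    simpa [Finset.sum_apply] using this
  · ext j
    have := congrFun hc j.succ
    simpa [Finset.sum_apply] using this

/-- Choose a nonzero affine functional vanishing at the three points other than `p k` and `p l`. Two
dependences not proportional at k, l give a nonsingular 2 × 2 system for its values there, so it
vanishes at all five points, against non-coplanarity. -/
lemma affine_dependence_unique {p : Fin 5 → Fin 3 → ℤ}
    (hp : ∀ f : (Fin 3 → ℤ) →ₗ[ℤ] ℤ, (∀ k, f (p k) = f (p 0)) → f = 0) {c d : Fin 5 → ℤ}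
    (hc0 : ∑ k, c k = 0) (hc : ∑ k, c k • p k = 0) (hd0 : ∑ k, d k = 0)
    (hd : ∑ k, d k • p k = 0) (k l : Fin 5) : d k * c l = d l * c k := by
  by_contra hne
  have hkl : k ≠ l := by rintro rfl; exact hne rfl
  have hcard : Fintype.card {i : Fin 5 // i ≠ k ∧ i ≠ l} = 3 := by
    clear * - hkl
    revert k l; decide
  have hnot : ¬ LinearIndependent ℤ fun (j : Fin 4) (i : {i : Fin 5 // i ≠ k ∧ i ≠ l}) =>
      (Fin.cons 1 (p i) : Fin 4 → ℤ) j := by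
    intro h
    have := h.fintype_card_le_finrank
    rw [Module.finrank_fintype_fun_eq_card, hcard] at this
    simp at this
  obtain ⟨g, hg, j, hj⟩ := Fintype.not_linearIndependent_iff.1 hnot
  set f : (Fin 3 → ℤ) →ₗ[ℤ] ℤ := ∑ t : Fin 3, g t.succ • LinearMap.proj t with hf
  have hfv : ∀ v, f v = ∑ t : Fin 3, g t.succ * v t := fun v => by simp [hf]
  have hz : ∀ i, i ≠ k → i ≠ l → g 0 + f (p i) = 0 := by
    intro i hik hil
    have := congrFun hg ⟨i, hik, hil⟩
    rw [hfv]
    simpa [Finset.sum_apply, Fin.sum_univ_succ] using this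
  have rel : ∀ e : Fin 5 → ℤ, ∑ k, e k = 0 → ∑ k, e k • p k = 0 →
      e k * (g 0 + f (p k)) + e l * (g 0 + f (p l)) = 0 := by
    intro e he0 he
    have h1 : ∑ i, e i * (g 0 + f (p i)) = 0 := by
      have := congrArg f he
      simp only [map_sum, map_smul, smul_eq_mul, map_zero] at this
      simp only [mul_add, Finset.sum_add_distrib, ← Finset.sum_mul, he0, this]
      simp
    rw [← Finset.sum_subset (Finset.subset_univ {k, l}), Finset.sum_pair hkl] at h1
    · exact h1
    · intro i _ hi
      simp only [Finset.mem_insert, Finset.mem_singleton, not_or] at hi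
      rw [hz i hi.1 hi.2, mul_zero]
  have r1 := rel c hc0 hc
  have r2 := rel d hd0 hd
  have hD : d k * c l - d l * c k ≠ 0 := sub_ne_zero.2 hne
  have zk : g 0 + f (p k) = 0 := (mul_eq_zero.1 (show (d k * c l - d l * c k) * (g 0 + f (p k)) = 0
    by linear_combination c l * r2 - d l * r1)).resolve_left hD
  have zl : g 0 + f (p l) = 0 := (mul_eq_zero.1 (show (d k * c l - d l * c k) * (g 0 + f (p l)) = 0
    by linear_combination d k * r1 - c k * r2)).resolve_left hD
  have hall : ∀ i, g 0 + f (p i) = 0 := by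
    intro i
    by_cases hik : i = k
    · rw [hik]; exact zk
    by_cases hil : i = l
    · rw [hil]; exact zl
    · exact hz i hik hil
  have hf0 := hp f fun i => by linarith [hall i, hall 0]
  have hg0 : g 0 = 0 := by have := hall 0; rw [hf0] at this; simpa using this
  apply hj
  refine Fin.cases hg0 (fun t => ?_) j
  have := hfv (Pi.single t 1)
  rw [hf0] at this
  simpa [Pi.single_apply] using this.symm

namespace Config

variable {p : Fin 5 → Fin 3 → ℤ} {c : Fin 5 → ℤ}

lemma classified_of_monotone (h : Config p c) (hm : Monotone c) (hc : c ≠ 0)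
    (hp : ∀ d : ℤ, (∀ k, d ∣ c k) → IsUnit d) : Classified p := by
  have m01 : c 0 ≤ c 1 := hm (by decide)
  have m12 : c 1 ≤ c 2 := hm (by decide)
  have m23 : c 2 ≤ c 3 := hm (by decide)
  have m34 : c 3 ≤ c 4 := hm (by decide)
  have hs := h.sum_eq
  rw [Fin.sum_univ_five] at hs
  have hne : ¬ (c 0 = 0 ∧ c 1 = 0 ∧ c 2 = 0 ∧ c 3 = 0 ∧ c 4 = 0) := by
    rintro ⟨h0, h1, h2, h3, h4⟩
    apply hc
    ext k; fin_cases k <;> assumption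
  have h0 : c 0 < 0 := by omega
  have h4 : 0 < c 4 := by omega
  rcases lt_trichotomy (c 1) 0 with h1 | h1 | h1
  · rcases lt_trichotomy (c 2) 0 with h2 | h2 | h2
    · rcases lt_trichotomy (c 3) 0 with h3 | h3 | h3
      · refine .of_reindex (s := ![4, 3, 2, 1, 0]) (by decide)
          ((h.neg.reindex (s := ![4, 3, 2, 1, 0]) (by decide)).classified_four_one ?_ ?_ ?_ ?_ ?_
            fun d hd => hp d fun k => ?_)
        · change -c 4 < 0; omega
        · change 0 < -c 3; omega
        · change -c 3 ≤ -c 2; omega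
        · change -c 2 ≤ -c 1; omega
        · change -c 1 ≤ -c 0; omega
        · fin_cases k
          exacts [dvd_neg.1 (hd 4), dvd_neg.1 (hd 3), dvd_neg.1 (hd 2), dvd_neg.1 (hd 1),
            dvd_neg.1 (hd 0)]
      · refine .of_reindex (s := ![4, 0, 1, 3, 2]) (by decide)
          ((h.neg.reindex (s := ![4, 0, 1, 3, 2]) (by decide)).classified_three_one ?_ ?_ ?_ ?_)
        · change 0 < -c 0; omega
        · change 0 < -c 1; omega
        · change -c 3 = 0; omega
        · change 0 < -c 2; omega
      · refine .of_reindex (s := ![4, 0, 1, 2, 3]) (by decide)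
          ((h.neg.reindex (s := ![4, 0, 1, 2, 3]) (by decide)).classified_three_two
            ?_ ?_ ?_ ?_ ?_ ?_)
        · change -c 4 < 0; omega
        · change 0 < -c 0; omega
        · change 0 < -c 1; omega
        · change 0 < -c 2; omega
        · change -c 3 < 0; omega
        · change -c 4 ≤ -c 3; omega
    · rcases eq_or_lt_of_le (h2 ▸ m23) with h3 | h3
      · refine .of_reindex (s := ![4, 0, 2, 3, 1]) (by decide)
          ((h.neg.reindex (s := ![4, 0, 2, 3, 1]) (by decide)).classified_two_one ?_ ?_ ?_ ?_ ?_)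
        · change -c 4 < 0; omega
        · change 0 < -c 0; omega
        · change -c 2 = 0; omega
        · change -c 3 = 0; omega
        · change 0 < -c 1; omega
      · exact .of_reindex (s := ![0, 3, 4, 2, 1]) (by decide)
          ((h.reindex (s := ![0, 3, 4, 2, 1]) (by decide)).classified_two_two h0 h3 h4 h2 h1)
    · exact .of_reindex (s := ![0, 2, 3, 4, 1]) (by decide)
        ((h.reindex (s := ![0, 2, 3, 4, 1]) (by decide)).classified_three_two h0 h2
          (h2.trans_le m23) h4 h1 m01)
  · rcases eq_or_lt_of_le (h1 ▸ m12) with h2 | h2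
    · rcases eq_or_lt_of_le (h2 ▸ m23) with h3 | h3
      -- Only the two extreme coefficients are nonzero and they are opposite, which would make `p 0`
      -- and `p 4` coincide.
      · exfalso
        have hd := h.dep
        rw [Fin.sum_univ_five, h1, ← h2, ← h3, show c 0 = -c 4 by omega] at hd
        have : c 4 • (p 4 - p 0) = 0 := by
          rw [← hd]; module
        have := (smul_eq_zero.1 this).resolve_left h4.ne'
        have := h.inj (sub_eq_zero.1 this)
        exact absurd this (by decide)
      · exact .of_reindex (s := ![0, 3, 1, 2, 4]) (by decide)
          ((h.reindex (s := ![0, 3, 1, 2, 4]) (by decide)).classified_two_one h0 h3 h1 h2.symm h4)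
    · exact .of_reindex (s := ![0, 2, 3, 1, 4]) (by decide)
        ((h.reindex (s := ![0, 2, 3, 1, 4]) (by decide)).classified_three_one h2
          (h2.trans_le m23) h1 h4)
  · exact h.classified_four_one h0 h1 m12 m23 m34 hp

end Config

/-- The classification, for labelled configurations of lattice points. -/
theorem classified_of_closed {p : Fin 5 → Fin 3 → ℤ} (inj : Function.Injective p)
    (closed : ∀ (v : Fin 3 → ℤ) (a : Fin 5 → ℤ), (∀ k, 0 ≤ a k) → 0 < ∑ k, a k →
      (∑ k, a k) • v = ∑ k, a k • p k → ∃ k, v = p k)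
    (hp : ∀ f : (Fin 3 → ℤ) →ₗ[ℤ] ℤ, (∀ k, f (p k) = f (p 0)) → f = 0) : Classified p := by
  obtain ⟨c, hc, hc0, hcp⟩ := exists_affine_dependence p
  have h : Config p c := ⟨inj, closed, hc0, hcp,
    fun d h1 h2 => affine_dependence_unique hp hc0 hcp h1 h2, hp⟩
  -- The dependence is made primitive, as signature (4,1) requires, and then sorted.
  obtain ⟨v, hv, hv1⟩ := Finset.extract_gcd c (Finset.univ_nonempty (α := Fin 5))
  have hD : Finset.univ.gcd c ≠ 0 := by
    intro h0
    apply hc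
    ext k
    exact Finset.gcd_eq_zero_iff.1 h0 k (Finset.mem_univ k)
  have hcv : c = Finset.univ.gcd c • v := by
    ext k
    exact hv k (Finset.mem_univ k)
  rw [hcv] at h
  have h' := h.of_smul hD
  have hv0 : v ≠ 0 := by
    rintro rfl
    exact hc (by rw [hcv, smul_zero])
  have hprim : ∀ d : ℤ, (∀ k, d ∣ v k) → IsUnit d := fun d hd =>
    isUnit_of_dvd_one (hv1 ▸ Finset.dvd_gcd fun k _ => hd k)
  set σ := Tuple.sort v
  have hσ : Function.Bijective σ := σ.bijective
  refine .of_reindex hσ ((h'.reindex hσ).classified_of_monotone (Tuple.monotone_sort v) ?_ ?_)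
  · intro h0
    apply hv0
    ext k
    have := congrFun h0 (σ.symm k)
    simpa using this
  · intro d hd
    refine hprim d fun k => ?_
    have := hd (σ.symm k)
    simpa using this

/-! ### From lattice configurations to real polytopes -/

lemma intPoint_add {d : ℕ} (v w : Fin d → ℤ) : intPoint (v + w) = intPoint v + intPoint w := by
  ext i; simp [intPoint]

lemma intPoint_smul {d : ℕ} (n : ℤ) (v : Fin d → ℤ) : intPoint (n • v) = (n : ℝ) • intPoint v := by
  ext i; simp [intPoint]

lemma intPoint_sum {d : ℕ} {ι : Type*} (s : Finset ι) (f : ι → Fin d → ℤ) :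
    intPoint (∑ i ∈ s, f i) = ∑ i ∈ s, intPoint (f i) := by
  ext j; simp [intPoint, Finset.sum_apply]

lemma intPoint_injective {d : ℕ} : Function.Injective (intPoint (d := d)) := by
  intro v w h
  ext i
  have := congrFun h i
  simpa [intPoint] using this

/-- The real linear automorphism that extends an automorphism of the lattice. -/
lemma exists_real_equiv (E : (Fin 3 → ℤ) ≃ₗ[ℤ] (Fin 3 → ℤ)) :
    ∃ L : (Fin 3 → ℝ) ≃ₗ[ℝ] (Fin 3 → ℝ), ∀ v, L (intPoint v) = intPoint (E v) := by
  set M := LinearMap.toMatrix' E.toLinearMap with hM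
  set N := LinearMap.toMatrix' E.symm.toLinearMap with hN
  have h1 : M * N = 1 := by
    rw [hM, hN, ← LinearMap.toMatrix'_comp]
    simp
  have h2 : N * M = 1 := by
    rw [hM, hN, ← LinearMap.toMatrix'_comp]
    simp
  have h1' : M.map (Int.castRingHom ℝ) * N.map (Int.castRingHom ℝ) = 1 := by
    rw [← Matrix.map_mul, h1]; simp
  have h2' : N.map (Int.castRingHom ℝ) * M.map (Int.castRingHom ℝ) = 1 := by
    rw [← Matrix.map_mul, h2]; simp
  refine ⟨Matrix.toLin'OfInv h2' h1', fun v => ?_⟩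
  change (M.map (Int.castRingHom ℝ)).mulVec (intPoint v) = _
  ext i
  have := RingHom.map_mulVec (Int.castRingHom ℝ) M v i
  rw [show intPoint v = (Int.castRingHom ℝ) ∘ v from rfl, ← this, hM, ← Matrix.toLin'_apply,
    Matrix.toLin'_toMatrix']
  rfl

lemma zEquivalent_of_intEquiv {p q : Fin 5 → Fin 3 → ℤ} (h : IntEquiv p q) :
    ZEquivalent (convexHull ℝ (Set.range fun k => intPoint (p k)))
      (convexHull ℝ (Set.range fun k => intPoint (q k))) := by
  obtain ⟨E, b, s, hs, h⟩ := h
  obtain ⟨L, hL⟩ := exists_real_equiv E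
  set t : (Fin 3 → ℝ) ≃ᵃ[ℝ] (Fin 3 → ℝ) :=
    L.toAffineEquiv.trans (AffineEquiv.constVAdd ℝ _ (intPoint b)) with ht
  have htv : ∀ v, t (intPoint v) = intPoint (E v + b) := by
    intro v
    simp [ht, hL, intPoint_add, add_comm]
  refine ⟨t, ?_, ?_⟩
  · ext x
    constructor
    · rintro ⟨_, ⟨v, rfl⟩, rfl⟩
      exact ⟨_, (htv v).symm⟩
    · rintro ⟨v, rfl⟩
      exact ⟨_, ⟨E.symm (v - b), rfl⟩, by rw [htv]; simp⟩
  · have := t.toAffineMap.image_convexHull (Set.range fun k => intPoint (p k))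
    rw [AffineEquiv.coe_toAffineMap] at this
    rw [this]
    congr 1
    ext x
    constructor
    · rintro ⟨_, ⟨k, rfl⟩, rfl⟩
      obtain ⟨j, rfl⟩ := hs.2 k
      exact ⟨j, by simp only [htv, h]⟩
    · rintro ⟨k, rfl⟩
      exact ⟨_, ⟨s k, rfl⟩, by simp only [htv, h]⟩

lemma eq_zero_of_isFullDimensional {P : Set (Fin 3 → ℝ)} (hP : IsFullDimensional P)
    (f : (Fin 3 → ℝ) →ₗ[ℝ] ℝ) (δ : ℝ) (hf : ∀ x ∈ P, f x = δ) : f = 0 := by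
  obtain ⟨y, hy, hyP⟩ := hP
  rw [affineIndependent_iff_linearIndependent_vsub ℝ y 0] at hy
  have hcard : Fintype.card {x : Fin 4 // x ≠ 0} = Module.finrank ℝ (Fin 3 → ℝ) := by
    simp
  have : Nonempty {x : Fin 4 // x ≠ 0} := ⟨⟨1, by decide⟩⟩
  have hspan := hy.span_eq_top_of_card_eq_finrank hcard
  refine LinearMap.ext_on hspan ?_
  rintro _ ⟨i, rfl⟩
  simp [hf _ (hyP _)]

/-- The generators of P are among its five lattice points, so P is their hull. Dividing integral
weights by their sum gives the closure property, and full dimension forces every lattice functional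
constant on the five points to vanish. -/
theorem exists_zEquivalent_polytope {P : Set (Fin 3 → ℝ)} (hP : IsLatticePolytope P)
    (hfull : IsFullDimensional P) (hsize : size P = 5) :
    ∃ e : TableEntry, ZEquivalent P e.polytope := by
  obtain ⟨S, hS⟩ := hP
  have hfin : (latticePoints P).Finite := Set.finite_of_ncard_ne_zero (by
    rw [size] at hsize; omega)
  have hcard : hfin.toFinset.card = 5 := by
    rw [← hsize, size, Set.ncard_eq_toFinset_card _ hfin]
  set φ := (hfin.toFinset.equivFinOfCardEq hcard).symm with hφ
  set p : Fin 5 → Fin 3 → ℤ := fun k => φ k with hp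
  have hinj : Function.Injective p := Subtype.val_injective.comp φ.injective
  have hrange : ∀ v, intPoint v ∈ P ↔ ∃ k, v = p k := by
    intro v
    constructor
    · intro hv
      have hv' : v ∈ hfin.toFinset := by rw [Set.Finite.mem_toFinset]; exact hv
      exact ⟨φ.symm ⟨v, hv'⟩, by simp [hp]⟩
    · rintro ⟨k, rfl⟩
      have := (φ k).2
      rw [Set.Finite.mem_toFinset] at this
      exact this
  have hconv : Convex ℝ P := hS ▸ convex_convexHull ℝ _
  have hPp : P = convexHull ℝ (Set.range fun k => intPoint (p k)) := by
    apply Set.Subset.antisymm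
    · rw [hS]
      refine convexHull_mono ?_
      rintro _ ⟨v, hv, rfl⟩
      obtain ⟨k, rfl⟩ := (hrange v).1 (hS ▸ subset_convexHull ℝ _ ⟨v, hv, rfl⟩)
      exact ⟨k, rfl⟩
    · refine convexHull_min ?_ hconv
      rintro _ ⟨k, rfl⟩
      exact (hrange _).2 ⟨k, rfl⟩
  have hclass : Classified p := by
    refine classified_of_closed hinj (fun v a ha hN hv => (hrange v).1 ?_) fun f hf => ?_
    · have hNR : (0 : ℝ) < ((∑ k, a k : ℤ) : ℝ) := by exact_mod_cast hN
      have hv' : intPoint v = ∑ k, ((a k : ℝ) / ((∑ k, a k : ℤ) : ℝ)) • intPoint (p k) := by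
        have := congrArg intPoint hv
        rw [intPoint_smul, intPoint_sum] at this
        simp only [intPoint_smul] at this
        simp only [div_eq_inv_mul, mul_smul, ← Finset.smul_sum]
        rw [← this, inv_smul_smul₀ hNR.ne']
      rw [hv']
      refine hconv.sum_mem (fun k _ => div_nonneg (by exact_mod_cast ha k) hNR.le) ?_
        fun k _ => (hrange _).2 ⟨k, rfl⟩
      rw [← Finset.sum_div, Int.cast_sum, div_self]
      rw [← Int.cast_sum]; exact hNR.ne'
    · set F : (Fin 3 → ℝ) →ₗ[ℝ] ℝ := ∑ i, (f (Pi.single i 1) : ℝ) • LinearMap.proj i with hF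
      have hFv : ∀ v, F (intPoint v) = f v := by
        intro v
        have : v = ∑ i, v i • (Pi.single i 1 : Fin 3 → ℤ) := by
          ext j; simp [Finset.sum_apply, Pi.single_apply]
        conv_rhs => rw [this]
        simp only [map_sum, map_smul, smul_eq_mul, Int.cast_sum, Int.cast_mul]
        simp [hF, intPoint, mul_comm]
      have hF0 : F = 0 := by
        refine eq_zero_of_isFullDimensional hfull F (f (p 0)) fun x hx => ?_
        rw [hPp] at hx
        have hsub : convexHull ℝ (Set.range fun k => intPoint (p k)) ⊆ {x | F x = f (p 0)} := by
          refine convexHull_min ?_ (convex_hyperplane F.isLinear _)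
          rintro _ ⟨k, rfl⟩
          simp only [Set.mem_ofPred_eq, hFv, hf k]
        exact hsub hx
      ext i
      have := hFv (Pi.single i 1)
      rw [hF0] at this
      simpa using this.symm
  obtain ⟨e, he⟩ := hclass
  refine ⟨e, ?_⟩
  rw [hPp]
  exact zEquivalent_of_intEquiv he

/-! ### Integer criteria for lattice points, dimension, signature, volumes and width -/

lemma exists_weights {q : Fin 5 → Fin 3 → ℤ} {x : Fin 3 → ℝ}
    (hx : x ∈ convexHull ℝ (Set.range fun k => intPoint (q k))) :
    ∃ w : Fin 5 → ℝ, (∀ k, 0 ≤ w k) ∧ ∑ k, w k = 1 ∧ ∀ i, ∑ k, w k * q k i = x i := by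
  have hsub : convexHull ℝ (Set.range fun k => intPoint (q k)) ⊆
      Fintype.linearCombination ℝ (fun k => intPoint (q k)) '' stdSimplex ℝ (Fin 5) := by
    refine convexHull_min ?_ ((convex_stdSimplex ℝ (Fin 5)).linear_image _)
    rintro _ ⟨k, rfl⟩
    exact ⟨Pi.single k 1, single_mem_stdSimplex ℝ k, by simp [Fintype.linearCombination_apply]⟩
  obtain ⟨w, ⟨hw0, hw1⟩, rfl⟩ := hsub hx
  refine ⟨w, hw0, hw1, fun i => ?_⟩
  simp [Fintype.linearCombination_apply, Finset.sum_apply, intPoint]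

/-- Affine inequalities pass from the points to the lattice points of their convex hull. -/
lemma affine_nonneg_of_mem {q : Fin 5 → Fin 3 → ℤ} {x y z : ℤ}
    (hv : intPoint ![x, y, z] ∈ convexHull ℝ (Set.range fun k => intPoint (q k))) (a b c d : ℤ)
    (h : ∀ k, 0 ≤ a * q k 0 + b * q k 1 + c * q k 2 + d) : 0 ≤ a * x + b * y + c * z + d := by
  obtain ⟨w, hw0, hw1, hw⟩ := exists_weights hv
  have h0 := hw 0
  have h1 := hw 1
  have h2 := hw 2
  simp only [intPoint, Matrix.cons_val] at h0 h1 h2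
  have key : (0 : ℝ) ≤ ∑ k, w k * ((a * q k 0 + b * q k 1 + c * q k 2 + d : ℤ) : ℝ) :=
    Finset.sum_nonneg fun k _ => mul_nonneg (hw0 k) (by exact_mod_cast h k)
  have e : ∑ k, w k * ((a * q k 0 + b * q k 1 + c * q k 2 + d : ℤ) : ℝ) =
      a * x + b * y + c * z + d := by
    rw [← h0, ← h1, ← h2]
    calc _ = ∑ k, (a * (w k * q k 0) + b * (w k * q k 1) + c * (w k * q k 2) + d * w k) := by
          refine Finset.sum_congr rfl fun k _ => ?_
          push_cast
          ring
      _ = _ := by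
          simp only [Finset.sum_add_distrib, ← Finset.mul_sum, hw1, mul_one]
  rw [e] at key
  exact_mod_cast key

lemma latticePoints_eq_range {q : Fin 5 → Fin 3 → ℤ}
    (h : ∀ x y z : ℤ, intPoint ![x, y, z] ∈ convexHull ℝ (Set.range fun k => intPoint (q k)) →
      ∃ k, ![x, y, z] = q k) :
    latticePoints (convexHull ℝ (Set.range fun k => intPoint (q k))) = Set.range q := by
  ext v
  constructor
  · intro hv
    rw [eq_vec v] at hv ⊢
    obtain ⟨k, hk⟩ := h _ _ _ hv
    exact ⟨k, hk.symm⟩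
  · rintro ⟨k, rfl⟩
    exact subset_convexHull ℝ _ ⟨k, rfl⟩

lemma size_eq_five {P : Set (Fin 3 → ℝ)} {q : Fin 5 → Fin 3 → ℤ} (hq : Function.Injective q)
    (h : latticePoints P = Set.range q) : size P = 5 := by
  rw [size, h, ← Set.image_univ, Set.ncard_image_of_injective _ hq]
  simp

lemma isLatticePolytope_convexHull (q : Fin 5 → Fin 3 → ℤ) :
    IsLatticePolytope (convexHull ℝ (Set.range fun k => intPoint (q k))) :=
  ⟨Finset.univ.image q, by
    congr 1
    ext x
    simp⟩

lemma isFullDimensional_convexHull {q : Fin 5 → Fin 3 → ℤ} (i j k l : Fin 5)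
    (h : det3 (q j - q i) (q k - q i) (q l - q i) ≠ 0) :
    IsFullDimensional (convexHull ℝ (Set.range fun k => intPoint (q k))) := by
  refine ⟨![intPoint (q i), intPoint (q j), intPoint (q k), intPoint (q l)], ?_, fun t => ?_⟩
  · rw [affineIndependent_iff_of_fintype]
    intro (w : Fin 4 → ℝ) (hw0 : ∑ t : Fin 4, w t = 0) hw
    rw [Finset.weightedVSub_eq_linear_combination (s := Finset.univ) hw0] at hw
    change ∑ t : Fin 4, w t • ![intPoint (q i), intPoint (q j), intPoint (q k), intPoint (q l)] t =
      0 at hw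
    rw [Fin.sum_univ_four] at hw
    have h0 := congrFun hw 0
    have h1 := congrFun hw 1
    have h2 := congrFun hw 2
    simp only [Fin.sum_univ_four, Matrix.cons_val, Pi.add_apply, Pi.smul_apply, smul_eq_mul,
      Pi.zero_apply, intPoint] at hw0 h0 h1 h2
    have hD : ((det3 (q j - q i) (q k - q i) (q l - q i) : ℤ) : ℝ) ≠ 0 := by exact_mod_cast h
    simp only [det3, Pi.sub_apply] at hD
    push_cast at hD
    generalize (q i 0 : ℝ) = i0, (q i 1 : ℝ) = i1, (q i 2 : ℝ) = i2 at *
    generalize (q j 0 : ℝ) = j0, (q j 1 : ℝ) = j1, (q j 2 : ℝ) = j2 at *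
    generalize (q k 0 : ℝ) = k0, (q k 1 : ℝ) = k1, (q k 2 : ℝ) = k2 at *
    generalize (q l 0 : ℝ) = l0, (q l 1 : ℝ) = l1, (q l 2 : ℝ) = l2 at *
    have e0 : w 1 * (j0 - i0) + w 2 * (k0 - i0) + w 3 * (l0 - i0) = 0 := by
      linear_combination h0 - i0 * hw0
    have e1 : w 1 * (j1 - i1) + w 2 * (k1 - i1) + w 3 * (l1 - i1) = 0 := by
      linear_combination h1 - i1 * hw0
    have e2 : w 1 * (j2 - i2) + w 2 * (k2 - i2) + w 3 * (l2 - i2) = 0 := by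
      linear_combination h2 - i2 * hw0
    generalize j0 - i0 = a0, j1 - i1 = a1, j2 - i2 = a2, k0 - i0 = b0, k1 - i1 = b1,
      k2 - i2 = b2, l0 - i0 = c0, l1 - i1 = c1, l2 - i2 = c2 at *
    have w1 : w 1 = 0 := (mul_eq_zero.1 (by
      linear_combination (b1 * c2 - b2 * c1) * e0 - (b0 * c2 - b2 * c0) * e1 +
        (b0 * c1 - b1 * c0) * e2)).resolve_left hD
    have w2 : w 2 = 0 := (mul_eq_zero.1 (by
      linear_combination -(a1 * c2 - a2 * c1) * e0 + (a0 * c2 - a2 * c0) * e1 -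
        (a0 * c1 - a1 * c0) * e2)).resolve_left hD
    have w3 : w 3 = 0 := (mul_eq_zero.1 (by
      linear_combination (a1 * b2 - a2 * b1) * e0 - (a0 * b2 - a2 * b0) * e1 +
        (a0 * b1 - a1 * b0) * e2)).resolve_left hD
    have w0 : w 0 = 0 := by linarith
    intro t
    fin_cases t <;> assumption
  · fin_cases t <;> exact subset_convexHull ℝ _ ⟨_, rfl⟩

lemma hasSignature_of_dependence {P : Set (Fin 3 → ℝ)} {q : Fin 5 → Fin 3 → ℤ} {c : Fin 5 → ℤ}
    {m n : ℕ} (hq : Function.Injective q) (h : latticePoints P = Set.range q) (hc : c 0 ≠ 0)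
    (hc0 : ∑ k, c k = 0) (hcq : ∑ k, c k • q k = 0)
    (hm : (Finset.univ.filter fun k => 0 < c k).card = m)
    (hn : (Finset.univ.filter fun k => c k < 0).card = n) : HasSignature P (m, n) := by
  refine ⟨q, fun k => c k, hq, h.symm, fun h0 => hc ?_, ?_, by
    show ∑ k, (c k : ℝ) = 0
    exact_mod_cast hc0, ?_, ?_⟩
  · simpa using congrFun h0 0
  · have := congrArg intPoint hcq
    simp only [intPoint_sum, intPoint_smul] at this
    rw [this]
    ext i; simp [intPoint]
  · rw [← hm, ← Set.ncard_coe_finset]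
    congr 1
    ext k
    simp
  · rw [← hn, ← Set.ncard_coe_finset]
    congr 1
    ext k
    simp

lemma det_cons_one (r : Fin 4 → Fin 3 → ℤ) :
    (Matrix.of fun (i j : Fin 4) => Fin.cons (α := fun _ => ℤ) 1 (r j) i).det =
      det3 (r 1 - r 0) (r 2 - r 0) (r 3 - r 0) := by
  have e : (Matrix.of fun (i j : Fin 4) => Fin.cons (α := fun _ => ℤ) 1 (r j) i) =
      !![1, 1, 1, 1; r 0 0, r 1 0, r 2 0, r 3 0; r 0 1, r 1 1, r 2 1, r 3 1;
        r 0 2, r 1 2, r 2 2, r 3 2] := by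
    ext i j
    fin_cases i <;> fin_cases j <;> rfl
  rw [e]
  simp [Matrix.det_succ_row_zero, Fin.sum_univ_succ, Fin.succAbove, det3]
  ring

lemma volumeVector_apply (q : Fin 5 → Fin 3 → ℤ) (k : Fin 5) :
    volumeVector q k = (-1) ^ (k : ℕ) * det3 (q (k.succAbove 1) - q (k.succAbove 0))
      (q (k.succAbove 2) - q (k.succAbove 0)) (q (k.succAbove 3) - q (k.succAbove 0)) := by
  rw [volumeVector, det_cons_one fun j => q (k.succAbove j)]

section Width

variable {q : Fin 5 → Fin 3 → ℤ}

lemma image_convexHull_subset_Icc (f : (Fin 3 → ℝ) →ᵃ[ℝ] ℝ) {m M : ℝ}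
    (h : ∀ k, f (intPoint (q k)) ∈ Set.Icc m M) :
    f '' convexHull ℝ (Set.range fun k => intPoint (q k)) ⊆ Set.Icc m M := by
  rw [AffineMap.image_convexHull]
  refine convexHull_min ?_ (convex_Icc m M)
  rintro _ ⟨_, ⟨k, rfl⟩, rfl⟩
  exact h k

lemma apply_mem_image (f : (Fin 3 → ℝ) →ᵃ[ℝ] ℝ) (k : Fin 5) :
    f (intPoint (q k)) ∈ f '' convexHull ℝ (Set.range fun k => intPoint (q k)) :=
  ⟨_, subset_convexHull ℝ _ ⟨k, rfl⟩, rfl⟩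

lemma sub_le_widthAlong (f : (Fin 3 → ℝ) →ᵃ[ℝ] ℝ) (i j : Fin 5) :
    f (intPoint (q i)) - f (intPoint (q j)) ≤
      widthAlong f (convexHull ℝ (Set.range fun k => intPoint (q k))) := by
  obtain ⟨M, hM⟩ := (Set.finite_range fun k => f (intPoint (q k))).bddAbove
  obtain ⟨m, hm⟩ := (Set.finite_range fun k => f (intPoint (q k))).bddBelow
  have hsub := image_convexHull_subset_Icc (q := q) f (m := m) (M := M)
    fun k => ⟨hm ⟨k, rfl⟩, hM ⟨k, rfl⟩⟩
  exact sub_le_sub (le_csSup (bddAbove_Icc.mono hsub) (apply_mem_image f i))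
    (csInf_le (bddBelow_Icc.mono hsub) (apply_mem_image f j))

lemma widthAlong_le (f : (Fin 3 → ℝ) →ᵃ[ℝ] ℝ) {m M : ℝ}
    (h : ∀ k, f (intPoint (q k)) ∈ Set.Icc m M) :
    widthAlong f (convexHull ℝ (Set.range fun k => intPoint (q k))) ≤ M - m := by
  have hsub := image_convexHull_subset_Icc f h
  have hne : (f '' convexHull ℝ (Set.range fun k => intPoint (q k))).Nonempty :=
    ⟨_, apply_mem_image f 0⟩
  exact sub_le_sub (csSup_le hne fun x hx => (hsub hx).2) (le_csInf hne fun x hx => (hsub hx).1)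

lemma affineMap_eq (f : (Fin 3 → ℝ) →ᵃ[ℝ] ℝ) (x : Fin 3 → ℝ) :
    f x = ∑ i, x i * (f (Pi.single i 1) - f 0) + f 0 := by
  have h := f.decomp
  have hx : f.linear x = ∑ i, x i * f.linear (Pi.single i 1) := by
    conv_lhs => rw [show x = ∑ i, x i • (Pi.single i 1 : Fin 3 → ℝ) by
      ext j; simp [Finset.sum_apply, Pi.single_apply]]
    simp
  have hl : ∀ y, f.linear y = f y - f 0 := fun y => by
    have := congrFun h y
    simp only [Pi.add_apply] at this
    linarith
  rw [← sub_eq_iff_eq_add, ← hl, hx]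
  simp only [hl]

/-- A criterion for the width in terms of integers only. -/
lemma hasWidth_convexHull (w : ℕ)
    (hlow : ∀ a b c : ℤ, (∀ i j, a * (q i 0 - q j 0) + b * (q i 1 - q j 1) + c * (q i 2 - q j 2) <
      w) → a = 0 ∧ b = 0 ∧ c = 0) (a b c m : ℤ) (habc : a ≠ 0 ∨ b ≠ 0 ∨ c ≠ 0)
    (h : ∀ k, m ≤ a * q k 0 + b * q k 1 + c * q k 2 ∧ a * q k 0 + b * q k 1 + c * q k 2 ≤ m + w) :
    HasWidth (convexHull ℝ (Set.range fun k => intPoint (q k))) (w : ℝ) := by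
  have low : ∀ f : (Fin 3 → ℝ) →ᵃ[ℝ] ℝ, (∀ v : Fin 3 → ℤ, ∃ m : ℤ, f (intPoint v) = (m : ℝ)) →
      (∃ x y, f x ≠ f y) →
      (w : ℝ) ≤ widthAlong f (convexHull ℝ (Set.range fun k => intPoint (q k))) := by
    intro f hf hxy
    -- Integrality on the lattice makes the linear coefficients integers, so the lower bound reduces
    -- to `hlow`.
    have hcoef : ∀ i, ∃ r : ℤ, f (Pi.single i 1) - f 0 = r := by
      intro i
      obtain ⟨r, hr⟩ := hf (Pi.single i 1)
      obtain ⟨s, hs⟩ := hf 0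
      refine ⟨r - s, ?_⟩
      rw [show (Pi.single i 1 : Fin 3 → ℝ) = intPoint (Pi.single i 1) by
        ext j; by_cases hj : j = i <;> simp [intPoint, hj], hr,
        show (0 : Fin 3 → ℝ) = intPoint 0 by ext j; simp [intPoint], hs]
      push_cast
      ring
    choose r hr using hcoef
    by_contra hlt
    push Not at hlt
    have hz := hlow (r 0) (r 1) (r 2) fun i j => by
      have h1 := (sub_le_widthAlong f i j).trans_lt hlt
      rw [affineMap_eq f (intPoint (q i)), affineMap_eq f (intPoint (q j))] at h1
      simp only [Fin.sum_univ_three, hr, intPoint] at h1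
      have h2 : ((r 0 * (q i 0 - q j 0) + r 1 * (q i 1 - q j 1) + r 2 * (q i 2 - q j 2) : ℤ) : ℝ) <
          ((w : ℤ) : ℝ) := by
        push_cast
        linarith
      exact_mod_cast h2
    obtain ⟨x, y, hxy⟩ := hxy
    apply hxy
    rw [affineMap_eq f x, affineMap_eq f y]
    simp only [Fin.sum_univ_three, hr, hz.1, hz.2.1, hz.2.2]
    simp
  refine ⟨?_, ?_⟩
  · set F : (Fin 3 → ℝ) →ᵃ[ℝ] ℝ := ((a : ℝ) • LinearMap.proj 0 + (b : ℝ) • LinearMap.proj 1 +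
      (c : ℝ) • LinearMap.proj 2 : (Fin 3 → ℝ) →ₗ[ℝ] ℝ).toAffineMap with hF
    have hFv : ∀ x : Fin 3 → ℝ, F x = a * x 0 + b * x 1 + c * x 2 := fun x => by simp [hF]
    have hint : ∀ v : Fin 3 → ℤ, ∃ m : ℤ, F (intPoint v) = (m : ℝ) := fun v =>
      ⟨a * v 0 + b * v 1 + c * v 2, by rw [hFv]; push_cast; rfl⟩
    have hne : ∃ x y, F x ≠ F y := by
      rcases habc with h0 | h0 | h0
      · exact ⟨![1, 0, 0], 0, by rw [hFv, hFv]; simpa using h0⟩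
      · exact ⟨![0, 1, 0], 0, by rw [hFv, hFv]; simpa using h0⟩
      · exact ⟨![0, 0, 1], 0, by rw [hFv, hFv]; simpa using h0⟩
    refine ⟨F, hint, hne, le_antisymm (low F hint hne) ?_⟩
    have := widthAlong_le (q := q) F (m := m) (M := m + w) fun k => by
      rw [hFv]
      obtain ⟨h1, h2⟩ := h k
      constructor
      · simp only [intPoint]; exact_mod_cast h1
      · simp only [intPoint]; exact_mod_cast h2
    linarith
  · rintro _ ⟨f, hf, hxy, rfl⟩
    exact low f hf hxy

end Width

/-- Lattice points of a convex hull, from a list of valid inequalities and a bounding box. -/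
lemma latticePoints_eq_range_of_facets {q : Fin 5 → Fin 3 → ℤ} (F : List (ℤ × ℤ × ℤ × ℤ))
    (l u : Fin 3 → ℤ) (hbox : ∀ k i, l i ≤ q k i ∧ q k i ≤ u i)
    (hF : ∀ f ∈ F, ∀ k, 0 ≤ f.1 * q k 0 + f.2.1 * q k 1 + f.2.2.1 * q k 2 + f.2.2.2)
    (h : ∀ x ∈ Finset.Icc (l 0) (u 0), ∀ y ∈ Finset.Icc (l 1) (u 1),
      ∀ z ∈ Finset.Icc (l 2) (u 2),
        (∀ f ∈ F, 0 ≤ f.1 * x + f.2.1 * y + f.2.2.1 * z + f.2.2.2) → ∃ k, ![x, y, z] = q k) :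
    latticePoints (convexHull ℝ (Set.range fun k => intPoint (q k))) = Set.range q := by
  refine latticePoints_eq_range fun x y z hv => ?_
  have b (a b c d) := affine_nonneg_of_mem hv a b c d
  refine h x (Finset.mem_Icc.2 ⟨?_, ?_⟩) y (Finset.mem_Icc.2 ⟨?_, ?_⟩) z
    (Finset.mem_Icc.2 ⟨?_, ?_⟩) fun f hf => b _ _ _ _ (hF f hf)
  · linarith [b 1 0 0 (-l 0) fun k => by linarith [(hbox k 0).1]]
  · linarith [b (-1) 0 0 (u 0) fun k => by linarith [(hbox k 0).2]]
  · linarith [b 0 1 0 (-l 1) fun k => by linarith [(hbox k 1).1]]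
  · linarith [b 0 (-1) 0 (u 1) fun k => by linarith [(hbox k 1).2]]
  · linarith [b 0 0 1 (-l 2) fun k => by linarith [(hbox k 2).1]]
  · linarith [b 0 0 (-1) (u 2) fun k => by linarith [(hbox k 2).2]]

/-! ### Verification of the rows -/

namespace TableEntry

/-- The row of `e` in the table is correct. -/
def RowValid (e : TableEntry) : Prop :=
  IsLatticePolytope e.polytope ∧ IsFullDimensional e.polytope ∧
    latticePoints e.polytope = Set.range e.points ∧ size e.polytope = 5 ∧
    HasSignature e.polytope e.tableSignature ∧
    (e.tableVolumeVector = volumeVector e.points ∨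
      e.tableVolumeVector = -volumeVector e.points) ∧
    HasWidth e.polytope (e.tableWidth : ℝ)

/-- The volume column is itself an affine dependence of the points, so its signs also certify the
signature. The number `s` is the global sign relating the column to the determinants. -/
lemma rowValid_of {e : TableEntry} (hinj : Function.Injective e.points)
    (hlat : latticePoints e.polytope = Set.range e.points) (i j k l : Fin 5)
    (hdet : det3 (e.points j - e.points i) (e.points k - e.points i)
      (e.points l - e.points i) ≠ 0)
    (hc : e.tableVolumeVector 0 ≠ 0) (hc0 : ∑ k, e.tableVolumeVector k = 0)
    (hcq : ∑ k, e.tableVolumeVector k • e.points k = 0)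
    (hm : (Finset.univ.filter fun k => 0 < e.tableVolumeVector k).card = e.tableSignature.1)
    (hn : (Finset.univ.filter fun k => e.tableVolumeVector k < 0).card = e.tableSignature.2)
    (s : ℤ) (hs : s = 1 ∨ s = -1)
    (hvol : ∀ k : Fin 5, e.tableVolumeVector k = s * ((-1) ^ (k : ℕ) *
      det3 (e.points (k.succAbove 1) - e.points (k.succAbove 0))
        (e.points (k.succAbove 2) - e.points (k.succAbove 0))
        (e.points (k.succAbove 3) - e.points (k.succAbove 0))))
    (hlow : ∀ a b c : ℤ, (∀ i j, a * (e.points i 0 - e.points j 0) +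
      b * (e.points i 1 - e.points j 1) + c * (e.points i 2 - e.points j 2) < e.tableWidth) →
        a = 0 ∧ b = 0 ∧ c = 0)
    (a b c m : ℤ) (habc : a ≠ 0 ∨ b ≠ 0 ∨ c ≠ 0)
    (hatt : ∀ k, m ≤ a * e.points k 0 + b * e.points k 1 + c * e.points k 2 ∧
      a * e.points k 0 + b * e.points k 1 + c * e.points k 2 ≤ m + e.tableWidth) :
    e.RowValid := by
  refine ⟨isLatticePolytope_convexHull _, isFullDimensional_convexHull i j k l hdet, hlat,
    size_eq_five hinj hlat, hasSignature_of_dependence hinj hlat hc hc0 hcq hm hn, ?_,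
    hasWidth_convexHull _ hlow a b c m habc hatt⟩
  rcases hs with rfl | rfl
  · exact .inl (funext fun k => by rw [hvol, volumeVector_apply, one_mul])
  · exact .inr (funext fun k => by rw [hvol, Pi.neg_apply, volumeVector_apply, neg_one_mul])

/-- In this and the other sporadic rows the data are facet inequalities αx + βy + γz + δ ≥ 0, the
corners of a bounding box, the indices of four affinely independent points, the sign of the volume
vector, and a functional attaining the width with its minimum. -/
lemma rowValid_s22 : s22.RowValid :=
  rowValid_of (by decide)
    (latticePoints_eq_range_of_facets
      [(-1, 0, -1, 1), (0, -1, -1, 1), (0, 0, 1, 0), (0, 1, 0, 0), (1, 0, 0, 0)]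
      ![0, 0, 0] ![1, 1, 1] (by decide) (by decide) (by decide +kernel))
    0 1 2 4 (by decide) (by decide) (by decide) (by decide) (by decide) (by decide) 1 (by decide)
    (by decide)
    (fun a b c h => by
      simp [Fin.forall_fin_succ, points, tableWidth] at h
      omega)
    0 0 1 0 (by decide) (by decide)

lemma rowValid_s31_3 : s31_3.RowValid :=
  rowValid_of (by decide)
    (latticePoints_eq_range_of_facets
      [(-1, -1, -1, 1), (-1, 2, -1, 1), (0, 0, 1, 0), (2, -1, -1, 1)]
      ![-1, -1, 0] ![1, 1, 1] (by decide) (by decide) (by decide +kernel))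
    0 1 2 4 (by decide) (by decide) (by decide) (by decide) (by decide) (by decide) (-1) (by decide)
    (by decide)
    (fun a b c h => by
      simp [Fin.forall_fin_succ, points, tableWidth] at h
      omega)
    0 0 1 0 (by decide) (by decide)

lemma rowValid_s31_9 : s31_9.RowValid :=
  rowValid_of (by decide)
    (latticePoints_eq_range_of_facets
      [(-3, -3, 2, 3), (-3, 6, -4, 3), (0, 0, 1, 0), (6, -3, -1, 3)]
      ![-1, -1, 0] ![1, 2, 3] (by decide) (by decide) (by decide +kernel))
    0 1 2 4 (by decide) (by decide) (by decide) (by decide) (by decide) (by decide) (-1) (by decide)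
    (by decide)
    (fun a b c h => by
      simp [Fin.forall_fin_succ, points, tableWidth] at h
      omega)
    1 0 0 (-1) (by decide) (by decide)

lemma rowValid_s41_4 : s41_4.RowValid :=
  rowValid_of (by decide)
    (latticePoints_eq_range_of_facets
      [(-1, -3, 3, 1), (-1, 1, -1, 1), (-1, 5, -1, 1), (3, -3, -1, 1)]
      ![-2, -1, -2] ![1, 1, 1] (by decide) (by decide) (by decide +kernel))
    0 1 2 3 (by decide) (by decide) (by decide) (by decide) (by decide) (by decide) (-1) (by decide)
    (by decide)
    (fun a b c h => by
      simp [Fin.forall_fin_succ, points, tableWidth] at h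
      omega)
    0 1 0 (-1) (by decide) (by decide)

lemma rowValid_s41_5 : s41_5.RowValid :=
  rowValid_of (by decide)
    (latticePoints_eq_range_of_facets
      [(-2, 1, -2, 2), (-1, -2, 4, 1), (-1, 3, -1, 1), (4, -2, -1, 1)]
      ![-1, -1, -1] ![1, 2, 1] (by decide) (by decide) (by decide +kernel))
    0 1 2 3 (by decide) (by decide) (by decide) (by decide) (by decide) (by decide) (-1) (by decide)
    (by decide)
    (fun a b c h => by
      simp [Fin.forall_fin_succ, points, tableWidth] at h
      omega)
    1 0 0 (-1) (by decide) (by decide)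

lemma rowValid_s41_7 : s41_7.RowValid :=
  rowValid_of (by decide)
    (latticePoints_eq_range_of_facets
      [(-3, 1, -3, 3), (-2, 3, -2, 2), (-1, -2, 6, 1), (6, -2, -1, 1)]
      ![-1, -2, -1] ![1, 3, 1] (by decide) (by decide) (by decide +kernel))
    0 1 2 3 (by decide) (by decide) (by decide) (by decide) (by decide) (by decide) (-1) (by decide)
    (by decide)
    (fun a b c h => by
      simp [Fin.forall_fin_succ, points, tableWidth] at h
      omega)
    1 0 0 (-1) (by decide) (by decide)

lemma rowValid_s41_11 : s41_11.RowValid :=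
  rowValid_of (by decide)
    (latticePoints_eq_range_of_facets
      [(-5, 2, -5, 5), (-3, -1, 8, 3), (-2, 3, -2, 2), (10, -4, -1, 1)]
      ![-1, -2, -1] ![2, 5, 1] (by decide) (by decide) (by decide +kernel))
    0 1 2 3 (by decide) (by decide) (by decide) (by decide) (by decide) (by decide) (-1) (by decide)
    (by decide)
    (fun a b c h => by
      simp [Fin.forall_fin_succ, points, tableWidth] at h
      omega)
    0 0 1 (-1) (by decide) (by decide)

lemma rowValid_s41_13 : s41_13.RowValid :=
  rowValid_of (by decide)
    (latticePoints_eq_range_of_facets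
      [(-5, 2, -5, 5), (-4, -1, 9, 4), (-1, 3, -1, 1), (10, -4, -3, 3)]
      ![-1, -1, -1] ![2, 5, 1] (by decide) (by decide) (by decide +kernel))
    0 1 2 3 (by decide) (by decide) (by decide) (by decide) (by decide) (by decide) (-1) (by decide)
    (by decide)
    (fun a b c h => by
      simp [Fin.forall_fin_succ, points, tableWidth] at h
      omega)
    0 0 1 (-1) (by decide) (by decide)

lemma rowValid_s41_17 : s41_17.RowValid :=
  rowValid_of (by decide)
    (latticePoints_eq_range_of_facets
      [(-7, 2, -7, 7), (-5, -1, 12, 5), (-2, 3, -2, 2), (14, -4, -3, 3)]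
      ![-1, -2, -1] ![2, 7, 1] (by decide) (by decide) (by decide +kernel))
    0 1 2 3 (by decide) (by decide) (by decide) (by decide) (by decide) (by decide) (-1) (by decide)
    (by decide)
    (fun a b c h => by
      simp [Fin.forall_fin_succ, points, tableWidth] at h
      omega)
    0 0 1 (-1) (by decide) (by decide)

lemma rowValid_s41_19 : s41_19.RowValid :=
  rowValid_of (by decide)
    (latticePoints_eq_range_of_facets
      [(-7, 3, -7, 7), (-4, -1, 15, 4), (-3, 4, -3, 3), (14, -6, -5, 5)]
      ![-2, -3, -1] ![3, 7, 1] (by decide) (by decide) (by decide +kernel))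
    0 1 2 3 (by decide) (by decide) (by decide) (by decide) (by decide) (by decide) (-1) (by decide)
    (by decide)
    (fun a b c h => by
      simp [Fin.forall_fin_succ, points, tableWidth] at h
      omega)
    0 0 1 (-1) (by decide) (by decide)

lemma rowValid_s41_20 : s41_20.RowValid :=
  rowValid_of (by decide)
    (latticePoints_eq_range_of_facets
      [(-5, -2, 15, 5), (-5, 2, -5, 5), (-5, 6, -5, 5), (15, -6, -5, 5)]
      ![-3, -5, -2] ![2, 5, 1] (by decide) (by decide) (by decide +kernel))
    0 1 2 3 (by decide) (by decide) (by decide) (by decide) (by decide) (by decide) (-1) (by decide)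
    (by decide)
    (fun a b c h => by
      simp [Fin.forall_fin_succ, points, tableWidth] at h
      omega)
    1 0 (-1) (-1) (by decide) (by decide)

end TableEntry

namespace TableEntry

lemma latticePoints_s21 {p q : ℤ} (hp : 0 ≤ p) (hpq : 2 * p ≤ q) (hgcd : Int.gcd p q = 1)
    (hq : 0 < q) : latticePoints (s21 p q hp hpq hgcd).polytope =
      Set.range (s21 p q hp hpq hgcd).points := by
  refine latticePoints_eq_range fun x y z hv => ?_
  have b (a b c d) := affine_nonneg_of_mem hv a b c d
  simp only [points, Fin.forall_fin_succ, Matrix.cons_val, Matrix.cons_val_zero, Matrix.cons_val_one, Matrix.cons_val_succ,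
    IsEmpty.forall_iff, and_true, mul_zero, mul_one, add_zero, zero_add] at b
  have hz0 := b 0 0 1 0 (by omega)
  have hz1 := b 0 0 (-1) 1 (by omega)
  have hy := b 0 1 0 0 (by omega)
  have hyq := b 0 (-1) q 0 (by omega)
  have hx1 := b (-1) 0 p 1 (by omega)
  have hx0 := b 1 0 0 1 (by omega)
  -- At z = 1 these two inequalities become the equation qx = py, and coprimality leaves only the
  -- ends of the upper edge.
  have h1 := b q (-p) (-q) q (by refine ⟨?_, ?_, ?_, ?_, ?_⟩ <;> linarith [mul_comm p q])
  have h2 := b (-q) p (-q) q (by refine ⟨?_, ?_, ?_, ?_, ?_⟩ <;> linarith [mul_comm p q])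
  obtain rfl | rfl : z = 0 ∨ z = 1 := by omega
  · obtain rfl : y = 0 := by linarith
    obtain rfl | rfl | rfl : x = 0 ∨ x = 1 ∨ x = -1 := by omega
    · exact ⟨0, rfl⟩
    · exact ⟨1, rfl⟩
    · exact ⟨3, rfl⟩
  · have hxy : q * x = p * y := by linarith
    obtain ⟨t, rfl⟩ : q ∣ y :=
      (Int.isCoprime_iff_gcd_eq_one.2 hgcd).symm.dvd_of_dvd_mul_left ⟨x, hxy.symm⟩
    obtain rfl : x = p * t := mul_left_cancel₀ hq.ne' (by linarith)
    have ht0 : 0 ≤ t := by nlinarith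
    have ht1 : t ≤ 1 := by nlinarith
    obtain rfl | rfl : t = 0 ∨ t = 1 := by omega
    · exact ⟨2, by simp [points]⟩
    · exact ⟨4, by simp [points]⟩

lemma latticePoints_s32 {a b : ℤ} (ha : 0 < a) (hab : a ≤ b) (hgcd : Int.gcd a b = 1) :
    latticePoints (s32 a b ha hab hgcd).polytope = Set.range (s32 a b ha hab hgcd).points := by
  refine latticePoints_eq_range fun x y z hv => ?_
  have f (a b c d) := affine_nonneg_of_mem hv a b c d
  simp only [points, Fin.forall_fin_succ, Matrix.cons_val, Matrix.cons_val_zero, Matrix.cons_val_one, Matrix.cons_val_succ,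
    IsEmpty.forall_iff, and_true, mul_zero, mul_one, add_zero, zero_add] at f
  have hz0 := f 0 0 1 0 (by omega)
  have hz1 := f 0 0 (-1) 1 (by omega)
  have hx0 := f 1 0 0 0 (by omega)
  have hy0 := f 0 1 0 0 (by omega)
  have hxy1 := f (-1) (-1) (a + b - 1) 1 (by omega)
  have hxa := f (-1) 0 (a - 1) 1 (by omega)
  have h1 := f b (-a) (-a) a (by refine ⟨?_, ?_, ?_, ?_, ?_⟩ <;> linarith [mul_comm a b])
  have h2 := f (-b) a (-b) b (by refine ⟨?_, ?_, ?_, ?_, ?_⟩ <;> linarith [mul_comm a b])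
  obtain rfl | rfl : z = 0 ∨ z = 1 := by omega
  · obtain ⟨rfl, rfl⟩ | ⟨rfl, rfl⟩ | ⟨rfl, rfl⟩ :
        (x = 0 ∧ y = 0) ∨ (x = 1 ∧ y = 0) ∨ (x = 0 ∧ y = 1) := by omega
    · exact ⟨0, rfl⟩
    · exact ⟨1, rfl⟩
    · exact ⟨2, rfl⟩
  · have hxy : b * x = a * y := by linarith
    obtain ⟨t, rfl⟩ : a ∣ x :=
      (Int.isCoprime_iff_gcd_eq_one.2 hgcd).dvd_of_dvd_mul_left ⟨y, hxy⟩
    obtain rfl : y = b * t := mul_left_cancel₀ ha.ne' (by linarith)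
    have ht0 : 0 ≤ t := by nlinarith
    have ht1 : t ≤ 1 := by nlinarith
    obtain rfl | rfl : t = 0 ∨ t = 1 := by omega
    · exact ⟨3, by simp [points]⟩
    · exact ⟨4, by simp [points]⟩

lemma pos_of_gcd_eq_one {p q : ℤ} (hp : 0 ≤ p) (hpq : 2 * p ≤ q) (hgcd : Int.gcd p q = 1) :
    0 < q := by
  rcases (show 0 ≤ q by omega).lt_or_eq with h | rfl
  · exact h
  · obtain rfl : p = 0 := by omega
    simp at hgcd

lemma rowValid_s21 {p q : ℤ} (hp : 0 ≤ p) (hpq : 2 * p ≤ q) (hgcd : Int.gcd p q = 1) :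
    (s21 p q hp hpq hgcd).RowValid := by
  have hq := pos_of_gcd_eq_one hp hpq hgcd
  refine rowValid_of ?_ (latticePoints_s21 hp hpq hgcd hq) 0 1 2 4 ?_ ?_ ?_ ?_ ?_ ?_ 1 (.inl rfl)
    ?_ ?_ 0 0 1 0 (by decide) ?_
  · intro i j h
    have h0 := congrFun h 0
    have h1 := congrFun h 1
    have h2 := congrFun h 2
    fin_cases i <;> fin_cases j <;> simp [points] at h0 h1 h2 ⊢ <;> omega
  · simp [points, det3, hq.ne']
  · simp [tableVolumeVector, hq.ne']
  · simp [Fin.sum_univ_five, tableVolumeVector]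
    ring
  · ext i
    fin_cases i <;> simp [Fin.sum_univ_five, tableVolumeVector, points]
  · rw [Finset.card_filter, Fin.sum_univ_five]
    simp [tableVolumeVector, tableSignature, hq, hq.le]
  · rw [Finset.card_filter, Fin.sum_univ_five]
    simp [tableVolumeVector, tableSignature, hq, hq.not_gt]
  · intro k
    fin_cases k <;> simp [tableVolumeVector, points, det3, Fin.succAbove]
  · intro a b c h
    have h1 := h 1 0
    have h2 := h 0 1
    have h3 := h 2 0
    have h4 := h 0 2
    have h5 := h 4 0
    have h6 := h 0 4
    simp [points, tableWidth] at h1 h2 h3 h4 h5 h6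
    obtain rfl : a = 0 := by omega
    obtain rfl : c = 0 := by omega
    refine ⟨rfl, (mul_eq_zero.1 (show b * q = 0 by omega)).resolve_right hq.ne', rfl⟩
  · intro k
    fin_cases k <;> simp [points, tableWidth]

lemma rowValid_s32 {a b : ℤ} (ha : 0 < a) (hab : a ≤ b) (hgcd : Int.gcd a b = 1) :
    (s32 a b ha hab hgcd).RowValid := by
  have hb : 0 < b := ha.trans_le hab
  refine rowValid_of ?_ (latticePoints_s32 ha hab hgcd) 0 1 2 3 ?_ ?_ ?_ ?_ ?_ ?_ (-1) (.inr rfl)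
    ?_ ?_ 0 0 1 0 (by decide) ?_
  · intro i j h
    have h0 := congrFun h 0
    have h1 := congrFun h 1
    have h2 := congrFun h 2
    fin_cases i <;> fin_cases j <;> simp [points] at h0 h1 h2 ⊢ <;> omega
  · simp [points, det3]
  · simp [tableVolumeVector]
    omega
  · simp [Fin.sum_univ_five, tableVolumeVector]
    ring
  · ext i
    fin_cases i <;> simp [Fin.sum_univ_five, tableVolumeVector, points]
  · rw [Finset.card_filter, Fin.sum_univ_five]
    simp [tableVolumeVector, tableSignature, ha, hb, (show ¬ b < -a by omega)]
  · rw [Finset.card_filter, Fin.sum_univ_five]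
    simp [tableVolumeVector, tableSignature, ha.not_gt, hb.not_gt, (show -a < b by omega)]
  · intro k
    fin_cases k <;> simp [tableVolumeVector, points, det3, Fin.succAbove]
    ring
  · intro a b c h
    have h1 := h 1 0
    have h2 := h 0 1
    have h3 := h 2 0
    have h4 := h 0 2
    have h5 := h 3 0
    have h6 := h 0 3
    simp [points, tableWidth] at h1 h2 h3 h4 h5 h6
    omega
  · intro k
    fin_cases k <;> simp [points, tableWidth]

theorem rowValid (e : TableEntry) : e.RowValid := by
  cases e with
  | s22 => exact rowValid_s22
  | s21 p q hp hpq hgcd => exact rowValid_s21 hp hpq hgcd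
  | s32 a b ha hab hgcd => exact rowValid_s32 ha hab hgcd
  | s31_3 => exact rowValid_s31_3
  | s31_9 => exact rowValid_s31_9
  | s41_4 => exact rowValid_s41_4
  | s41_5 => exact rowValid_s41_5
  | s41_7 => exact rowValid_s41_7
  | s41_11 => exact rowValid_s41_11
  | s41_13 => exact rowValid_s41_13
  | s41_17 => exact rowValid_s41_17
  | s41_19 => exact rowValid_s41_19
  | s41_20 => exact rowValid_s41_20

end TableEntry

/-! ### Invariants under equivalence and irredundancy -/

lemma intEquiv_of_zEquivalent {P Q : Set (Fin 3 → ℝ)} {p q : Fin 5 → Fin 3 → ℤ}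
    (hP : latticePoints P = Set.range p) (hQ : latticePoints Q = Set.range q)
    (hq : Function.Injective q) (h : ZEquivalent P Q) : IntEquiv p q := by
  obtain ⟨t, ht, htPQ⟩ := h
  have hg : ∀ v, ∃ w, intPoint w = t (intPoint v) := fun v => by
    have : t (intPoint v) ∈ t '' Set.range intPoint := ⟨_, ⟨v, rfl⟩, rfl⟩
    rwa [ht] at this
  choose g hg using hg
  have hg' : ∀ v, intPoint (g v - g 0) = t.linear (intPoint v) := fun v => by
    have h1 := t.toAffineMap.decomp
    have h2 : ∀ x, t x = t.linear x + t 0 := fun x => congrFun h1 x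
    have h3 := intPoint_add (g v - g 0) (g 0)
    rw [sub_add_cancel, hg, hg, h2, show intPoint (0 : Fin 3 → ℤ) = 0 by ext; simp [intPoint]] at h3
    exact (add_right_cancel h3).symm
  set f : (Fin 3 → ℤ) →+ (Fin 3 → ℤ) :=
    { toFun := fun v => g v - g 0
      map_zero' := sub_self _
      map_add' := fun v w => intPoint_injective (by
        rw [intPoint_add, hg', hg', hg', intPoint_add, map_add]) } with hf
  have hginj : Function.Injective g := fun v w h =>
    intPoint_injective (t.injective (by rw [← hg, ← hg, h]))
  have hgsurj : Function.Surjective g := fun w => by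
    have : intPoint w ∈ Set.range intPoint := ⟨w, rfl⟩
    rw [← ht] at this
    obtain ⟨_, ⟨v, rfl⟩, hv⟩ := this
    exact ⟨v, intPoint_injective ((hg v).trans hv)⟩
  have hfbij : Function.Bijective f :=
    ⟨fun v w h => hginj (sub_left_injective h), fun w => by
      obtain ⟨v, hv⟩ := hgsurj (w + g 0)
      exact ⟨v, by simp [hf, hv]⟩⟩
  have hs : ∀ k, ∃ l, g (p l) = q k := fun k => by
    obtain ⟨v, hv⟩ := hgsurj (q k)
    have hk : intPoint (q k) ∈ t '' P := htPQ ▸ (hQ ▸ ⟨k, rfl⟩ : q k ∈ latticePoints Q)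
    obtain ⟨x, hx, hxk⟩ := hk
    rw [← hv, hg] at hxk
    have hvP : v ∈ latticePoints P := by
      rwa [t.injective hxk] at hx
    rw [hP] at hvP
    obtain ⟨l, rfl⟩ := hvP
    exact ⟨l, hv⟩
  choose s hs using hs
  refine ⟨(AddEquiv.ofBijective f hfbij).toIntLinearEquiv, g 0, s,
    Finite.injective_iff_bijective.1 fun k l h => hq (by rw [← hs, ← hs, h]), fun k => ?_⟩
  rw [← hs]
  exact (sub_add_cancel (g (p (s k))) (g 0)).symm

lemma abs_det3_equiv (E : (Fin 3 → ℤ) ≃ₗ[ℤ] (Fin 3 → ℤ)) (u v w : Fin 3 → ℤ) :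
    |det3 (E u) (E v) (E w)| = |det3 u v w| := by
  have hdet : ∀ a b c : Fin 3 → ℤ, det3 a b c = (Matrix.of ![a, b, c]).det := fun a b c => by
    simp [Matrix.det_fin_three, det3]
    ring
  set A := LinearMap.toMatrix' E.toLinearMap with hA
  have h : Matrix.of ![E u, E v, E w] = Matrix.of ![u, v, w] * A.transpose := by
    have hE : ∀ x, E x = A.mulVec x := fun x => by
      rw [hA, LinearMap.toMatrix'_mulVec]; rfl
    ext i j
    fin_cases i <;> simp [Matrix.mul_apply, hE, Matrix.mulVec, dotProduct, mul_comm]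
  have hu : IsUnit A.det := by
    rw [hA, LinearMap.det_toMatrix']
    exact E.isUnit_det'
  rw [hdet, hdet, h, Matrix.det_mul, Matrix.det_transpose, abs_mul, Int.isUnit_iff_abs_eq.1 hu,
    mul_one]

/-- A unimodular map preserves determinants up to sign, and the relabelling only permutes the four
columns left after omitting one point. -/
lemma abs_volumeVector_of_intEquiv {p q : Fin 5 → Fin 3 → ℤ}
    {E : (Fin 3 → ℤ) ≃ₗ[ℤ] (Fin 3 → ℤ)} {b : Fin 3 → ℤ} {s : Fin 5 → Fin 5}
    (hs : Function.Bijective s) (h : ∀ k, q k = E (p (s k)) + b) (k : Fin 5) :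
    |volumeVector q k| = |volumeVector p (s k)| := by
  have hτ : ∀ j, ∃ i, (s k).succAbove i = s (k.succAbove j) := fun j =>
    Fin.exists_succAbove_eq fun h => Fin.succAbove_ne k j (hs.1 h)
  choose τ hτ using hτ
  have hτb : Function.Bijective τ := Finite.injective_iff_bijective.1 fun i j h =>
    Fin.succAbove_right_injective (p := k) (hs.1 (by rw [← hτ, ← hτ, h]))
  have h1 : |volumeVector q k| = |volumeVector (fun l => p (s l)) k| := by
    rw [volumeVector_apply, volumeVector_apply, abs_mul, abs_mul]
    simp only [h, add_sub_add_right_eq_sub, ← map_sub, abs_det3_equiv]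
  rw [h1, volumeVector, volumeVector, abs_mul, abs_mul, abs_neg_one_pow, abs_neg_one_pow,
    one_mul, one_mul]
  have := Matrix.det_permute' (Equiv.ofBijective τ hτb)
    (Matrix.of fun (i j : Fin 4) => Fin.cons (α := fun _ => ℤ) 1 (p ((s k).succAbove j)) i)
  rw [show (Matrix.of fun (i j : Fin 4) =>
      Fin.cons (α := fun _ => ℤ) 1 (p (s (k.succAbove j))) i) =
      (Matrix.of fun (i j : Fin 4) =>
        Fin.cons (α := fun _ => ℤ) 1 (p ((s k).succAbove j)) i).submatrix id
        (Equiv.ofBijective τ hτb) by ext i j; simp [hτ], this, abs_mul]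
  rcases Int.units_eq_one_or (Equiv.Perm.sign (Equiv.ofBijective τ hτb)) with h | h <;> simp [h]

namespace TableEntry

/-- The unimodular invariance of the normalized volumes of the table. -/
lemma exists_equiv_of_zEquivalent {e e' : TableEntry} (h : ZEquivalent e.polytope e'.polytope) :
    ∃ (E : (Fin 3 → ℤ) ≃ₗ[ℤ] (Fin 3 → ℤ)) (b : Fin 3 → ℤ) (s : Fin 5 ≃ Fin 5),
      (∀ k, e'.points k = E (e.points (s k)) + b) ∧
        ∀ k, |e'.tableVolumeVector k| = |e.tableVolumeVector (s k)| := by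
  have hinj : ∀ e : TableEntry, Function.Injective e.points := fun e => by
    have h1 := (rowValid e).2.2.1
    have h2 := (rowValid e).2.2.2.1
    rw [size, h1, ← Set.image_univ] at h2
    refine Set.injOn_univ.1 ((Set.ncard_image_iff (Set.finite_univ)).1 ?_)
    rw [h2]
    simp
  have habs : ∀ (e : TableEntry) k, |e.tableVolumeVector k| = |volumeVector e.points k| :=
    fun e k => by
      rcases (rowValid e).2.2.2.2.2.1 with h | h <;> simp [h]
  obtain ⟨E, b, s, hs, hE⟩ := intEquiv_of_zEquivalent (rowValid e).2.2.1 (rowValid e').2.2.1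
    (hinj e') h
  exact ⟨E, b, Equiv.ofBijective s hs, hE, fun k => by
    rw [habs, habs, abs_volumeVector_of_intEquiv hs hE]; rfl⟩

/-- The sum of the normalized volumes. -/
def volumeSum : TableEntry → ℤ
  | s22 => 4
  | s21 _ q _ _ _ => 4 * q
  | s32 a b _ _ _ => 2 * (a + b) + 2
  | s31_3 => 6
  | s31_9 => 18
  | s41_4 => 8
  | s41_5 => 10
  | s41_7 => 14
  | s41_11 => 22
  | s41_13 => 26
  | s41_17 => 34
  | s41_19 => 38
  | s41_20 => 40

/-- The sum of the cubes of the normalized volumes. -/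
def volumeCubeSum : TableEntry → ℤ
  | s22 => 4
  | s21 _ q _ _ _ => 10 * q ^ 3
  | s32 a b _ _ _ => (a + b) ^ 3 + a ^ 3 + b ^ 3 + 2
  | s31_3 => 30
  | s31_9 => 810
  | s41_4 => 68
  | s41_5 => 136
  | s41_7 => 380
  | s41_11 => 1492
  | s41_13 => 2414
  | s41_17 => 5416
  | s41_19 => 7418
  | s41_20 => 8500

/-- The number of coplanar quadruples. -/
def zeroCount : TableEntry → ℤ
  | s22 => 1
  | s21 _ _ _ _ _ => 2
  | s32 _ _ _ _ _ => 0
  | s31_3 => 1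
  | s31_9 => 1
  | _ => 0

lemma sum_abs_tableVolumeVector (e : TableEntry) :
    ∑ k, |e.tableVolumeVector k| = e.volumeSum := by
  cases e with
  | s21 p q hp hpq hgcd =>
    have hq := pos_of_gcd_eq_one hp hpq hgcd
    simp [Fin.sum_univ_five, tableVolumeVector, volumeSum, abs_mul, abs_of_pos hq]
    ring
  | s32 a b ha hab hgcd =>
    have hb := ha.trans_le hab
    simp [Fin.sum_univ_five, tableVolumeVector, volumeSum, abs_of_pos ha, abs_of_pos hb,
      abs_of_neg (show -a - b < 0 by omega)]
    ring
  | _ => decide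

lemma sum_cube_tableVolumeVector (e : TableEntry) :
    ∑ k, |e.tableVolumeVector k| ^ 3 = e.volumeCubeSum := by
  cases e with
  | s21 p q hp hpq hgcd =>
    have hq := pos_of_gcd_eq_one hp hpq hgcd
    simp [Fin.sum_univ_five, tableVolumeVector, volumeCubeSum, abs_mul, abs_of_pos hq]
    ring
  | s32 a b ha hab hgcd =>
    have hb := ha.trans_le hab
    simp [Fin.sum_univ_five, tableVolumeVector, volumeCubeSum, abs_of_pos ha, abs_of_pos hb,
      abs_of_neg (show -a - b < 0 by omega)]
    ring
  | _ => decide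

lemma sum_zero_tableVolumeVector (e : TableEntry) :
    ∑ k, (if |e.tableVolumeVector k| = 0 then 1 else 0) = e.zeroCount := by
  cases e with
  | s21 p q hp hpq hgcd =>
    have hq := pos_of_gcd_eq_one hp hpq hgcd
    rw [Fin.sum_univ_five]
    simp [tableVolumeVector, zeroCount, hq.ne']
  | s32 a b ha hab hgcd =>
    have hb := ha.trans_le hab
    rw [Fin.sum_univ_five]
    simp [tableVolumeVector, zeroCount, ha.ne', hb.ne',
      (show -a - b ≠ 0 by omega)]
  | _ => decide

lemma eq_of_dvd_sub_or_add {p p' q : ℤ} (hp : 0 ≤ p) (hpq : 2 * p ≤ q) (hp' : 0 ≤ p')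
    (hpq' : 2 * p' ≤ q) (hq : 0 < q) (h : q ∣ p' - p ∨ q ∣ p' + p) : p = p' := by
  rcases h with ⟨x, hx⟩ | ⟨x, hx⟩
  · have h1 : -1 < x := by nlinarith
    have h2 : x < 1 := by nlinarith
    obtain rfl : x = 0 := by omega
    omega
  · have h1 : -1 < x := by nlinarith
    have h2 : x < 2 := by nlinarith
    obtain rfl | rfl : x = 0 ∨ x = 1 := by omega
    · omega
    · omega

/-- The absolute volumes 2q, q and 0 distinguish the midpoint, the ends of the collinear triple and
the opposite edge. The equivalence thus fixes the origin, sends e₁ to ±e₁ and preserves that edge,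
whose first coordinate is p modulo q up to sign. -/
lemma s21_param_eq {p p' q : ℤ} {hp : 0 ≤ p} {hpq : 2 * p ≤ q} {hgcd : Int.gcd p q = 1}
    {hp' : 0 ≤ p'} {hpq' : 2 * p' ≤ q} {hgcd' : Int.gcd p' q = 1}
    (h : ZEquivalent (s21 p q hp hpq hgcd).polytope (s21 p' q hp' hpq' hgcd').polytope) :
    p = p' := by
  have hq := pos_of_gcd_eq_one hp hpq hgcd
  refine eq_of_dvd_sub_or_add hp hpq hp' hpq' hq ?_
  obtain ⟨E, b, s, hE, hs⟩ := exists_equiv_of_zEquivalent h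
  simp only [tableVolumeVector] at hs
  have val : ∀ k : Fin 5, |(![-2 * q, q, 0, q, 0] : Fin 5 → ℤ) k| =
      (![2 * q, q, 0, q, 0] : Fin 5 → ℤ) k := fun k => by
    fin_cases k <;> simp [abs_mul, abs_of_pos hq]
  simp only [val] at hs
  have s0 : s 0 = 0 := by
    have := hs 0
    revert this
    generalize s 0 = j
    fin_cases j <;> simp <;> omega
  have s1 : s 1 = 1 ∨ s 1 = 3 := by
    have := hs 1
    revert this
    generalize s 1 = j
    fin_cases j <;> simp <;> omega
  have s2 : s 2 = 2 ∨ s 2 = 4 := by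
    have := hs 2
    revert this
    generalize s 2 = j
    fin_cases j <;> simp <;> omega
  have s4 : s 4 = 2 ∨ s 4 = 4 := by
    have := hs 4
    revert this
    generalize s 4 = j
    fin_cases j <;> simp <;> omega
  have s24 : s 2 ≠ s 4 := fun h => absurd (s.injective h) (by decide)
  obtain rfl : b = 0 := by
    have h0 : (![0, 0, 0] : Fin 3 → ℤ) = E ![0, 0, 0] + b := by
      have := hE 0
      rwa [s0] at this
    rw [show (![0, 0, 0] : Fin 3 → ℤ) = 0 by decide, map_zero, zero_add] at h0
    exact h0.symm
  have key : E ![p, q, 1] = p • E ![1, 0, 0] + q • E ![0, 1, 0] + E ![0, 0, 1] := by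
    rw [← map_smul, ← map_smul, ← map_add, ← map_add]
    congr 1
    ext i
    fin_cases i <;> simp
  have key0 : E ![p, q, 1] 0 = p * E ![1, 0, 0] 0 + q * E ![0, 1, 0] 0 + E ![0, 0, 1] 0 :=
    congrFun key 0
  have e1 := hE 1
  have e2 := hE 2
  have e4 := hE 4
  have hneg : E ![-1, 0, 0] = -E ![1, 0, 0] := by
    rw [← map_neg]
    congr 1
    ext i
    fin_cases i <;> simp
  have ε : E ![1, 0, 0] 0 = 1 ∨ E ![1, 0, 0] 0 = -1 := by
    rcases s1 with s1 | s1 <;> rw [s1] at e1 <;> have := congrFun e1 0 <;>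
      simp [points, hneg] at this <;> omega
  have hmain : p' = p * E ![1, 0, 0] 0 + q * E ![0, 1, 0] 0 ∨
      0 = p * E ![1, 0, 0] 0 + q * E ![0, 1, 0] 0 + p' := by
    rcases s2 with s2 | s2
    · have s4' : s 4 = 4 := s4.resolve_left fun h => s24 (s2.trans h.symm)
      rw [s2] at e2
      rw [s4'] at e4
      have h2 : 0 = E ![0, 0, 1] 0 + 0 := congrFun e2 0
      have h4 : p' = E ![p, q, 1] 0 + 0 := congrFun e4 0
      left
      linarith
    · have s4' : s 4 = 2 := s4.resolve_right fun h => s24 (s2.trans h.symm)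
      rw [s2] at e2
      rw [s4'] at e4
      have h2 : 0 = E ![p, q, 1] 0 + 0 := congrFun e2 0
      have h4 : p' = E ![0, 0, 1] 0 + 0 := congrFun e4 0
      right
      linarith
  generalize E ![0, 1, 0] 0 = x at hmain
  rcases hmain with h | h <;> rcases ε with hε | hε <;> rw [hε] at h
  · exact .inl ⟨x, by linarith⟩
  · exact .inr ⟨x, by linarith⟩
  · exact .inr ⟨-x, by linarith⟩
  · exact .inl ⟨-x, by linarith⟩

lemma exists_mem_Icc_of_volumeSum {a b v r : ℤ} (ha : 0 < a) (hab : a ≤ b)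
    (h1 : 2 * (a + b) + 2 = v) (h2 : (a + b) ^ 3 + a ^ 3 + b ^ 3 + 2 = r) (hv : v ≤ 40) :
    ∃ a' ∈ Finset.Icc (1 : ℤ) 20, ∃ b' ∈ Finset.Icc (1 : ℤ) 20,
      2 * (a' + b') + 2 = v ∧ (a' + b') ^ 3 + a' ^ 3 + b' ^ 3 + 2 = r :=
  ⟨a, Finset.mem_Icc.2 ⟨by omega, by omega⟩, b, Finset.mem_Icc.2 ⟨by omega, by omega⟩, h1, h2⟩

/-- The sum and the sum of cubes determine the product, hence the unordered pair. -/
lemma s32_params_eq {a b a' b' : ℤ} (ha : 0 < a) (hab : a ≤ b) (hab' : a' ≤ b')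
    (h1 : a + b = a' + b') (h2 : a ^ 3 + b ^ 3 = a' ^ 3 + b' ^ 3) : a = a' ∧ b = b' := by
  have hb : 0 < a' + b' := by omega
  obtain rfl : b = a' + b' - a := by omega
  have h : (a' + b') * ((a - a') * (a - b')) = 0 := by linarith
  rcases mul_eq_zero.1 ((mul_eq_zero.1 h).resolve_left hb.ne') with h | h <;> constructor <;> omega

theorem eq_of_zEquivalent {e e' : TableEntry} (h : ZEquivalent e.polytope e'.polytope) :
    e = e' := by
  obtain ⟨h1, h2, h3⟩ : e.volumeSum = e'.volumeSum ∧ e.volumeCubeSum = e'.volumeCubeSum ∧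
      e.zeroCount = e'.zeroCount := by
    obtain ⟨E, b, s, -, hs⟩ := exists_equiv_of_zEquivalent h
    have comm : ∀ F : ℤ → ℤ, ∑ k, F |e.tableVolumeVector k| = ∑ k, F |e'.tableVolumeVector k| :=
      fun F => by
        simp only [hs]
        exact (s.sum_comp fun k => F |e.tableVolumeVector k|).symm
    rw [← sum_abs_tableVolumeVector, ← sum_abs_tableVolumeVector, ← sum_cube_tableVolumeVector,
      ← sum_cube_tableVolumeVector, ← sum_zero_tableVolumeVector, ← sum_zero_tableVolumeVector]
    exact ⟨comm id, comm fun x => x ^ 3, comm fun x => if x = 0 then 1 else 0⟩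
  cases e <;> cases e' <;>
    first
    | rfl
    | (exfalso; revert h1; decide)
    | dsimp only [volumeSum, volumeCubeSum, zeroCount] at h1 h2 h3
  all_goals try omega
  -- What can still collide is a (3,2) entry and a sporadic row: the bounded volume sum leaves
  -- finitely many parameters, and the cube sums exclude them.
  all_goals try
    rename_i ha hab _
    first
    | exact absurd (exists_mem_Icc_of_volumeSum ha hab h1 h2 (by decide)) (by decide +kernel)
    | exact absurd (exists_mem_Icc_of_volumeSum ha hab h1.symm h2.symm (by decide))
        (by decide +kernel)
  · rename_i p q hp hpq hgcd p' q' hp' hpq' hgcd'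
    obtain rfl : q = q' := by omega
    obtain rfl := s21_param_eq h
    rfl
  · rename_i a b ha hab hgcd a' b' ha' hab' hgcd'
    obtain ⟨rfl, rfl⟩ := s32_params_eq ha hab hab' (by omega) (by
      rw [show a + b = a' + b' by omega] at h2
      linarith)
    rfl

end TableEntry

end LatticePolytopes

theorem mainTheorem3 :
    -- every entry of the table is a lattice 3-polytope of size 5 with the listed invariants
    (∀ e : LatticePolytopes.TableEntry,
      LatticePolytopes.IsLatticePolytope e.polytope ∧
      LatticePolytopes.IsFullDimensional e.polytope ∧
      LatticePolytopes.latticePoints e.polytope = Set.range e.points ∧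
      LatticePolytopes.size e.polytope = 5 ∧
      LatticePolytopes.HasSignature e.polytope e.tableSignature ∧
      (e.tableVolumeVector = LatticePolytopes.volumeVector e.points ∨
        e.tableVolumeVector = -LatticePolytopes.volumeVector e.points) ∧
      LatticePolytopes.HasWidth e.polytope (e.tableWidth : ℝ)) ∧
    -- completeness
    (∀ P : Set (Fin 3 → ℝ),
      LatticePolytopes.IsLatticePolytope P → LatticePolytopes.IsFullDimensional P →
      LatticePolytopes.size P = 5 →
      ∃ e : LatticePolytopes.TableEntry, LatticePolytopes.ZEquivalent P e.polytope) ∧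
    -- irredundancy
    (∀ e e' : LatticePolytopes.TableEntry,
      LatticePolytopes.ZEquivalent e.polytope e'.polytope → e = e') := by
  exact ⟨LatticePolytopes.TableEntry.rowValid,
    fun _ hP hfull hsize => LatticePolytopes.exists_zEquivalent_polytope hP hfull hsize,
    fun _ _ h => LatticePolytopes.TableEntry.eq_of_zEquivalent h⟩
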